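/- Let $\mathfrak g$ be a complex semisimple Lie algebra with a compact form, and let $(\xi_a)_{a\in A}$ be a basis of $\mathfrak g$ consisting of self-adjoint elements (for the hermitian involution defined by the compact form) that is orthonormal for the Killing form. For $m\ge 0$ let $\psi^a(-m)$ and $\sigma^a(-m)$ denote the basis dual to $z^m\xi_a$ in two copies of the restricted dual of $\mathfrak g[z]$, and write $\psi^{[a,b]}(n)=\mathrm{ad}^*_{\xi_a}\psi^b(n)$, $\sigma^{[a,b]}(n)=\mathrm{ad}^*_{\xi_a}\sigma^b(n)$ for the coadjoint translates. Let $\Lambda\otimes S=\Lambda(\mathfrak g[z]/\mathfrak g)^*_{res}\otimes S\,\mathfrak g[z]^*_{res}$ be the free supercommutative algebra on the odd generators $\psi^a(n)$, $n<0$, and the even generators $\sigma^a(n)$, $n\le 0$. Give it the hermitian metric which is the multilinear extension (Gram determinants on $\Lambda$, permanents on $S$) of $\langle\sigma^a(n)|\sigma^a(n)\rangle=1$, $\langle\psi^a(n)|\psi^a(n)\rangle=-1/n$, all other products of generators being zero. For $a\in A$, $m\in\mathbb Z$ define derivations of $\Lambda\otimes S$ by their values on generators (even derivations in the first two lines, odd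 ones in the last two; values not listed are $0$, and $\psi^{[a,b]}(k)$ is read as $0$ for $k\ge 0$, $\sigma^{[a,b]}(k)$ as $0$ for $k>0$): $$\begin{aligned} &\mathrm{ad}_a(m):\psi^b(n)\mapsto\psi^{[a,b]}(m+n), && R_a(m):\sigma^b(n)\mapsto\sigma^{[a,b]}(m+n),\\ &\mathrm{ad}_a(m)^*:\psi^b(n)\mapsto\tfrac{n-m}{n}\,\psi^{[a,b]}(n-m), && \\ &d_a(m):\sigma^b(n)\mapsto\psi^{[a,b]}(m+n), && \\ &d_a(m)^*:\psi^b(n)\mapsto-\tfrac1n\,\sigma^{[a,b]}(n-m). && \end{aligned}$$ For $m>0$ let $\psi^a(-m)$ also denote left multiplication by $\psi^a(-m)$, and let $\psi^a(-m)^*=\frac1m\,\partial/\partial\psi^a(-m)$. Put $$\bar\partial=\sum_{a;\,m>0}\Big(\psi^a(-m)R_a(m)+\tfrac12\psi^a(-m)\,\mathrm{ad}_a(m)\Big),\qquad \bar\partial^*=\sum_{a;\,m>0}\Big(\psi^a(-m)^*R_a(-m)+\tfrac12\,\mathrm{ad}_a(m)^*\psi^a(-m)^*\Big),$$ $$\overline\square=\bar\partial\bar\partial^*+\bar\partial^*\bar\partial,\qquad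 D=\sum_{a;\,m>0}d_a(-m)\,d_a(-m)^*,$$ $$\square=\sum_{a;\,m>0}\tfrac1m\big[R_a(-m)+\mathrm{ad}_a(-m)\big]\big[R_a(m)+\mathrm{ad}_a(-m)^*\big]$$ (all these sums are finite on each element). Let $C^\bullet\subset\Lambda\otimes S$ be the subspace of $\mathfrak g$-invariants, i.e. the joint kernel of the operators $R_a(0)+\mathrm{ad}_a(0)$, $a\in A$. **Theorem.** (0) For all $a\in A$ and $m\in\mathbb Z$ the hermitian adjoints of $\mathrm{ad}_a(m)$, $R_a(m)$, $d_a(m)$ are $\mathrm{ad}_a(m)^*$, $R_a(-m)$, $d_a(m)^*$; for $m>0$ the adjoint of multiplication by $\psi^a(-m)$ is $\psi^a(-m)^*$; and the adjoint of $\bar\partial$ is $\bar\partial^*$. Both $\bar\partial$ and $\bar\partial^*$ preserve $C^\bullet$, and $\bar\partial^2=0$ on $C^\bullet$. (1) On $C^\bullet$, $\overline\square=\square+D$. (2) An element of $\Lambda\otimes S$ is a harmonic cocycle, i.e. lies in $C^\bullet$ and is killed by $\bar\partial$ and by $\overline\square$, if and only if it lies in the joint kernel of the derivations $d_a(-m)^*$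 ($a\in A$, $m>0$) and $R_a(m)+\mathrm{ad}_a(-m)^*$ ($a\in A$, $m\ge 0$). (3) The harmonic cocycles form a subalgebra of $\Lambda\otimes S$. -/

import Mathlib

open scoped TensorProduct

noncomputable section

namespace LoopKoszul

/-! ### The Lie algebra and its Fourier basis -/

/-- A compact form of a complex Lie algebra, given by its conjugation `θ`: a conjugate-linear
involutive automorphism of the Lie algebra whose real form `{x | θ x = x}` has negative definite
Killing form. The corresponding hermitian involution is `x ↦ -θ x`. -/
structure CompactForm (𝔤 : Type*) [LieRing 𝔤] [LieAlgebra ℂ 𝔤] where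
  conj : 𝔤 →ₛₗ[starRingEnd ℂ] 𝔤
  conj_conj : ∀ x, conj (conj x) = x
  conj_lie : ∀ x y, conj ⁅x, y⁆ = ⁅conj x, conj y⁆
  negDef : ∀ x, conj x = x → x ≠ 0 → (killingForm ℂ 𝔤 x x).re < 0

/-- A basis of self-adjoint elements (fixed by the hermitian involution of the compact form),
orthonormal for the Killing form. -/
structure IsFourierBasis {𝔤 : Type*} [LieRing 𝔤] [LieAlgebra ℂ 𝔤] (θ : CompactForm 𝔤)
    {r : ℕ} (ξ : Module.Basis (Fin r) ℂ 𝔤) : Prop where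
  selfAdjoint : ∀ a, -θ.conj (ξ a) = ξ a
  orthonormal : ∀ a b, killingForm ℂ 𝔤 (ξ a) (ξ b) = if a = b then 1 else 0

/-! ### The algebra `Λ(𝔤[z]/𝔤)*_res ⊗ S 𝔤[z]*_res` -/

/-- Labels `(n, a)` of the odd generators `ψᵃ(n)`, `n < 0`. -/
abbrev OddIdx (r : ℕ) : Type := {n : ℤ // n < 0} ×ₗ Fin r

/-- Labels `(n, a)` of the even generators `σᵃ(n)`, `n ≤ 0`. -/
abbrev EvenIdx (r : ℕ) : Type := {n : ℤ // n ≤ 0} × Fin r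

/-- `Λ ⊗ S`: the exterior algebra on the restricted dual of `𝔤[z]/𝔤`, which has the basis
`ψᵃ(-m)` (`m > 0`) dual to `zᵐ ξ_a`, tensored with the symmetric algebra on the restricted dual
of `𝔤[z]`, which has the basis `σᵃ(-m)` (`m ≥ 0`) dual to `zᵐ ξ_a`. -/
abbrev Forms (r : ℕ) : Type :=
  ExteriorAlgebra ℂ (OddIdx r →₀ ℂ) ⊗[ℂ] MvPolynomial (EvenIdx r) ℂ

variable {r : ℕ}

/-- `ψᵃ(n)` for `n < 0`, and zero for `n ≥ 0`. -/
def psi (a : Fin r) (n : ℤ) : Forms r :=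
  if h : n < 0 then
    ExteriorAlgebra.ι ℂ (Finsupp.single (toLex ((⟨n, h⟩ : {n : ℤ // n < 0}), a)) (1 : ℂ)) ⊗ₜ 1
  else 0

/-- `σᵃ(n)` for `n ≤ 0`, and zero for `n > 0`. -/
def sigma (a : Fin r) (n : ℤ) : Forms r :=
  if h : n ≤ 0 then 1 ⊗ₜ MvPolynomial.X ((⟨n, h⟩ : {n : ℤ // n ≤ 0}), a) else 0

/-! ### Locally finite sums of operators, derivations -/

/-- A family of operators is locally finite if only finitely many of them are non-zero on any
given vector. -/
def LocFin {ι : Type*} (f : ι → Module.End ℂ (Forms r)) : Prop :=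
  ∀ x, {i | f i x ≠ 0}.Finite

/-- The sum of a locally finite family of operators. -/
def locSum {ι : Type*} (f : ι → Module.End ℂ (Forms r)) (hf : LocFin f) :
    Module.End ℂ (Forms r) where
  toFun x := ∑ᶠ i, f i x
  map_add' x y := by
    simp only [map_add]
    exact finsum_add_distrib (hf x) (hf y)
  map_smul' c x := by
    simp only [map_smul, RingHom.id_apply]
    exact (smul_finsum c fun i => f i x).symm

theorem LocFin.comp {ι : Type*} {f : ι → Module.End ℂ (Forms r)} (hf : LocFin f)
    (g : ι → Module.End ℂ (Forms r)) : LocFin fun i => g i * f i := by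
  intro x
  refine (hf x).subset fun i hi h => hi ?_
  simp [h]

theorem LocFin.add {ι : Type*} {f g : ι → Module.End ℂ (Forms r)} (hf : LocFin f)
    (hg : LocFin g) : LocFin fun i => f i + g i := by
  intro x
  refine ((hf x).union (hg x)).subset fun i hi => ?_
  by_contra h
  simp only [Set.mem_union, Set.mem_ofPred_eq, not_or, not_not] at h
  exact hi (by simp [h.1, h.2])

/-- Left multiplication by a form. -/
abbrev lmul (x : Forms r) : Module.End ℂ (Forms r) := LinearMap.mulLeft ℂ x

/-- The odd partial derivative `∂/∂ψᵃ(n)`, contraction with a vector of the dual basis. -/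
def dpsi (i : OddIdx r) : Module.End ℂ (Forms r) :=
  LinearMap.rTensor (MvPolynomial (EvenIdx r) ℂ)
    (CliffordAlgebra.contractLeft (Q := (0 : QuadraticForm ℂ (OddIdx r →₀ ℂ)))
      (Finsupp.lapply i : (OddIdx r →₀ ℂ) →ₗ[ℂ] ℂ))

/-- The partial derivative `∂/∂σᵃ(n)`. -/
def dsigma (j : EvenIdx r) : Module.End ℂ (Forms r) :=
  LinearMap.lTensor (ExteriorAlgebra ℂ (OddIdx r →₀ ℂ)) (MvPolynomial.pderiv j).toLinearMap

theorem locFin_dpsi : LocFin (dpsi (r := r)) := by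
  intro x
  induction x using TensorProduct.induction_on with
  | zero => simp
  | add x y hx hy =>
    refine (hx.union hy).subset fun i hi => ?_
    by_contra h
    simp only [Set.mem_union, Set.mem_ofPred_eq, not_or, not_not] at h
    exact hi (by simp [h.1, h.2])
  | tmul x s =>
    have key : {i : OddIdx r | CliffordAlgebra.contractLeft
        (Q := (0 : QuadraticForm ℂ (OddIdx r →₀ ℂ)))
        (Finsupp.lapply i : (OddIdx r →₀ ℂ) →ₗ[ℂ] ℂ) x ≠ 0}.Finite := by
      induction x using CliffordAlgebra.left_induction with
      | algebraMap c => simp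
      | add x y hx hy =>
        refine (hx.union hy).subset fun i hi => ?_
        by_contra h
        simp only [Set.mem_union, Set.mem_ofPred_eq, not_or, not_not] at h
        exact hi (by simp [h.1, h.2])
      | ι_mul x v hx =>
        refine (hx.union v.support.finite_toSet).subset fun i hi => ?_
        by_contra h
        simp only [Set.mem_union, Set.mem_ofPred_eq, not_or, not_not, Finset.mem_coe,
          Finsupp.notMem_support_iff] at h
        exact hi (by simp [CliffordAlgebra.contractLeft_ι_mul, h.1, h.2])
    refine key.subset fun i hi h => hi ?_
    simp [dpsi, h]

theorem locFin_dsigma : LocFin (dsigma (r := r)) := by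
  intro x
  induction x using TensorProduct.induction_on with
  | zero => simp
  | add x y hx hy =>
    refine (hx.union hy).subset fun i hi => ?_
    by_contra h
    simp only [Set.mem_union, Set.mem_ofPred_eq, not_or, not_not] at h
    exact hi (by simp [h.1, h.2])
  | tmul x s =>
    refine s.vars.finite_toSet.subset fun i hi => ?_
    by_contra h
    exact hi (by simp [dsigma, MvPolynomial.pderiv_eq_zero_of_notMem_vars h])

/-- The parity automorphism of the superalgebra `Λ ⊗ S`. -/
def parity : Forms r →ₐ[ℂ] Forms r :=
  Algebra.TensorProduct.map
    (CliffordAlgebra.involute (Q := (0 : QuadraticForm ℂ (OddIdx r →₀ ℂ))))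
    (AlgHom.id ℂ (MvPolynomial (EvenIdx r) ℂ))

/-- `∂/∂ψᵃ(n)` is an odd derivation. -/
theorem dpsi_mul (i : OddIdx r) (x y : Forms r) :
    dpsi i (x * y) = dpsi i x * y + parity x * dpsi i y := by
  have key : ∀ a b : ExteriorAlgebra ℂ (OddIdx r →₀ ℂ), CliffordAlgebra.contractLeft
      (Q := (0 : QuadraticForm ℂ (OddIdx r →₀ ℂ)))
      (Finsupp.lapply i : (OddIdx r →₀ ℂ) →ₗ[ℂ] ℂ) (a * b) =
      CliffordAlgebra.contractLeft (Q := (0 : QuadraticForm ℂ (OddIdx r →₀ ℂ)))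
        (Finsupp.lapply i : (OddIdx r →₀ ℂ) →ₗ[ℂ] ℂ) a * b +
      CliffordAlgebra.involute (Q := (0 : QuadraticForm ℂ (OddIdx r →₀ ℂ))) a *
        CliffordAlgebra.contractLeft (Q := (0 : QuadraticForm ℂ (OddIdx r →₀ ℂ)))
          (Finsupp.lapply i : (OddIdx r →₀ ℂ) →ₗ[ℂ] ℂ) b := by
    intro a b
    induction a using CliffordAlgebra.left_induction with
    | algebraMap c => simp [CliffordAlgebra.contractLeft_algebraMap_mul]
    | add x y hx hy => simp only [add_mul, map_add, hx, hy]; abel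
    | ι_mul x v hx =>
      rw [mul_assoc, CliffordAlgebra.contractLeft_ι_mul, hx, CliffordAlgebra.contractLeft_ι_mul,
        map_mul, CliffordAlgebra.involute_ι]
      simp only [mul_add, sub_mul, smul_mul_assoc, neg_mul, mul_assoc]
      abel
  induction x using TensorProduct.induction_on with
  | zero => simp
  | add x x' hx hx' => simp only [add_mul, map_add, hx, hx']; abel
  | tmul a s =>
    induction y using TensorProduct.induction_on with
    | zero => simp
    | add y y' hy hy' => simp only [mul_add, map_add, hy, hy']; abel
    | tmul b t =>
      simp [dpsi, parity, key, TensorProduct.add_tmul]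

/-- `∂/∂σᵃ(n)` is an even derivation. -/
theorem dsigma_mul (j : EvenIdx r) (x y : Forms r) :
    dsigma j (x * y) = dsigma j x * y + x * dsigma j y := by
  induction x using TensorProduct.induction_on with
  | zero => simp
  | add x x' hx hx' => simp only [add_mul, map_add, hx, hx']; abel
  | tmul a s =>
    induction y using TensorProduct.induction_on with
    | zero => simp
    | add y y' hy hy' => simp only [mul_add, map_add, hy, hy']; abel
    | tmul b t =>
      simp [dsigma, Derivation.leibniz, TensorProduct.tmul_add, mul_comm, add_comm]

/-- The operator `∑ u · ∂/∂ψ + ∑ v · ∂/∂σ`. If the `u` are odd and the `v` even (or the `u` even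
and the `v` odd), this is the even (or odd) derivation of the superalgebra `Λ ⊗ S` with the
values `u` on the generators `ψ` and `v` on the generators `σ`. -/
def der (u : Fin r → ℤ → Forms r) (v : Fin r → ℤ → Forms r) : Module.End ℂ (Forms r) :=
  locSum (fun i : OddIdx r => lmul (u (ofLex i).2 (ofLex i).1) * dpsi i)
      (locFin_dpsi.comp _) +
    locSum (fun j : EvenIdx r => lmul (v j.2 j.1) * dsigma j) (locFin_dsigma.comp _)

theorem der_psi (u v : Fin r → ℤ → Forms r) (b : Fin r) (n : ℤ) (hn : n < 0) :
    der u v (psi b n) = u b n := by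
  have h1 : ∀ i : OddIdx r, i ≠ toLex ((⟨n, hn⟩ : {n : ℤ // n < 0}), b) →
      (lmul (u (ofLex i).2 (ofLex i).1) * dpsi i) (psi b n) = 0 := by
    intro i hi
    simp [psi, hn, dpsi, ExteriorAlgebra.ι, CliffordAlgebra.contractLeft_ι, hi.symm]
  have h2 : ∀ j : EvenIdx r, (lmul (v j.2 j.1) * dsigma j) (psi b n) = 0 := by
    intro j
    simp [psi, hn, dsigma]
  have h3 : (∑ᶠ j : EvenIdx r, (lmul (v j.2 j.1) * dsigma j) (psi b n)) = 0 := by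
    simp only [h2, finsum_zero]
  change (∑ᶠ i : OddIdx r, (lmul (u (ofLex i).2 (ofLex i).1) * dpsi i) (psi b n)) +
    (∑ᶠ j : EvenIdx r, (lmul (v j.2 j.1) * dsigma j) (psi b n)) = u b n
  rw [h3, finsum_eq_single _ _ h1, add_zero]
  simp [psi, hn, dpsi, ExteriorAlgebra.ι, CliffordAlgebra.contractLeft_ι,
    ← Algebra.TensorProduct.one_def]

theorem der_sigma (u v : Fin r → ℤ → Forms r) (b : Fin r) (n : ℤ) (hn : n ≤ 0) :
    der u v (sigma b n) = v b n := by
  have h1 : ∀ i : EvenIdx r, i ≠ ((⟨n, hn⟩ : {n : ℤ // n ≤ 0}), b) →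
      (lmul (v i.2 i.1) * dsigma i) (sigma b n) = 0 := by
    intro i hi
    simp [sigma, hn, dsigma, MvPolynomial.pderiv_X, hi.symm]
  have h2 : ∀ j : OddIdx r,
      (lmul (u (ofLex j).2 (ofLex j).1) * dpsi j) (sigma b n) = 0 := by
    intro j
    simp [sigma, hn, dpsi]
  have h3 : (∑ᶠ j : OddIdx r,
      (lmul (u (ofLex j).2 (ofLex j).1) * dpsi j) (sigma b n)) = 0 := by
    simp only [h2, finsum_zero]
  change (∑ᶠ j : OddIdx r, (lmul (u (ofLex j).2 (ofLex j).1) * dpsi j) (sigma b n)) +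
    (∑ᶠ i : EvenIdx r, (lmul (v i.2 i.1) * dsigma i) (sigma b n)) = v b n
  rw [h3, finsum_eq_single _ _ h1, zero_add]
  simp [sigma, hn, dsigma, ← Algebra.TensorProduct.one_def]

/-! ### The hermitian metric -/

/-- The basis of `Λ ⊗ S` formed by the products of ordered monomials in the `ψ` and monomials
in the `σ`. -/
def monomialBasis (r : ℕ) : Module.Basis (Finset (OddIdx r) × (EvenIdx r →₀ ℕ)) ℂ (Forms r) :=
  (Module.Basis.ExteriorAlgebra
    (Finsupp.basisSingleOne : Module.Basis (OddIdx r) ℂ (OddIdx r →₀ ℂ))).tensorProduct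
      (MvPolynomial.basisMonomials (EvenIdx r) ℂ)

/-- The square norm of a monomial in the multilinear extension of `⟨ψᵃ(n)|ψᵃ(n)⟩ = -1/n`,
`⟨σᵃ(n)|σᵃ(n)⟩ = 1`: Gram determinants on `Λ` and Gram permanents on `S`, so that
`⟨σᵏ|σᵏ⟩ = k!`. -/
def monomialNormSq (k : Finset (OddIdx r) × (EvenIdx r →₀ ℕ)) : ℝ :=
  (∏ i ∈ k.1, (-1 / (((ofLex i).1 : ℤ) : ℝ))) * ∏ j ∈ k.2.support, ((k.2 j).factorial : ℝ)

/-- The hermitian metric on `Λ ⊗ S` (conjugate-linear in the first variable): distinct monomials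
in the generators are orthogonal, with the square norms above. -/
def herm (x y : Forms r) : ℂ :=
  ((monomialBasis r).repr x).sum fun k c =>
    (monomialNormSq k : ℂ) * starRingEnd ℂ c * (monomialBasis r).repr y k

/-- `T'` is the hermitian adjoint of `T`. -/
def IsAdj (T T' : Module.End ℂ (Forms r)) : Prop :=
  ∀ x y, herm (T x) y = herm x (T' y)

/-! ### The operators -/

section Operators

variable {𝔤 : Type*} [LieRing 𝔤] [LieAlgebra ℂ 𝔤] (ξ : Module.Basis (Fin r) ℂ 𝔤)

/-- The coefficient of the dual basis vector `ξᶜ` in the coadjoint translate of `ξᵇ` by `ξ_a`. -/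
def coad (a b c : Fin r) : ℂ := (⁅ξ a, ξ.coord b⁆ : Module.Dual ℂ 𝔤) (ξ c)

/-- `ψ^{[a,b]}(n)`, zero if `n ≥ 0`. -/
def psiBr (a b : Fin r) (n : ℤ) : Forms r := ∑ c, coad ξ a b c • psi c n

/-- `σ^{[a,b]}(n)`, zero if `n > 0`. -/
def sigmaBr (a b : Fin r) (n : ℤ) : Forms r := ∑ c, coad ξ a b c • sigma c n

/-- `ad_a(m) : ψᵇ(n) ↦ ψ^{[a,b]}(m+n)`, or zero if `m + n ≥ 0`; `σᵇ(n) ↦ 0`. -/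
def ad (a : Fin r) (m : ℤ) : Module.End ℂ (Forms r) :=
  der (fun b n => psiBr ξ a b (m + n)) 0

/-- `R_a(m) : σᵇ(n) ↦ σ^{[a,b]}(m+n)`, or zero if `m + n > 0`; `ψᵇ(n) ↦ 0`. -/
def R (a : Fin r) (m : ℤ) : Module.End ℂ (Forms r) :=
  der 0 (fun b n => sigmaBr ξ a b (m + n))

/-- `ad_a(m)* : ψᵇ(n) ↦ ((n-m)/n) ψ^{[a,b]}(n-m)`, or zero if `n ≥ m`; `σᵇ(n) ↦ 0`. -/
def adStar (a : Fin r) (m : ℤ) : Module.End ℂ (Forms r) :=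
  der (fun b n => (((n : ℂ) - m) / n) • psiBr ξ a b (n - m)) 0

/-- `d_a(m) : σᵇ(n) ↦ ψ^{[a,b]}(m+n)`, or zero if `m + n ≥ 0`; `ψᵇ(n) ↦ 0`. -/
def d (a : Fin r) (m : ℤ) : Module.End ℂ (Forms r) :=
  der 0 (fun b n => psiBr ξ a b (m + n))

/-- `d_a(m)* : ψᵇ(n) ↦ -σ^{[a,b]}(n-m)/n`, or zero if `n > m`; `σᵇ(n) ↦ 0`. -/
def dStar (a : Fin r) (m : ℤ) : Module.End ℂ (Forms r) :=
  der (fun b n => (-1 / (n : ℂ)) • sigmaBr ξ a b (n - m)) 0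

/-- The adjoint of multiplication by `ψᵃ(-m)`, `m > 0`: the odd derivation
`(1/m) ∂/∂ψᵃ(-m)`. -/
def psiStar (a : Fin r) (m : ℕ+) : Module.End ℂ (Forms r) :=
  (1 / (m : ℂ)) • dpsi (toLex ((⟨-(m : ℤ), by simp⟩ : {n : ℤ // n < 0}), a))

theorem psi_of_nonneg (a : Fin r) {n : ℤ} (hn : 0 ≤ n) : psi a n = 0 := by
  simp [psi, hn]

theorem sigma_of_pos (a : Fin r) {n : ℤ} (hn : 0 < n) : sigma a n = 0 := by
  simp [sigma, hn]

theorem psiBr_of_nonneg (a b : Fin r) {n : ℤ} (hn : 0 ≤ n) : psiBr ξ a b n = 0 := by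
  simp [psiBr, psi_of_nonneg _ hn]

theorem sigmaBr_of_pos (a b : Fin r) {n : ℤ} (hn : 0 < n) : sigmaBr ξ a b n = 0 := by
  simp [sigmaBr, sigma_of_pos _ hn]

/-- A family of derivations, indexed by `a` and by `m > 0`, is locally finite if each generator
is killed for large `m`. -/
theorem locFin_der (u v : Fin r → ℕ+ → Fin r → ℤ → Forms r)
    (hu : ∀ a (m : ℕ+) b n, -n < (m : ℤ) → u a m b n = 0)
    (hv : ∀ a (m : ℕ+) b n, -n < (m : ℤ) → v a m b n = 0) :
    LocFin fun p : Fin r × ℕ+ => der (u p.1 p.2) (v p.1 p.2) := by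
  intro x
  have hfin : ∀ k : ℤ, {p : Fin r × ℕ+ | (p.2 : ℤ) ≤ k}.Finite := by
    intro k
    have : {p : Fin r × ℕ+ | (p.2 : ℤ) ≤ k} = Set.univ ×ˢ {m : ℕ+ | (m : ℤ) ≤ k} := by
      ext; simp
    rw [this]
    refine Set.finite_univ.prod ?_
    refine Set.Finite.of_finite_image (f := fun m : ℕ+ => (m : ℤ))
      ((Set.finite_Icc 0 k).subset ?_) (fun a _ b _ h => by simpa using h)
    rintro _ ⟨m, hm, rfl⟩
    exact ⟨by positivity, hm⟩
  have h1 : (⋃ i ∈ {i : OddIdx r | dpsi i x ≠ 0},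
      {p : Fin r × ℕ+ | (p.2 : ℤ) ≤ -((ofLex i).1 : ℤ)}).Finite :=
    (locFin_dpsi x).biUnion fun _ _ => hfin _
  have h2 : (⋃ j ∈ {j : EvenIdx r | dsigma j x ≠ 0},
      {p : Fin r × ℕ+ | (p.2 : ℤ) ≤ -(j.1 : ℤ)}).Finite :=
    (locFin_dsigma x).biUnion fun _ _ => hfin _
  refine (h1.union h2).subset fun p hp => ?_
  by_contra h
  simp only [Set.mem_union, Set.mem_iUnion, Set.mem_ofPred_eq, not_or, not_exists, not_le] at h
  apply hp
  have e1 : ∀ i : OddIdx r,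
      (lmul (u p.1 p.2 (ofLex i).2 (ofLex i).1) * dpsi i) x = 0 := by
    intro i
    by_cases hi : dpsi i x = 0
    · simp [hi]
    · simp [hu _ _ _ _ (h.1 i hi)]
  have e2 : ∀ j : EvenIdx r, (lmul (v p.1 p.2 j.2 j.1) * dsigma j) x = 0 := by
    intro j
    by_cases hj : dsigma j x = 0
    · simp [hj]
    · simp [hv _ _ _ _ (h.2 j hj)]
  change (∑ᶠ i : OddIdx r, (lmul (u p.1 p.2 (ofLex i).2 (ofLex i).1) * dpsi i) x) +
    (∑ᶠ j : EvenIdx r, (lmul (v p.1 p.2 j.2 j.1) * dsigma j) x) = 0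
  simp only [e1, e2, finsum_zero, add_zero]

theorem locFin_ad : LocFin fun p : Fin r × ℕ+ => ad ξ p.1 p.2 :=
  locFin_der (fun a m b n => psiBr ξ a b (m + n)) 0
    (fun a m b n h => psiBr_of_nonneg ξ a b (by omega)) (fun _ _ _ _ _ => rfl)

theorem locFin_R : LocFin fun p : Fin r × ℕ+ => R ξ p.1 p.2 :=
  locFin_der 0 (fun a m b n => sigmaBr ξ a b (m + n)) (fun _ _ _ _ _ => rfl)
    (fun a m b n h => sigmaBr_of_pos ξ a b (by omega))

theorem locFin_adStar : LocFin fun p : Fin r × ℕ+ => adStar ξ p.1 (-p.2) :=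
  locFin_der (fun a m b n => (((n : ℂ) - (-(m : ℤ) : ℤ)) / n) • psiBr ξ a b (n - -(m : ℤ))) 0
    (fun a m b n h => by rw [psiBr_of_nonneg ξ a b (by omega), smul_zero])
    (fun _ _ _ _ _ => rfl)

theorem locFin_dStar : LocFin fun p : Fin r × ℕ+ => dStar ξ p.1 (-p.2) :=
  locFin_der (fun a m b n => (-1 / (n : ℂ)) • sigmaBr ξ a b (n - -(m : ℤ))) 0
    (fun a m b n h => by rw [sigmaBr_of_pos ξ a b (by omega), smul_zero])
    (fun _ _ _ _ _ => rfl)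

theorem locFin_psiStar : LocFin fun p : Fin r × ℕ+ => psiStar p.1 p.2 := by
  intro x
  have hinj : Function.Injective fun p : Fin r × ℕ+ =>
      (toLex ((⟨-(p.2 : ℤ), by simp⟩ : {n : ℤ // n < 0}), p.1) : OddIdx r) := by
    rintro ⟨a, m⟩ ⟨b, n⟩ h
    have h' := toLex.injective h
    simp only [Prod.mk.injEq, Subtype.mk.injEq, neg_inj, Nat.cast_inj, PNat.coe_inj] at h'
    rw [h'.1, h'.2]
  refine ((locFin_dpsi x).preimage hinj.injOn).subset fun p hp h => hp ?_
  simp only [psiStar, LinearMap.smul_apply]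
  rw [h, smul_zero]

/-- `∂̄ = ∑_{a; m>0} (ψᵃ(-m) R_a(m) + ½ ψᵃ(-m) ad_a(m))`. -/
def dbar : Module.End ℂ (Forms r) :=
  locSum (fun p : Fin r × ℕ+ => lmul (psi p.1 (-p.2)) * R ξ p.1 p.2 +
      ((1 / 2 : ℂ) • lmul (psi p.1 (-p.2))) * ad ξ p.1 p.2)
    (((locFin_R ξ).comp _).add ((locFin_ad ξ).comp _))

/-- `∂̄* = ∑_{a; m>0} (ψᵃ(-m)* R_a(-m) + ½ ad_a(m)* ψᵃ(-m)*)`, where in the first term the factors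
act on `Λ` and on `S` and so commute. -/
def dbarStar : Module.End ℂ (Forms r) :=
  locSum (fun p : Fin r × ℕ+ => R ξ p.1 (-p.2) * psiStar p.1 p.2 +
      ((1 / 2 : ℂ) • adStar ξ p.1 p.2) * psiStar p.1 p.2)
    ((locFin_psiStar.comp _).add (locFin_psiStar.comp _))

/-- The Laplacian `∂̄ ∂̄* + ∂̄* ∂̄`. -/
def boxBar : Module.End ℂ (Forms r) := dbar ξ * dbarStar ξ + dbarStar ξ * dbar ξ

/-- `D = ∑_{a; m>0} d_a(-m) d_a(-m)*`. -/
def bigD : Module.End ℂ (Forms r) :=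
  locSum (fun p : Fin r × ℕ+ => d ξ p.1 (-p.2) * dStar ξ p.1 (-p.2))
    ((locFin_dStar ξ).comp _)

/-- `□ = ∑_{a; m>0} (1/m) (R_a(-m) + ad_a(-m)) (R_a(m) + ad_a(-m)*)`. -/
def box : Module.End ℂ (Forms r) :=
  locSum (fun p : Fin r × ℕ+ => ((1 / (p.2 : ℂ)) • (R ξ p.1 (-p.2) + ad ξ p.1 (-p.2))) *
      (R ξ p.1 p.2 + adStar ξ p.1 (-p.2)))
    (((locFin_R ξ).add (locFin_adStar ξ)).comp _)

/-- The space `C` of the restricted relative Koszul complex: the `𝔤`-invariants in `Λ ⊗ S`, where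
`ξ_a` acts by `R_a(0) + ad_a(0)`. -/
def koszul : Submodule ℂ (Forms r) := ⨅ a : Fin r, LinearMap.ker (R ξ a 0 + ad ξ a 0)

/-- A harmonic cocycle: an element of the complex killed by the differential and by the
Laplacian. -/
def IsHarmonic (x : Forms r) : Prop := x ∈ koszul ξ ∧ dbar ξ x = 0 ∧ boxBar ξ x = 0

end Operators

end LoopKoszul

end

open LoopKoszul

/-!
The theorem rests on one identity of operators on all of `Λ ⊗ S`,
`∂̄ ∂̄* + ∂̄* ∂̄ = □ + D + ∑ₐ Xₐ Eₐ`, where `Eₐ = R_a(0) + ad_a(0)` is the action of `ξ_a` and `Xₐ`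
is the derivation `ψᵇ(n) ↦ ψ^{[a,b]}(n) / n` (`IsFourierBasis.boxBar_eq`). On the invariants the last
sum vanishes, which is the formula for the Laplacian. Since `□` and `D` are positive combinations of
operators `Y* Y`, an invariant form killed by the Laplacian is killed by all the
`R_a(m) + ad_a(-m)*` and `d_a(-m)*`; conversely a form in the joint kernel of these derivations is
killed by the Laplacian, hence by `∂̄`, again by positivity (`IsFourierBasis.isHarmonic_iff`). The
joint kernel of a family of derivations is a subalgebra.

The identity is proved by comparing differential operators. Each of its terms is an operator of
order two without constant term (`IsSecondOrder`), so it is determined by its values on the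
generators and by the brackets `T(uv) - T(u)v - u T(v)` of pairs of generators
(`IsSecondOrder.eq_zero`). For the left side these follow from the commutation relations of `∂̄*`
with multiplication by the generators (`IsFourierBasis.dbarStar_psiL_mul`,
`IsFourierBasis.dbarStar_sigmaL_mul`): the anticommutator with `ψᵇ(-p)` is
`(1/p) (R_b(-p) + ad_b(p)*)` and the commutator with `σᵇ(-q)` is `-d_b(q)*`. All the brackets are
then sums, over ranges of splittings of the total energy, of invariants `∑ₐ f[ξ_a, x] g[ξ_a, y]` and
`∑ₐ f(ξ_a) g[x, [ξ_a, y]]`, and the invariance of the Casimir element `∑ₐ ξ_a ⊗ ξ_a` and the Jacobi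
identity bring the two sides into the same form.

The adjointness of two derivations is checked on their commutators with the annihilation operators
(`IsEvenDer.isAdj`, `IsOddDer.isAdj`), starting from the fact that multiplication by a generator is
adjoint to a multiple of a partial derivative. The structure constants enter through the total
antisymmetry given by the Killing form and through their being purely imaginary in a self-adjoint
basis. Throughout, `ψᵇ(-p)` and `σᵇ(-q)` are extended to linear maps `psiL ξ p` and `sigmaL ξ q` on
`𝔤`, so that the coadjoint translates become Lie brackets.
-/

open scoped TensorProduct

noncomputable section

namespace LoopKoszul

variable {r : ℕ}

/-! ### Ring identities in `Λ ⊗ S` -/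

section Forms

/-! Instances of the general lemmas, with the negation of a tensor product in place of that of a
ring, so that they can be used for rewriting. -/

protected theorem Forms.neg_mul (x y : Forms r) : -x * y = -(x * y) := _root_.neg_mul x y

protected theorem Forms.mul_neg (x y : Forms r) : x * -y = -(x * y) := _root_.mul_neg x y

protected theorem Forms.neg_neg (x : Forms r) : - -x = x := _root_.neg_neg x

protected theorem Forms.neg_zero : -(0 : Forms r) = 0 := _root_.neg_zero

protected theorem Forms.sub_mul (x y z : Forms r) : (x - y) * z = x * z - y * z :=
  _root_.sub_mul x y z

protected theorem Forms.mul_sub (x y z : Forms r) : x * (y - z) = x * y - x * z :=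
  _root_.mul_sub x y z

protected theorem Forms.smul_sub (c : ℂ) (x y : Forms r) : c • (x - y) = c • x - c • y :=
  _root_.smul_sub c x y

protected theorem Forms.smul_neg (c : ℂ) (x : Forms r) : c • -x = -(c • x) :=
  _root_.smul_neg c x

protected theorem Forms.neg_smul (c : ℂ) (x : Forms r) : -c • x = -(c • x) :=
  _root_.neg_smul c x

protected theorem Forms.sub_eq_add_neg (x y : Forms r) : x - y = x + -y :=
  _root_.sub_eq_add_neg x y

protected theorem Forms.neg_add (x y : Forms r) : -(x + y) = -x + -y :=
  _root_.neg_add x y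

protected theorem Forms.end_neg (T : Module.End ℂ (Forms r)) (x : Forms r) : T (-x) = -T x :=
  map_neg T x

protected theorem Forms.end_sub (T : Module.End ℂ (Forms r)) (x y : Forms r) :
    T (x - y) = T x - T y :=
  map_sub T x y

end Forms

theorem parity_psi (b : Fin r) (n : ℤ) : parity (psi b n) = -psi b n := by
  unfold psi
  split_ifs
  · simp [parity, ExteriorAlgebra.ι, TensorProduct.neg_tmul]
  · simp

theorem parity_sigma (b : Fin r) (n : ℤ) : parity (sigma b n) = sigma b n := by
  unfold sigma
  split_ifs
  · simp [parity]
  · simp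

theorem parity_parity (x : Forms r) : parity (parity x) = x := by
  induction x using TensorProduct.induction_on with
  | zero => simp
  | add x y hx hy => simp [hx, hy]
  | tmul a s => simp [parity]

/-- Induction on a form, written as a sum of products of generators. -/
theorem forms_induction {p : Forms r → Prop} (one : p 1)
    (add : ∀ x y, p x → p y → p (x + y)) (smul : ∀ (c : ℂ) x, p x → p (c • x))
    (hpsi : ∀ b n x, n < 0 → p x → p (psi b n * x))
    (hsigma : ∀ b n x, n ≤ 0 → p x → p (sigma b n * x)) (x : Forms r) : p x := by
  have zero : p 0 := by simpa using smul 0 1 one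
  have hs : ∀ s : MvPolynomial (EvenIdx r) ℂ, p (1 ⊗ₜ s) := by
    intro s
    induction s using MvPolynomial.induction_on with
    | C c =>
      have := smul c 1 one
      rwa [Algebra.TensorProduct.one_def, ← TensorProduct.tmul_smul, MvPolynomial.smul_eq_C_mul,
        mul_one] at this
    | add s t hs ht => rw [TensorProduct.tmul_add]; exact add _ _ hs ht
    | mul_X s j hs =>
      have := hsigma j.2 j.1 _ j.1.2 hs
      simpa [sigma, j.1.2, mul_comm] using this
  induction x using TensorProduct.induction_on with
  | zero => exact zero
  | add x y hx hy => exact add _ _ hx hy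
  | tmul a s =>
    induction a using CliffordAlgebra.left_induction with
    | algebraMap c =>
      rw [Algebra.algebraMap_eq_smul_one]
      exact smul c _ (hs s)
    | add a b ha hb => rw [TensorProduct.add_tmul]; exact add _ _ ha hb
    | ι_mul a v ha =>
      induction v using Finsupp.induction_linear with
      | zero => simpa using zero
      | add v w hv hw =>
        rw [map_add, add_mul, TensorProduct.add_tmul]; exact add _ _ hv hw
      | single i c =>
        have := smul c _ (hpsi (ofLex i).2 (ofLex i).1 _ (ofLex i).1.2 ha)
        simp only [psi, (ofLex i).1.2, dif_pos, Algebra.TensorProduct.tmul_mul_tmul, one_mul,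
          TensorProduct.smul_tmul', ← smul_mul_assoc, ← map_smul, Finsupp.smul_single,
          smul_eq_mul, mul_one] at this
        exact this

/-! ### Supercommutativity -/

theorem psi_mul (b : Fin r) (n : ℤ) (x : Forms r) : psi b n * x = parity x * psi b n := by
  unfold psi
  split_ifs with h
  · induction x using TensorProduct.induction_on with
    | zero => simp
    | add x y hx hy => simp only [mul_add, map_add, add_mul, hx, hy]
    | tmul a s =>
      simp only [parity, Algebra.TensorProduct.map_tmul, Algebra.TensorProduct.tmul_mul_tmul,
        one_mul, mul_one, AlgHom.id_apply]
      congr 1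
      induction a using CliffordAlgebra.left_induction with
      | algebraMap c => simp [Algebra.commutes]
      | add a b ha hb => simp only [mul_add, map_add, add_mul, ha, hb]
      | ι_mul a v ha =>
        have h2 := ExteriorAlgebra.ι_add_mul_swap (R := ℂ)
          (Finsupp.single (toLex ((⟨n, h⟩ : {n : ℤ // n < 0}), b)) (1 : ℂ)) v
        rw [map_mul, CliffordAlgebra.involute_ι, mul_assoc, ← ha, ← mul_assoc, ← mul_assoc,
          eq_neg_of_add_eq_zero_left h2]
        simp [ExteriorAlgebra.ι]
  · simp

theorem sigma_mul (b : Fin r) (n : ℤ) (x : Forms r) : sigma b n * x = x * sigma b n := by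
  unfold sigma
  split_ifs with h
  · induction x using TensorProduct.induction_on with
    | zero => simp
    | add x y hx hy => simp only [mul_add, add_mul, hx, hy]
    | tmul a s => simp [mul_comm]
  · simp

/-- The even part of a form is central, and its odd part supercommutes with all forms. -/
theorem even_odd_part_comm (u : Forms r) :
    (∀ x, (u + parity u) * x = x * (u + parity u)) ∧
      ∀ x, (u - parity u) * x = parity x * (u - parity u) := by
  induction u using forms_induction with
  | one => exact ⟨fun x => by simp [mul_add, add_mul], fun x => by simp⟩
  | add u v hu hv =>
    refine ⟨fun x => ?_, fun x => ?_⟩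
    · rw [map_add, add_add_add_comm, add_mul, mul_add, hu.1, hv.1]
    · rw [map_add, add_sub_add_comm, add_mul, mul_add, hu.2, hv.2]
  | smul c u hu =>
    refine ⟨fun x => ?_, fun x => ?_⟩
    · rw [map_smul, ← smul_add, smul_mul_assoc, mul_smul_comm, hu.1]
    · rw [map_smul, ← Forms.smul_sub, smul_mul_assoc, mul_smul_comm, hu.2]
  | hpsi b n u _ hu =>
    have e1 : psi b n * u + parity (psi b n * u) = psi b n * (u - parity u) := by
      rw [map_mul, parity_psi, Forms.neg_mul, Forms.mul_sub, Forms.sub_eq_add_neg]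
    have e2 : psi b n * u - parity (psi b n * u) = psi b n * (u + parity u) := by
      rw [map_mul, parity_psi, Forms.neg_mul, mul_add, Forms.sub_eq_add_neg, Forms.neg_neg]
    rw [e1, e2]
    refine ⟨fun x => ?_, fun x => ?_⟩
    · rw [mul_assoc, hu.2, ← mul_assoc, psi_mul, parity_parity, mul_assoc]
    · rw [mul_assoc, hu.1, ← mul_assoc, psi_mul, mul_assoc]
  | hsigma b n u _ hu =>
    simp only [map_mul, parity_sigma, ← Forms.mul_sub, ← mul_add]
    refine ⟨fun x => ?_, fun x => ?_⟩
    · rw [mul_assoc, hu.1, ← mul_assoc, sigma_mul, mul_assoc]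
    · rw [mul_assoc, hu.2, ← mul_assoc, sigma_mul, mul_assoc]

theorem even_mul {u : Forms r} (hu : parity u = u) (x : Forms r) : u * x = x * u := by
  have h := (even_odd_part_comm u).1 x
  rw [hu, ← two_smul ℂ u, smul_mul_assoc, mul_smul_comm] at h
  exact smul_right_injective _ (two_ne_zero' ℂ) h

theorem odd_mul {u : Forms r} (hu : parity u = -u) (x : Forms r) : u * x = parity x * u := by
  have h := (even_odd_part_comm u).2 x
  rw [hu, sub_neg_eq_add, ← two_smul ℂ u, smul_mul_assoc, mul_smul_comm] at h
  exact smul_right_injective _ (two_ne_zero' ℂ) h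

/-! ### Derivations -/

/-- An even derivation of the superalgebra `Λ ⊗ S`: it commutes with the parity automorphism. -/
structure IsEvenDer (T : Module.End ℂ (Forms r)) : Prop where
  leibniz : ∀ x y, T (x * y) = T x * y + x * T y
  par : ∀ x, parity (T x) = T (parity x)

/-- An odd derivation of the superalgebra `Λ ⊗ S`: it anticommutes with the parity automorphism. -/
structure IsOddDer (T : Module.End ℂ (Forms r)) : Prop where
  leibniz : ∀ x y, T (x * y) = T x * y + parity x * T y
  par : ∀ x, parity (T x) = -T (parity x)

/-- On finitely many forms, a locally finite sum agrees with one of its finite partial sums. -/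
theorem locSum_eq_finset_sum {ι : Type*} {f : ι → Module.End ℂ (Forms r)} (hf : LocFin f)
    {V : Set (Forms r)} (hV : V.Finite) :
    ∃ s : Finset ι, ∀ v ∈ V, locSum f hf v = ∑ i ∈ s, f i v := by
  classical
  refine ⟨(hV.biUnion fun v _ => hf v).toFinset, fun v hv => ?_⟩
  refine finsum_eq_sum_of_support_subset _ fun i hi => ?_
  simp only [Set.Finite.coe_toFinset, Set.mem_iUnion]
  exact ⟨v, hv, hi⟩

theorem IsEvenDer.locSum {ι : Type*} {f : ι → Module.End ℂ (Forms r)} (hf : LocFin f)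
    (h : ∀ i, IsEvenDer (f i)) : IsEvenDer (locSum f hf) := by
  refine ⟨fun x y => ?_, fun x => ?_⟩
  · obtain ⟨s, hs⟩ := locSum_eq_finset_sum hf (Set.toFinite {x * y, x, y})
    rw [hs _ (by simp), hs x (by simp), hs y (by simp), Finset.sum_mul, Finset.mul_sum,
      ← Finset.sum_add_distrib]
    exact Finset.sum_congr rfl fun i _ => (h i).leibniz x y
  · obtain ⟨s, hs⟩ := locSum_eq_finset_sum hf (Set.toFinite {parity x, x})
    rw [hs (parity x) (by simp), hs x (by simp), map_sum]
    exact Finset.sum_congr rfl fun i _ => (h i).par x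

theorem IsOddDer.locSum {ι : Type*} {f : ι → Module.End ℂ (Forms r)} (hf : LocFin f)
    (h : ∀ i, IsOddDer (f i)) : IsOddDer (locSum f hf) := by
  refine ⟨fun x y => ?_, fun x => ?_⟩
  · obtain ⟨s, hs⟩ := locSum_eq_finset_sum hf (Set.toFinite {x * y, x, y})
    rw [hs _ (by simp), hs x (by simp), hs y (by simp), Finset.sum_mul, Finset.mul_sum,
      ← Finset.sum_add_distrib]
    exact Finset.sum_congr rfl fun i _ => (h i).leibniz x y
  · obtain ⟨s, hs⟩ := locSum_eq_finset_sum hf (Set.toFinite {parity x, x})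
    rw [hs (parity x) (by simp), hs x (by simp), map_sum, ← Finset.sum_neg_distrib]
    exact Finset.sum_congr rfl fun i _ => (h i).par x

theorem IsEvenDer.zero : IsEvenDer (0 : Module.End ℂ (Forms r)) := ⟨by simp, by simp⟩

theorem IsEvenDer.add {T T' : Module.End ℂ (Forms r)} (h : IsEvenDer T) (h' : IsEvenDer T') :
    IsEvenDer (T + T') := by
  refine ⟨fun x y => ?_, fun x => ?_⟩
  · simp only [LinearMap.add_apply, h.leibniz, h'.leibniz, add_mul, mul_add]; abel
  · simp only [LinearMap.add_apply, h.par, h'.par, map_add]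

theorem IsOddDer.add {T T' : Module.End ℂ (Forms r)} (h : IsOddDer T) (h' : IsOddDer T') :
    IsOddDer (T + T') := by
  refine ⟨fun x y => ?_, fun x => ?_⟩
  · simp only [LinearMap.add_apply, h.leibniz, h'.leibniz, add_mul, mul_add]; abel
  · simp only [LinearMap.add_apply, h.par, h'.par, map_add, Forms.neg_add]

theorem IsEvenDer.smul {T : Module.End ℂ (Forms r)} (h : IsEvenDer T) (c : ℂ) :
    IsEvenDer (c • T) := by
  refine ⟨fun x y => ?_, fun x => ?_⟩
  · simp only [LinearMap.smul_apply, h.leibniz, smul_add, smul_mul_assoc, mul_smul_comm]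
  · simp only [LinearMap.smul_apply, h.par, map_smul]

theorem IsOddDer.smul {T : Module.End ℂ (Forms r)} (h : IsOddDer T) (c : ℂ) :
    IsOddDer (c • T) := by
  refine ⟨fun x y => ?_, fun x => ?_⟩
  · simp only [LinearMap.smul_apply, h.leibniz, smul_add, smul_mul_assoc, mul_smul_comm]
  · simp only [LinearMap.smul_apply, h.par, map_smul, Forms.smul_neg]

theorem IsEvenDer.sum {ι : Type*} {f : ι → Module.End ℂ (Forms r)} {s : Finset ι}
    (h : ∀ i ∈ s, IsEvenDer (f i)) : IsEvenDer (∑ i ∈ s, f i) :=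
  Finset.sum_induction f IsEvenDer (fun _ _ => .add) .zero h

theorem IsOddDer.zero : IsOddDer (0 : Module.End ℂ (Forms r)) := ⟨by simp, by simp⟩

theorem IsOddDer.sum {ι : Type*} {f : ι → Module.End ℂ (Forms r)} {s : Finset ι}
    (h : ∀ i ∈ s, IsOddDer (f i)) : IsOddDer (∑ i ∈ s, f i) :=
  Finset.sum_induction f IsOddDer (fun _ _ => .add) .zero h

theorem IsEvenDer.odd_lmul {T : Module.End ℂ (Forms r)} (h : IsEvenDer T) {u : Forms r}
    (hu : parity u = -u) : IsOddDer (lmul u * T) := by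
  refine ⟨fun x y => ?_, fun x => ?_⟩
  · simp only [Module.End.mul_apply, LinearMap.mulLeft_apply, h.leibniz, mul_add, ← mul_assoc,
      odd_mul hu x]
  · simp [h.par, hu, Forms.neg_mul]

theorem IsEvenDer.even_lmul {T : Module.End ℂ (Forms r)} (h : IsEvenDer T) {u : Forms r}
    (hu : parity u = u) : IsEvenDer (lmul u * T) := by
  refine ⟨fun x y => ?_, fun x => ?_⟩
  · simp only [Module.End.mul_apply, LinearMap.mulLeft_apply, h.leibniz, mul_add, ← mul_assoc,
      even_mul hu x]
  · simp [h.par, hu]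

theorem IsOddDer.odd_lmul {T : Module.End ℂ (Forms r)} (h : IsOddDer T) {u : Forms r}
    (hu : parity u = -u) : IsEvenDer (lmul u * T) := by
  refine ⟨fun x y => ?_, fun x => ?_⟩
  · simp only [Module.End.mul_apply, LinearMap.mulLeft_apply, h.leibniz, mul_add, ← mul_assoc,
      odd_mul hu (parity x), parity_parity]
  · simp [h.par, hu, Forms.neg_mul, Forms.mul_neg]

theorem IsOddDer.even_lmul {T : Module.End ℂ (Forms r)} (h : IsOddDer T) {u : Forms r}
    (hu : parity u = u) : IsOddDer (lmul u * T) := by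
  refine ⟨fun x y => ?_, fun x => ?_⟩
  · simp only [Module.End.mul_apply, LinearMap.mulLeft_apply, h.leibniz, mul_add, ← mul_assoc,
      even_mul hu (parity x)]
  · simp [h.par, hu, Forms.mul_neg]

/-- The commutator of an odd and an even derivation. -/
theorem IsOddDer.commutator {T U : Module.End ℂ (Forms r)} (hT : IsOddDer T)
    (hU : IsEvenDer U) : IsOddDer (T * U - U * T) := by
  refine ⟨fun x y => ?_, fun x => ?_⟩
  · simp only [LinearMap.sub_apply, Module.End.mul_apply, hT.leibniz, hU.leibniz, map_add, hU.par,
      Forms.mul_sub, Forms.sub_mul]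
    abel
  · simp only [LinearMap.sub_apply, Module.End.mul_apply, map_sub, hT.par, hU.par, Forms.end_neg]
    abel

/-- The commutator of two even derivations. -/
theorem IsEvenDer.commutator {T U : Module.End ℂ (Forms r)} (hT : IsEvenDer T)
    (hU : IsEvenDer U) : IsEvenDer (T * U - U * T) := by
  refine ⟨fun x y => ?_, fun x => ?_⟩
  · simp only [LinearMap.sub_apply, Module.End.mul_apply, hT.leibniz, hU.leibniz, map_add,
      Forms.mul_sub, Forms.sub_mul]
    abel
  · simp only [LinearMap.sub_apply, Module.End.mul_apply, map_sub, hT.par, hU.par]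

/-- The anticommutator of two odd derivations. -/
theorem IsOddDer.anticommutator {T U : Module.End ℂ (Forms r)} (hT : IsOddDer T)
    (hU : IsOddDer U) : IsEvenDer (T * U + U * T) := by
  refine ⟨fun x y => ?_, fun x => ?_⟩
  · simp only [LinearMap.add_apply, Module.End.mul_apply, hT.leibniz, hU.leibniz, map_add, hU.par,
      hT.par, parity_parity, mul_add, add_mul, Forms.neg_mul]
    abel
  · simp only [LinearMap.add_apply, Module.End.mul_apply, map_add, hT.par, hU.par, Forms.end_neg,
      Forms.neg_neg]

theorem IsEvenDer.map_one {T : Module.End ℂ (Forms r)} (h : IsEvenDer T) : T 1 = 0 := by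
  simpa using h.leibniz 1 1

theorem IsOddDer.map_one {T : Module.End ℂ (Forms r)} (h : IsOddDer T) : T 1 = 0 := by
  simpa using h.leibniz 1 1

theorem IsEvenDer.ext {T U : Module.End ℂ (Forms r)} (hT : IsEvenDer T) (hU : IsEvenDer U)
    (hpsi : ∀ b n, n < 0 → T (psi b n) = U (psi b n))
    (hsigma : ∀ b n, n ≤ 0 → T (sigma b n) = U (sigma b n)) : T = U := by
  refine LinearMap.ext fun x => ?_
  induction x using forms_induction with
  | one => rw [hT.map_one, hU.map_one]
  | add x y hx hy => rw [map_add, map_add, hx, hy]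
  | smul c x hx => rw [map_smul, map_smul, hx]
  | hpsi b n x hn hx => rw [hT.leibniz, hU.leibniz, hpsi b n hn, hx]
  | hsigma b n x hn hx => rw [hT.leibniz, hU.leibniz, hsigma b n hn, hx]

theorem IsOddDer.ext {T U : Module.End ℂ (Forms r)} (hT : IsOddDer T) (hU : IsOddDer U)
    (hpsi : ∀ b n, n < 0 → T (psi b n) = U (psi b n))
    (hsigma : ∀ b n, n ≤ 0 → T (sigma b n) = U (sigma b n)) : T = U := by
  refine LinearMap.ext fun x => ?_
  induction x using forms_induction with
  | one => rw [hT.map_one, hU.map_one]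
  | add x y hx hy => rw [map_add, map_add, hx, hy]
  | smul c x hx => rw [map_smul, map_smul, hx]
  | hpsi b n x hn hx => rw [hT.leibniz, hU.leibniz, hpsi b n hn, hx]
  | hsigma b n x hn hx => rw [hT.leibniz, hU.leibniz, hsigma b n hn, hx]

theorem isOddDer_dpsi (i : OddIdx r) : IsOddDer (dpsi i) := by
  refine ⟨dpsi_mul i, fun x => ?_⟩
  induction x using TensorProduct.induction_on with
  | zero => simp
  | add x y hx hy => simp only [map_add, hx, hy, Forms.neg_add]
  | tmul a s =>
    simp only [dpsi, parity, LinearMap.rTensor_tmul, Algebra.TensorProduct.map_tmul,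
      ← TensorProduct.neg_tmul]
    congr 1
    induction a using CliffordAlgebra.left_induction with
    | algebraMap c => simp
    | add a b ha hb => simp only [map_add, ha, hb, neg_add]
    | ι_mul a v ha =>
      simp only [map_mul, CliffordAlgebra.contractLeft_ι_mul, map_sub, map_smul, ha,
        CliffordAlgebra.involute_ι, neg_mul, mul_neg, map_neg]
      abel

theorem isEvenDer_dsigma (j : EvenIdx r) : IsEvenDer (dsigma j) := by
  refine ⟨dsigma_mul j, fun x => ?_⟩
  induction x using TensorProduct.induction_on with
  | zero => simp
  | add x y hx hy => simp only [map_add, hx, hy]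
  | tmul a s => simp [dsigma, parity]

theorem isEvenDer_der {u v : Fin r → ℤ → Forms r} (hu : ∀ b n, parity (u b n) = -u b n)
    (hv : ∀ b n, parity (v b n) = v b n) : IsEvenDer (der u v) :=
  (IsEvenDer.locSum _ fun i => (isOddDer_dpsi i).odd_lmul (hu _ _)).add
    (IsEvenDer.locSum _ fun j => (isEvenDer_dsigma j).even_lmul (hv _ _))

theorem isOddDer_der {u v : Fin r → ℤ → Forms r} (hu : ∀ b n, parity (u b n) = u b n)
    (hv : ∀ b n, parity (v b n) = -v b n) : IsOddDer (der u v) :=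
  (IsOddDer.locSum _ fun i => (isOddDer_dpsi i).even_lmul (hu _ _)).add
    (IsOddDer.locSum _ fun j => (isEvenDer_dsigma j).odd_lmul (hv _ _))

/-! ### Operators of order two -/

/-- The failure of `T` to commute with multiplication by `g`, less multiplication by `T g`. -/
def defect (T : Module.End ℂ (Forms r)) (g : Forms r) : Module.End ℂ (Forms r) :=
  T * lmul g - lmul g * T - lmul (T g)

theorem defect_apply (T : Module.End ℂ (Forms r)) (g y : Forms r) :
    defect T g y = T (g * y) - g * T y - T g * y := by
  simp [defect]

/-- An even differential operator of order at most two on the superalgebra `Λ ⊗ S`, without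
constant term: its defect at each generator is a derivation of the parity of that generator. -/
structure IsSecondOrder (T : Module.End ℂ (Forms r)) : Prop where
  map_one : T 1 = 0
  defect_psi : ∀ b n y z, defect T (psi b n) (y * z) =
    defect T (psi b n) y * z + parity y * defect T (psi b n) z
  defect_sigma : ∀ b n y z, defect T (sigma b n) (y * z) =
    defect T (sigma b n) y * z + y * defect T (sigma b n) z

theorem defect_add (T U : Module.End ℂ (Forms r)) (g y : Forms r) :
    defect (T + U) g y = defect T g y + defect U g y := by
  simp only [defect_apply, LinearMap.add_apply, mul_add, add_mul]; abel

theorem defect_smul (c : ℂ) (T : Module.End ℂ (Forms r)) (g y : Forms r) :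
    defect (c • T) g y = c • defect T g y := by
  simp only [defect_apply, LinearMap.smul_apply, mul_smul_comm, smul_mul_assoc, Forms.smul_sub]

theorem IsSecondOrder.add {T U : Module.End ℂ (Forms r)} (hT : IsSecondOrder T)
    (hU : IsSecondOrder U) : IsSecondOrder (T + U) := by
  refine ⟨by simp [hT.map_one, hU.map_one], fun b n y z => ?_, fun b n y z => ?_⟩
  · simp only [defect_add, hT.defect_psi, hU.defect_psi, add_mul, mul_add]; abel
  · simp only [defect_add, hT.defect_sigma, hU.defect_sigma, add_mul, mul_add]; abel

theorem IsSecondOrder.smul {T : Module.End ℂ (Forms r)} (hT : IsSecondOrder T) (c : ℂ) :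
    IsSecondOrder (c • T) := by
  refine ⟨by simp [hT.map_one], fun b n y z => ?_, fun b n y z => ?_⟩
  · simp only [defect_smul, hT.defect_psi, smul_add, smul_mul_assoc, mul_smul_comm]
  · simp only [defect_smul, hT.defect_sigma, smul_add, smul_mul_assoc, mul_smul_comm]

theorem IsSecondOrder.sub {T U : Module.End ℂ (Forms r)} (hT : IsSecondOrder T)
    (hU : IsSecondOrder U) : IsSecondOrder (T - U) := by
  have : T - U = T + (-1 : ℂ) • U := by
    refine LinearMap.ext fun x => ?_
    simp [Forms.sub_eq_add_neg]
  rw [this]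
  exact hT.add (hU.smul (-1))

theorem IsSecondOrder.sum {ι : Type*} {f : ι → Module.End ℂ (Forms r)} {s : Finset ι}
    (h : ∀ i ∈ s, IsSecondOrder (f i)) : IsSecondOrder (∑ i ∈ s, f i) :=
  Finset.sum_induction f IsSecondOrder (fun _ _ => .add)
    ⟨by simp, by simp [defect_apply], by simp [defect_apply]⟩ h

theorem IsSecondOrder.locSum {ι : Type*} {f : ι → Module.End ℂ (Forms r)} (hf : LocFin f)
    (h : ∀ i, IsSecondOrder (f i)) : IsSecondOrder (locSum f hf) := by
  have key : ∀ g y z : Forms r, ∃ s : Finset ι,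
      (defect (LoopKoszul.locSum f hf) g (y * z) = defect (∑ i ∈ s, f i) g (y * z)) ∧
      (defect (LoopKoszul.locSum f hf) g y = defect (∑ i ∈ s, f i) g y) ∧
      (defect (LoopKoszul.locSum f hf) g z = defect (∑ i ∈ s, f i) g z) := by
    intro g y z
    obtain ⟨s, hs⟩ := locSum_eq_finset_sum hf
      (Set.toFinite {g * (y * z), g * y, g * z, g, y * z, y, z})
    refine ⟨s, ?_, ?_, ?_⟩ <;>
    · simp only [defect_apply, LinearMap.sum_apply]
      rw [hs _ (by simp), hs _ (by simp), hs g (by simp)]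
  refine ⟨?_, fun b n y z => ?_, fun b n y z => ?_⟩
  · change (∑ᶠ i, f i 1) = 0
    simp only [(h _).map_one, finsum_zero]
  · obtain ⟨s, h1, h2, h3⟩ := key (psi b n) y z
    rw [h1, h2, h3]
    exact (IsSecondOrder.sum fun i _ => h i).defect_psi b n y z
  · obtain ⟨s, h1, h2, h3⟩ := key (sigma b n) y z
    rw [h1, h2, h3]
    exact (IsSecondOrder.sum fun i _ => h i).defect_sigma b n y z

/-- To recognize an operator of order two it suffices to compute its commutators with the
generators up to multiplication operators. -/
theorem IsSecondOrder.of_commutators {T : Module.End ℂ (Forms r)} (h1 : T 1 = 0)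
    (hpsi : ∀ b n, ∃ U c, IsOddDer U ∧ ∀ y, T (psi b n * y) = psi b n * T y + U y + c * y)
    (hsigma : ∀ b n, ∃ U c, IsEvenDer U ∧
      ∀ y, T (sigma b n * y) = sigma b n * T y + U y + c * y) : IsSecondOrder T := by
  refine ⟨h1, fun b n => ?_, fun b n => ?_⟩
  · obtain ⟨U, c, hU, h⟩ := hpsi b n
    have hc : T (psi b n) = c := by simpa [h1, hU.map_one] using h 1
    have hd : ∀ y, defect T (psi b n) y = U y := by
      intro y; rw [defect_apply, h, hc]; abel
    intro y z
    simp only [hd, hU.leibniz]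
  · obtain ⟨U, c, hU, h⟩ := hsigma b n
    have hc : T (sigma b n) = c := by simpa [h1, hU.map_one] using h 1
    have hd : ∀ y, defect T (sigma b n) y = U y := by
      intro y; rw [defect_apply, h, hc]; abel
    intro y z
    simp only [hd, hU.leibniz]

theorem IsEvenDer.mul_isSecondOrder {X Y : Module.End ℂ (Forms r)} (hX : IsEvenDer X)
    (hY : IsEvenDer Y) : IsSecondOrder (X * Y) := by
  refine .of_commutators (by simp [hY.map_one]) (fun b n => ?_) (fun b n => ?_)
  · refine ⟨lmul (Y (psi b n)) * X + lmul (X (psi b n)) * Y, X (Y (psi b n)),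
      (hX.odd_lmul ?_).add (hY.odd_lmul ?_), fun y => ?_⟩
    · rw [hY.par, parity_psi, Forms.end_neg]
    · rw [hX.par, parity_psi, Forms.end_neg]
    · simp only [Module.End.mul_apply, LinearMap.add_apply, LinearMap.mulLeft_apply, hX.leibniz,
        hY.leibniz, map_add]
      abel
  · refine ⟨lmul (Y (sigma b n)) * X + lmul (X (sigma b n)) * Y, X (Y (sigma b n)),
      (hX.even_lmul ?_).add (hY.even_lmul ?_), fun y => ?_⟩
    · rw [hY.par, parity_sigma]
    · rw [hX.par, parity_sigma]
    · simp only [Module.End.mul_apply, LinearMap.add_apply, LinearMap.mulLeft_apply, hX.leibniz,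
        hY.leibniz, map_add]
      abel

theorem IsOddDer.mul_isSecondOrder {X Y : Module.End ℂ (Forms r)} (hX : IsOddDer X)
    (hY : IsOddDer Y) : IsSecondOrder (X * Y) := by
  refine .of_commutators (by simp [hY.map_one]) (fun b n => ?_) (fun b n => ?_)
  · refine ⟨lmul (Y (psi b n)) * X + (-1 : ℂ) • (lmul (X (psi b n)) * Y), X (Y (psi b n)),
      (hX.even_lmul ?_).add ((hY.even_lmul ?_).smul _), fun y => ?_⟩
    · rw [hY.par, parity_psi, Forms.end_neg, Forms.neg_neg]
    · rw [hX.par, parity_psi, Forms.end_neg, Forms.neg_neg]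
    · simp only [Module.End.mul_apply, LinearMap.add_apply, LinearMap.mulLeft_apply, hX.leibniz,
        hY.leibniz, map_add, parity_psi, hY.par, Forms.end_neg, Forms.neg_neg, Forms.neg_mul,
        LinearMap.smul_apply, Forms.neg_smul, one_smul]
      abel
  · refine ⟨(-1 : ℂ) • (lmul (Y (sigma b n)) * X) + (lmul (X (sigma b n)) * Y), X (Y (sigma b n)),
      ((hX.odd_lmul ?_).smul _).add (hY.odd_lmul ?_), fun y => ?_⟩
    · rw [hY.par, parity_sigma]
    · rw [hX.par, parity_sigma]
    · simp only [Module.End.mul_apply, LinearMap.add_apply, LinearMap.mulLeft_apply, hX.leibniz,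
        hY.leibniz, map_add, parity_sigma, hY.par, Forms.neg_mul, LinearMap.smul_apply, neg_smul,
        one_smul]
      abel

/-- An operator of order two is determined by its values on products of at most two
generators. -/
theorem IsSecondOrder.eq_zero {T : Module.End ℂ (Forms r)} (hT : IsSecondOrder T)
    (hp : ∀ b n, n < 0 → T (psi b n) = 0) (hs : ∀ b n, n ≤ 0 → T (sigma b n) = 0)
    (hpp : ∀ b n c k, n < 0 → k < 0 → T (psi b n * psi c k) = 0)
    (hps : ∀ b n c k, n < 0 → k ≤ 0 → T (psi b n * sigma c k) = 0)
    (hss : ∀ b n c k, n ≤ 0 → k ≤ 0 → T (sigma b n * sigma c k) = 0) : T = 0 := by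
  have h1 : ∀ g, defect T g 1 = 0 := fun g => by simp [defect_apply, hT.map_one]
  have hdp : ∀ b n, n < 0 → ∀ y, defect T (psi b n) y = 0 := by
    intro b n hn y
    induction y using forms_induction with
    | one => exact h1 _
    | add x y hx hy => rw [map_add, hx, hy, add_zero]
    | smul c x hx => rw [map_smul, hx, smul_zero]
    | hpsi c k x hk hx =>
      rw [hT.defect_psi, hx, defect_apply, hpp b n c k hn hk, hp b n hn, hp c k hk]; simp
    | hsigma c k x hk hx =>
      rw [hT.defect_psi, hx, defect_apply, hps b n c k hn hk, hp b n hn, hs c k hk]; simp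
  have hds : ∀ b n, n ≤ 0 → ∀ y, defect T (sigma b n) y = 0 := by
    intro b n hn y
    induction y using forms_induction with
    | one => exact h1 _
    | add x y hx hy => rw [map_add, hx, hy, add_zero]
    | smul c x hx => rw [map_smul, hx, smul_zero]
    | hpsi c k x hk hx =>
      rw [hT.defect_sigma, hx, defect_apply, sigma_mul, hps c k b n hk hn, hs b n hn, hp c k hk]
      simp
    | hsigma c k x hk hx =>
      rw [hT.defect_sigma, hx, defect_apply, hss b n c k hn hk, hs b n hn, hs c k hk]; simp
  refine LinearMap.ext fun x => ?_
  induction x using forms_induction with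
  | one => exact hT.map_one
  | add x y hx hy => rw [map_add, hx, hy]; simp
  | smul c x hx => rw [map_smul, hx]; simp
  | hpsi b n x hn hx =>
    have := hdp b n hn x
    rw [defect_apply, hp b n hn, hx] at this
    simpa using this
  | hsigma b n x hn hx =>
    have := hds b n hn x
    rw [defect_apply, hs b n hn, hx] at this
    simpa using this

/-! ### The hermitian metric -/

theorem monomialNormSq_pos (k : Finset (OddIdx r) × (EvenIdx r →₀ ℕ)) : 0 < monomialNormSq k := by
  refine mul_pos (Finset.prod_pos fun i _ => ?_) (Finset.prod_pos fun j _ => ?_)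
  · have : (((ofLex i).1 : ℤ) : ℝ) < 0 := by exact_mod_cast (ofLex i).1.2
    exact div_pos_of_neg_of_neg (by norm_num) this
  · exact_mod_cast Nat.factorial_pos _

theorem herm_eq_sum (x y : Forms r) {s : Finset (Finset (OddIdx r) × (EvenIdx r →₀ ℕ))}
    (hs : ((monomialBasis r).repr x).support ⊆ s) :
    herm x y = ∑ k ∈ s, (monomialNormSq k : ℂ) * starRingEnd ℂ ((monomialBasis r).repr x k) *
      (monomialBasis r).repr y k :=
  Finsupp.sum_of_support_subset _ hs _ fun k _ => by simp

theorem herm_add_left (x x' y : Forms r) : herm (x + x') y = herm x y + herm x' y := by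
  classical
  set s := ((monomialBasis r).repr x).support ∪ ((monomialBasis r).repr x').support
  rw [herm_eq_sum x y (s := s) Finset.subset_union_left,
    herm_eq_sum x' y (s := s) Finset.subset_union_right, herm_eq_sum (x + x') y (s := s),
    ← Finset.sum_add_distrib]
  · refine Finset.sum_congr rfl fun k _ => ?_
    simp only [map_add, Finsupp.add_apply]
    ring
  · rw [map_add]
    exact Finsupp.support_add

theorem herm_add_right (x y y' : Forms r) : herm x (y + y') = herm x y + herm x y' := by
  simp only [herm_eq_sum x _ subset_rfl, map_add, Finsupp.add_apply, mul_add,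
    Finset.sum_add_distrib]

theorem herm_smul_left (c : ℂ) (x y : Forms r) :
    herm (c • x) y = starRingEnd ℂ c * herm x y := by
  rw [herm_eq_sum x y subset_rfl, herm_eq_sum (c • x) y
    (s := ((monomialBasis r).repr x).support), Finset.mul_sum]
  · refine Finset.sum_congr rfl fun k _ => ?_
    simp only [map_smul, Finsupp.smul_apply, smul_eq_mul, map_mul]
    ring
  · rw [map_smul]
    exact Finsupp.support_smul

theorem herm_smul_right (c : ℂ) (x y : Forms r) : herm x (c • y) = c * herm x y := by
  simp only [herm_eq_sum x _ subset_rfl, map_smul, Finsupp.smul_apply, smul_eq_mul,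
    Finset.mul_sum]
  exact Finset.sum_congr rfl fun k _ => by ring

theorem herm_zero_left (y : Forms r) : herm 0 y = 0 := by
  simpa using herm_smul_left 0 0 y

theorem herm_zero_right (x : Forms r) : herm x 0 = 0 := by
  simpa using herm_smul_right 0 x 0

theorem herm_neg_left (x y : Forms r) : herm (-x) y = -herm x y := by
  simpa [Forms.neg_smul] using herm_smul_left (-1) x y

theorem herm_neg_right (x y : Forms r) : herm x (-y) = -herm x y := by
  simpa [Forms.neg_smul] using herm_smul_right (-1) x y

theorem herm_sub_right (x y y' : Forms r) : herm x (y - y') = herm x y - herm x y' := by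
  rw [Forms.sub_eq_add_neg, herm_add_right, herm_neg_right, sub_eq_add_neg]

theorem herm_sum_left {ι : Type*} (s : Finset ι) (f : ι → Forms r) (y : Forms r) :
    herm (∑ i ∈ s, f i) y = ∑ i ∈ s, herm (f i) y := by
  classical
  induction s using Finset.induction_on with
  | empty => simp [herm_zero_left]
  | insert i s hi ih => rw [Finset.sum_insert hi, Finset.sum_insert hi, herm_add_left, ih]

theorem herm_sum_right {ι : Type*} (s : Finset ι) (x : Forms r) (f : ι → Forms r) :
    herm x (∑ i ∈ s, f i) = ∑ i ∈ s, herm x (f i) := by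
  classical
  induction s using Finset.induction_on with
  | empty => simp [herm_zero_right]
  | insert i s hi ih => rw [Finset.sum_insert hi, Finset.sum_insert hi, herm_add_right, ih]

theorem herm_conj (x y : Forms r) : starRingEnd ℂ (herm x y) = herm y x := by
  classical
  set s := ((monomialBasis r).repr x).support ∪ ((monomialBasis r).repr y).support
  rw [herm_eq_sum x y (s := s) Finset.subset_union_left,
    herm_eq_sum y x (s := s) Finset.subset_union_right, map_sum]
  refine Finset.sum_congr rfl fun k _ => ?_
  simp only [map_mul, Complex.conj_conj, Complex.conj_ofReal]
  ring

theorem herm_self (x : Forms r) : herm x x =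
    ((∑ k ∈ ((monomialBasis r).repr x).support,
      monomialNormSq k * ‖(monomialBasis r).repr x k‖ ^ 2 : ℝ) : ℂ) := by
  rw [herm_eq_sum x x subset_rfl, Complex.ofReal_sum]
  refine Finset.sum_congr rfl fun k _ => ?_
  rw [mul_assoc, Complex.conj_mul']
  push_cast
  rfl

theorem herm_self_re_nonneg (x : Forms r) : 0 ≤ (herm x x).re := by
  rw [herm_self, Complex.ofReal_re]
  exact Finset.sum_nonneg fun k _ => mul_nonneg (monomialNormSq_pos k).le (sq_nonneg _)

theorem eq_zero_of_herm_self {x : Forms r} (h : (herm x x).re = 0) : x = 0 := by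
  rw [herm_self, Complex.ofReal_re, Finset.sum_eq_zero_iff_of_nonneg
    fun k _ => mul_nonneg (monomialNormSq_pos k).le (sq_nonneg _)] at h
  rw [← (monomialBasis r).repr.map_eq_zero_iff]
  ext k
  by_contra hk
  have h1 := h k (Finsupp.mem_support_iff.2 hk)
  rcases mul_eq_zero.1 h1 with h2 | h2
  · exact (monomialNormSq_pos k).ne' h2
  · exact hk (by simpa using h2)

theorem herm_basis (k l : Finset (OddIdx r) × (EvenIdx r →₀ ℕ)) :
    herm (monomialBasis r k) (monomialBasis r l) = if k = l then (monomialNormSq k : ℂ) else 0 := by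
  classical
  rw [herm_eq_sum _ _ (s := {k})]
  · by_cases h : k = l
    · subst h; simp
    · simp [h]
  · rw [Module.Basis.repr_self]
    exact Finsupp.support_single_subset

/-! ### Adjoints -/

theorem IsAdj.symm {T T' : Module.End ℂ (Forms r)} (h : IsAdj T T') : IsAdj T' T := by
  intro x y
  rw [← herm_conj, ← h, herm_conj]

theorem IsAdj.add {T T' U U' : Module.End ℂ (Forms r)} (h : IsAdj T T') (h' : IsAdj U U') :
    IsAdj (T + U) (T' + U') := by
  intro x y
  simp only [LinearMap.add_apply, herm_add_left, herm_add_right, h x y, h' x y]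

theorem IsAdj.smul {T T' : Module.End ℂ (Forms r)} (h : IsAdj T T') (c : ℂ) :
    IsAdj (c • T) (starRingEnd ℂ c • T') := by
  intro x y
  simp only [LinearMap.smul_apply, herm_smul_left, herm_smul_right, h x y]

theorem IsAdj.mul {T T' U U' : Module.End ℂ (Forms r)} (h : IsAdj T T') (h' : IsAdj U U') :
    IsAdj (T * U) (U' * T') := by
  intro x y
  simp only [Module.End.mul_apply, h _ y, h' x _]

theorem IsAdj.sum {ι : Type*} {s : Finset ι} {f f' : ι → Module.End ℂ (Forms r)}
    (h : ∀ i ∈ s, IsAdj (f i) (f' i)) : IsAdj (∑ i ∈ s, f i) (∑ i ∈ s, f' i) := by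
  intro x y
  simp only [LinearMap.sum_apply, herm_sum_left, herm_sum_right]
  exact Finset.sum_congr rfl fun i hi => h i hi x y

theorem IsAdj.locSum {ι : Type*} {f f' : ι → Module.End ℂ (Forms r)} (hf : LocFin f)
    (hf' : LocFin f') (h : ∀ i, IsAdj (f i) (f' i)) : IsAdj (locSum f hf) (locSum f' hf') := by
  classical
  intro x y
  have h1 : LoopKoszul.locSum f hf x = ∑ i ∈ (hf x).toFinset ∪ (hf' y).toFinset, f i x :=
    finsum_eq_sum_of_support_subset _ fun i hi => by
      simp only [Finset.coe_union, Set.Finite.coe_toFinset]; exact Or.inl hi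
  have h2 : LoopKoszul.locSum f' hf' y = ∑ i ∈ (hf x).toFinset ∪ (hf' y).toFinset, f' i y :=
    finsum_eq_sum_of_support_subset _ fun i hi => by
      simp only [Finset.coe_union, Set.Finite.coe_toFinset]; exact Or.inr hi
  rw [h1, h2, herm_sum_left, herm_sum_right]
  exact Finset.sum_congr rfl fun i _ => h i x y

theorem IsAdj.of_basis {T T' : Module.End ℂ (Forms r)}
    (h : ∀ k l, herm (T (monomialBasis r k)) (monomialBasis r l) =
      herm (monomialBasis r k) (T' (monomialBasis r l))) : IsAdj T T' := by
  intro x y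
  induction (monomialBasis r).mem_span x using Submodule.span_induction with
  | zero => simp only [map_zero, herm_zero_left]
  | add x x' _ _ hx hx' => simp only [map_add, herm_add_left, hx, hx']
  | smul c x _ hx => simp only [map_smul, herm_smul_left, hx]
  | mem x hx =>
    obtain ⟨k, rfl⟩ := hx
    induction (monomialBasis r).mem_span y using Submodule.span_induction with
    | zero => simp only [map_zero, herm_zero_right]
    | add y y' _ _ hy hy' => simp only [map_add, herm_add_right, hy, hy']
    | smul c y _ hy => simp only [map_smul, herm_smul_right, hy]
    | mem y hy =>
      obtain ⟨l, rfl⟩ := hy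
      exact h k l

/-! ### Multiplication by the generators -/

/-- The monomial basis of the exterior algebra on the span of the `ψ`. -/
abbrev oddBasis (r : ℕ) :
    Module.Basis (Finset (OddIdx r)) ℂ (ExteriorAlgebra ℂ (OddIdx r →₀ ℂ)) :=
  Module.Basis.ExteriorAlgebra
    (Finsupp.basisSingleOne : Module.Basis (OddIdx r) ℂ (OddIdx r →₀ ℂ))

theorem oddBasis_empty : oddBasis r ∅ = 1 := by
  rw [ExteriorAlgebra.basis_apply_ofCard (n := 0) _ Finset.card_empty,
    ExteriorAlgebra.ιMulti_family]
  simp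

theorem oddBasis_singleton (i : OddIdx r) :
    oddBasis r {i} = ExteriorAlgebra.ι ℂ (Finsupp.single i 1) := by
  rw [ExteriorAlgebra.basis_apply_ofCard (n := 1) _ (Finset.card_singleton i),
    ExteriorAlgebra.ιMulti_family]
  simp [Set.powersetCard.ofFinEmbEquiv]

theorem ι_mul_oddBasis_of_mem {i : OddIdx r} {I : Finset (OddIdx r)} (hi : i ∈ I) :
    ExteriorAlgebra.ι ℂ (Finsupp.single i 1) * oddBasis r I = 0 := by
  have h : ¬Disjoint (Set.powersetCard.ofCard (Finset.card_singleton i)).val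
      (Set.powersetCard.ofCard (rfl : I.card = I.card)).val := by
    simpa using hi
  simpa only [Set.powersetCard.val_ofCard, oddBasis_singleton] using
    ExteriorAlgebra.basis_mul_of_not_disjoint
      (Finsupp.basisSingleOne : Module.Basis (OddIdx r) ℂ (OddIdx r →₀ ℂ)) _ _ h

/-- Multiplication by a generator sends a monomial to a monomial, up to the sign of the permutation
which puts the factors in order. The sign itself is not needed: only its square occurs below. -/
theorem exists_ι_mul_oddBasis {i : OddIdx r} {I : Finset (OddIdx r)} (hi : i ∉ I) :
    ∃ s : ℂ, (s = 1 ∨ s = -1) ∧ ExteriorAlgebra.ι ℂ (Finsupp.single i 1) * oddBasis r I =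
      s • oddBasis r (insert i I) := by
  have h : Disjoint (Set.powersetCard.ofCard (Finset.card_singleton i)).val
      (Set.powersetCard.ofCard (rfl : I.card = I.card)).val := by
    simpa using hi
  have h1 := ExteriorAlgebra.basis_mul_of_disjoint
    (Finsupp.basisSingleOne : Module.Basis (OddIdx r) ℂ (OddIdx r →₀ ℂ)) _ _ h
  simp only [Set.powersetCard.val_ofCard, oddBasis_singleton,
    Set.powersetCard.coe_disjUnion] at h1
  have h2 : Finset.disjUnion {i} I h = insert i I := by
    ext x; exact Finset.mem_disjUnion.trans (by simp)
  rw [h2] at h1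
  rcases Int.units_eq_one_or (Equiv.Perm.sign (Set.powersetCard.permOfDisjoint h)) with hs | hs
  · exact ⟨1, Or.inl rfl, by rw [h1, hs, one_smul, one_smul]⟩
  · refine ⟨-1, Or.inr rfl, ?_⟩
    rw [h1, hs, neg_smul, one_smul, Units.smul_def]
    simp

/-- Contraction with the dual basis vector of `ψ_i`, on the exterior algebra. -/
abbrev oddContract (i : OddIdx r) :=
  CliffordAlgebra.contractLeft (Q := (0 : QuadraticForm ℂ (OddIdx r →₀ ℂ)))
    (Finsupp.lapply i : (OddIdx r →₀ ℂ) →ₗ[ℂ] ℂ)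

theorem oddContract_ι_mul (i j : OddIdx r) (x : ExteriorAlgebra ℂ (OddIdx r →₀ ℂ)) :
    oddContract i (ExteriorAlgebra.ι ℂ (Finsupp.single j 1) * x) =
      (if i = j then x else 0) - ExteriorAlgebra.ι ℂ (Finsupp.single j 1) * oddContract i x := by
  classical
  rw [ExteriorAlgebra.ι, CliffordAlgebra.contractLeft_ι_mul]
  congr 1
  rw [Finsupp.lapply_apply, Finsupp.single_apply]
  split_ifs with h1 h2 h2
  · rw [one_smul]
  · exact absurd h1.symm h2
  · exact absurd h2.symm h1
  · rw [zero_smul]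

theorem oddContract_oddBasis_of_notMem {i : OddIdx r} {I : Finset (OddIdx r)} (hi : i ∉ I) :
    oddContract i (oddBasis r I) = 0 := by
  classical
  induction I using Finset.induction_on with
  | empty => rw [oddBasis_empty, CliffordAlgebra.contractLeft_one]
  | insert j I hj ih =>
    obtain ⟨s, hs, h⟩ := exists_ι_mul_oddBasis hj
    have hs0 : s ≠ 0 := by rcases hs with rfl | rfl <;> simp
    rw [Finset.mem_insert, not_or] at hi
    have h1 := congrArg (oddContract i) h
    rw [oddContract_ι_mul, if_neg hi.1, ih hi.2, mul_zero, sub_zero, map_smul] at h1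
    exact (smul_eq_zero.1 h1.symm).resolve_left hs0

theorem monomialBasis_apply (I : Finset (OddIdx r)) (k : EvenIdx r →₀ ℕ) :
    monomialBasis r (I, k) = oddBasis r I ⊗ₜ MvPolynomial.monomial k 1 := by
  simp [monomialBasis, Module.Basis.tensorProduct_apply]

/-- Multiplication by `ψᵇ(n)` is adjoint to `(-1/n) ∂/∂ψᵇ(n)`. -/
theorem isAdj_lmul_psi (b : Fin r) {n : ℤ} (hn : n < 0) :
    IsAdj (lmul (psi b n)) ((-1 / (n : ℂ)) • dpsi (toLex (⟨n, hn⟩, b))) := by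
  classical
  set i : OddIdx r := toLex (⟨n, hn⟩, b) with hi
  have hpsi : ∀ I k, psi b n * monomialBasis r (I, k) =
      (ExteriorAlgebra.ι ℂ (Finsupp.single i 1) * oddBasis r I) ⊗ₜ
        MvPolynomial.monomial k 1 := by
    intro I k
    rw [monomialBasis_apply, psi, dif_pos hn, Algebra.TensorProduct.tmul_mul_tmul, one_mul]
  have hd : ∀ I k, dpsi i (monomialBasis r (I, k)) =
      oddContract i (oddBasis r I) ⊗ₜ MvPolynomial.monomial k 1 := by
    intro I k
    rw [monomialBasis_apply, dpsi, LinearMap.rTensor_tmul]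
  refine .of_basis ?_
  rintro ⟨I, k⟩ ⟨J, l⟩
  rw [LinearMap.mulLeft_apply, LinearMap.smul_apply, hpsi, hd, herm_smul_right]
  by_cases hJ : i ∈ J
  · obtain ⟨J, hiJ, rfl⟩ : ∃ J', i ∉ J' ∧ insert i J' = J :=
      ⟨J.erase i, Finset.notMem_erase i J, Finset.insert_erase hJ⟩
    obtain ⟨s, hs, h⟩ := exists_ι_mul_oddBasis hiJ
    have hss : s * s = 1 := by rcases hs with rfl | rfl <;> simp
    have h1 : oddContract i (oddBasis r (insert i J)) = s • oddBasis r J := by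
      have h2 : oddBasis r (insert i J) =
          s • (ExteriorAlgebra.ι ℂ (Finsupp.single i 1) * oddBasis r J) := by
        rw [h, smul_smul, hss, one_smul]
      rw [h2, map_smul, oddContract_ι_mul, if_pos rfl, oddContract_oddBasis_of_notMem hiJ,
        mul_zero, sub_zero]
    rw [h1, ← TensorProduct.smul_tmul', ← monomialBasis_apply, herm_smul_right, herm_basis]
    by_cases hI : i ∈ I
    · rw [ι_mul_oddBasis_of_mem hI, TensorProduct.zero_tmul, herm_zero_left, if_neg]
      · simp
      · rintro h; exact hiJ ((Prod.mk.inj h).1 ▸ hI)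
    · by_cases hIJ : I = J
      · subst hIJ
        rw [h, ← TensorProduct.smul_tmul', ← monomialBasis_apply, herm_smul_left, herm_basis]
        have hs2 : starRingEnd ℂ s = s := by rcases hs with rfl | rfl <;> simp
        have h3 : monomialNormSq (insert i I, k) = -1 / n * monomialNormSq (I, k) := by
          rw [monomialNormSq, Finset.prod_insert hI, mul_assoc, monomialNormSq]
          rfl
        by_cases hkl : k = l
        · subst hkl
          rw [if_pos rfl, if_pos rfl, h3, hs2]
          push_cast
          ring
        · rw [if_neg (by simp [hkl]), if_neg (by simp [hkl])]; simp
      · obtain ⟨s', -, h'⟩ := exists_ι_mul_oddBasis hI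
        rw [h', ← TensorProduct.smul_tmul', ← monomialBasis_apply, herm_smul_left, herm_basis,
          if_neg, if_neg]
        · simp
        · simp [hIJ]
        · rintro h
          apply hIJ
          have h4 := congrArg (fun p => Finset.erase p.1 i) h
          simpa [Finset.erase_insert hI, Finset.erase_insert hiJ] using h4
  · rw [oddContract_oddBasis_of_notMem hJ, TensorProduct.zero_tmul, herm_zero_right, mul_zero]
    by_cases hI : i ∈ I
    · rw [ι_mul_oddBasis_of_mem hI, TensorProduct.zero_tmul, herm_zero_left]
    · obtain ⟨s', -, h'⟩ := exists_ι_mul_oddBasis hI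
      rw [h', ← TensorProduct.smul_tmul', ← monomialBasis_apply, herm_smul_left, herm_basis,
        if_neg, mul_zero]
      rintro h
      apply hJ
      rw [← (Prod.mk.inj h).1]
      exact Finset.mem_insert_self i I

theorem monomialNormSq_add_single (I : Finset (OddIdx r)) (k : EvenIdx r →₀ ℕ) (j : EvenIdx r) :
    monomialNormSq (I, k + Finsupp.single j 1) = (k j + 1) * monomialNormSq (I, k) := by
  classical
  have h : ∀ l : EvenIdx r →₀ ℕ, l.support ⊆ insert j k.support →
      ∏ i ∈ l.support, ((l i).factorial : ℝ) =
        (l j).factorial * ∏ i ∈ (insert j k.support).erase j, ((l i).factorial : ℝ) := by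
    intro l hl
    rw [Finset.mul_prod_erase _ (fun i => ((l i).factorial : ℝ)) (Finset.mem_insert_self _ _)]
    exact Finset.prod_subset hl fun i _ hi => by simp [Finsupp.notMem_support_iff.1 hi]
  have h1 : ∀ i ∈ (insert j k.support).erase j,
      (((k + Finsupp.single j 1 : EvenIdx r →₀ ℕ) i).factorial : ℝ) = (k i).factorial := by
    intro i hi
    rw [Finsupp.add_apply, Finsupp.single_eq_of_ne (Finset.ne_of_mem_erase hi), add_zero]
  have hsub : (k + Finsupp.single j 1).support ⊆ insert j k.support := by
    intro i
    simp only [Finsupp.mem_support_iff, Finset.mem_insert, Finsupp.add_apply]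
    intro hi
    by_contra hc
    push Not at hc
    rw [Finsupp.single_eq_of_ne hc.1, hc.2] at hi
    simp at hi
  simp only [monomialNormSq]
  rw [h _ hsub, h k (Finset.subset_insert _ _), Finset.prod_congr rfl h1, Finsupp.add_apply,
    Finsupp.single_eq_same, Nat.factorial_succ]
  push_cast
  ring

/-- Multiplication by `σᵇ(n)` is adjoint to `∂/∂σᵇ(n)`: the factorials in the square norms
account for the exponent brought down by the derivative. -/
theorem isAdj_lmul_sigma (b : Fin r) {n : ℤ} (hn : n ≤ 0) :
    IsAdj (lmul (sigma b n)) (dsigma (⟨n, hn⟩, b)) := by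
  classical
  set j : EvenIdx r := (⟨n, hn⟩, b) with hj
  refine .of_basis ?_
  rintro ⟨I, k⟩ ⟨J, l⟩
  have h1 : sigma b n * monomialBasis r (I, k) = monomialBasis r (I, k + Finsupp.single j 1) := by
    rw [monomialBasis_apply, sigma, dif_pos hn, Algebra.TensorProduct.tmul_mul_tmul, one_mul,
      monomialBasis_apply, MvPolynomial.X, MvPolynomial.monomial_mul, one_mul, add_comm]
  have h2 : dsigma j (monomialBasis r (J, l)) =
      (l j : ℂ) • monomialBasis r (J, l - Finsupp.single j 1) := by
    rw [monomialBasis_apply, dsigma, LinearMap.lTensor_tmul, monomialBasis_apply,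
      ← TensorProduct.tmul_smul]
    simp [MvPolynomial.pderiv_monomial, MvPolynomial.smul_monomial]
  rw [LinearMap.mulLeft_apply, h1, h2, herm_smul_right, herm_basis, herm_basis]
  by_cases hl : l j = 0
  · rw [hl, if_neg]
    · simp
    · rintro h
      have h3 := DFunLike.congr_fun (congrArg Prod.snd h) j
      simp [hl] at h3
  · obtain ⟨l, rfl⟩ : ∃ l', l' + Finsupp.single j 1 = l :=
      ⟨l - Finsupp.single j 1, tsub_add_cancel_of_le (by
        rw [Finsupp.single_le_iff]; omega)⟩
    rw [add_tsub_cancel_right]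
    by_cases h : (I, k) = (J, l)
    · obtain ⟨rfl, rfl⟩ := Prod.mk.inj h
      rw [if_pos rfl, if_pos rfl, monomialNormSq_add_single]
      simp
    · rw [if_neg h, if_neg, mul_zero]
      rintro h4
      apply h
      obtain ⟨rfl, h5⟩ := Prod.mk.inj h4
      rw [add_right_cancel h5]

/-! ### Structure constants -/

section Lie

variable {𝔤 : Type*} [LieRing 𝔤] [LieAlgebra ℂ 𝔤] {θ : CompactForm 𝔤}
  {ξ : Module.Basis (Fin r) ℂ 𝔤}

theorem IsFourierBasis.coord_eq (h : IsFourierBasis θ ξ) (b : Fin r) (x : 𝔤) :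
    ξ.coord b x = killingForm ℂ 𝔤 x (ξ b) := by
  have : ξ.coord b = (killingForm ℂ 𝔤).flip (ξ b) := by
    refine ξ.ext fun a => ?_
    change _ = killingForm ℂ 𝔤 (ξ a) (ξ b)
    rw [h.orthonormal]
    simp [Finsupp.single_apply]
  rw [this]
  rfl

theorem killingForm_lie_left (x y z : 𝔤) :
    killingForm ℂ 𝔤 ⁅x, y⁆ z = -killingForm ℂ 𝔤 y ⁅x, z⁆ := by
  rw [← lie_skew, map_neg, LinearMap.neg_apply, LieModule.traceForm_apply_lie_apply]

/-- The operator `[x, ·]` is skew-symmetric in an orthonormal basis. -/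
theorem IsFourierBasis.coord_lie (h : IsFourierBasis θ ξ) (x : 𝔤) (a b : Fin r) :
    ξ.coord b ⁅x, ξ a⁆ = -ξ.coord a ⁅x, ξ b⁆ := by
  rw [h.coord_eq, h.coord_eq, killingForm_lie_left, LieModule.traceForm_comm]

theorem IsFourierBasis.coad_eq (h : IsFourierBasis θ ξ) (a b c : Fin r) :
    coad ξ a b c = ξ.coord c ⁅ξ a, ξ b⁆ := by
  rw [h.coord_lie]
  simp [coad]

theorem IsFourierBasis.coad_swap (h : IsFourierBasis θ ξ) (a b c : Fin r) :
    coad ξ a c b = -coad ξ a b c := by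
  rw [h.coad_eq, h.coad_eq, h.coord_lie]

/-- In a basis of self-adjoint elements the structure constants are purely imaginary, because
`θ ξ_a = -ξ_a` for the conjugation `θ`. -/
theorem IsFourierBasis.conj_coad (h : IsFourierBasis θ ξ) (a b c : Fin r) :
    starRingEnd ℂ (coad ξ a b c) = -coad ξ a b c := by
  have hθ : ∀ a, θ.conj (ξ a) = -ξ a := fun a => by
    rw [← neg_eq_iff_eq_neg.1 (h.selfAdjoint a)]
  have key : ∀ x : 𝔤, ξ.coord c (θ.conj x) = -starRingEnd ℂ (ξ.coord c x) := by
    intro x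
    conv_lhs => rw [← ξ.sum_repr x]
    simp only [map_sum, LinearMap.map_smulₛₗ, hθ, smul_neg, map_neg]
    simp [Finsupp.single_apply]
  have h1 := key ⁅ξ a, ξ b⁆
  rw [θ.conj_lie, hθ, hθ, lie_neg, neg_lie, neg_neg] at h1
  rw [h.coad_eq]
  exact (neg_eq_iff_eq_neg.2 h1).symm

/-- Invariance of the Casimir element `∑ ξ_a ⊗ ξ_a`. -/
theorem IsFourierBasis.casimir (h : IsFourierBasis θ ξ) (f g : 𝔤 →ₗ[ℂ] Forms r) (x : 𝔤) :
    ∑ a, f ⁅x, ξ a⁆ * g (ξ a) = -∑ a, f (ξ a) * g ⁅x, ξ a⁆ := by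
  have e : ∀ a, ⁅x, ξ a⁆ = ∑ c, ξ.coord c ⁅x, ξ a⁆ • ξ c := fun a => (ξ.sum_repr _).symm
  have e1 : ∀ a, f ⁅x, ξ a⁆ * g (ξ a) = ∑ c, ξ.coord c ⁅x, ξ a⁆ • (f (ξ c) * g (ξ a)) := by
    intro a
    rw [e a, map_sum, Finset.sum_mul]
    exact Finset.sum_congr rfl fun c _ => by rw [map_smul, smul_mul_assoc, ← e]
  have e2 : ∀ a, f (ξ a) * g ⁅x, ξ a⁆ = ∑ c, ξ.coord c ⁅x, ξ a⁆ • (f (ξ a) * g (ξ c)) := by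
    intro a
    rw [e a, map_sum, Finset.mul_sum]
    exact Finset.sum_congr rfl fun c _ => by rw [map_smul, mul_smul_comm, ← e]
  simp only [e1, e2]
  rw [Finset.sum_comm, ← Finset.sum_neg_distrib]
  refine Finset.sum_congr rfl fun a _ => ?_
  rw [← Finset.sum_neg_distrib]
  exact Finset.sum_congr rfl fun c _ => by rw [h.coord_lie, Forms.neg_smul]

theorem IsFourierBasis.casimir_lie (h : IsFourierBasis θ ξ) (f g : 𝔤 →ₗ[ℂ] Forms r) (x y : 𝔤) :
    ∑ a, f ⁅ξ a, x⁆ * g ⁅ξ a, y⁆ = -∑ a, f (ξ a) * g ⁅⁅ξ a, x⁆, y⁆ := by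
  have := h.casimir f (g ∘ₗ (LieModule.toEnd ℂ 𝔤 𝔤 y)) x
  simp only [LinearMap.comp_apply, LieModule.toEnd_apply_apply] at this
  have e : ∀ a, f ⁅ξ a, x⁆ * g ⁅ξ a, y⁆ = f ⁅x, ξ a⁆ * g ⁅y, ξ a⁆ := by
    intro a
    rw [← lie_skew, ← lie_skew _ y, map_neg, map_neg, Forms.neg_mul, Forms.mul_neg, Forms.neg_neg]
  simp only [e, this]
  congr 1
  refine Finset.sum_congr rfl fun a _ => ?_
  rw [← lie_skew (ξ a) x, neg_lie, lie_skew]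

theorem IsFourierBasis.casimir_lie_left (h : IsFourierBasis θ ξ) (f g : 𝔤 →ₗ[ℂ] Forms r)
    (x y : 𝔤) :
    ∑ a, f ⁅x, ξ a⁆ * g ⁅ξ a, y⁆ = -∑ a, f (ξ a) * g ⁅⁅x, ξ a⁆, y⁆ := by
  have e : ∀ a, f ⁅x, ξ a⁆ * g ⁅ξ a, y⁆ = -(f ⁅ξ a, x⁆ * g ⁅ξ a, y⁆) := by
    intro a
    rw [← lie_skew, map_neg, Forms.neg_mul]
  have e' : ∀ a, f (ξ a) * g ⁅⁅x, ξ a⁆, y⁆ = -(f (ξ a) * g ⁅⁅ξ a, x⁆, y⁆) := by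
    intro a
    rw [← lie_skew (ξ a) x, neg_lie, map_neg, Forms.mul_neg, Forms.neg_neg]
  simp only [e, e', Finset.sum_neg_distrib, h.casimir_lie]

/-- The Casimir element acts as the identity in the adjoint representation. -/
theorem IsFourierBasis.casimir_adjoint (h : IsFourierBasis θ ξ) (x : 𝔤) :
    ∑ a, ⁅ξ a, ⁅ξ a, x⁆⁆ = x := by
  have key : ∀ b, killingForm ℂ 𝔤 (∑ a, ⁅ξ a, ⁅ξ a, x⁆⁆) (ξ b) = killingForm ℂ 𝔤 x (ξ b) := by
    intro b
    have h1 : killingForm ℂ 𝔤 x (ξ b) = ∑ a, ξ.coord a ⁅x, ⁅ξ b, ξ a⁆⁆ := by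
      rw [killingForm, LieModule.traceForm_apply_apply, LinearMap.trace_eq_matrix_trace ℂ ξ,
        Matrix.trace]
      refine Finset.sum_congr rfl fun a _ => ?_
      simp [LinearMap.toMatrix_apply]
    rw [h1, map_sum, LinearMap.sum_apply]
    refine Finset.sum_congr rfl fun a _ => ?_
    rw [h.coord_eq, killingForm_lie_left (ξ a), killingForm_lie_left x, ← lie_skew (ξ a) (ξ b),
      ← lie_skew (ξ a) x, map_neg, map_neg, LinearMap.neg_apply, neg_neg,
      LieModule.traceForm_comm]
  refine ξ.ext_elem fun b => ?_
  have := key b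
  rwa [← h.coord_eq, ← h.coord_eq] at this

end Lie

/-! ### Values of the operators on the generators -/

section Values

variable {𝔤 : Type*} [LieRing 𝔤] [LieAlgebra ℂ 𝔤] {θ : CompactForm 𝔤}
  (ξ : Module.Basis (Fin r) ℂ 𝔤)

/-- The odd generators of energy `p`, as a linear map on `𝔤`: it sends `ξ_a` to `ψᵃ(-p)`, and is
zero if `p ≤ 0`. -/
def psiL (p : ℤ) : 𝔤 →ₗ[ℂ] Forms r := ξ.constr ℂ fun c => psi c (-p)

/-- The even generators of energy `p`, as a linear map on `𝔤`: it sends `ξ_a` to `σᵃ(-p)`, and is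
zero if `p < 0`. -/
def sigmaL (p : ℤ) : 𝔤 →ₗ[ℂ] Forms r := ξ.constr ℂ fun c => sigma c (-p)

theorem psiL_basis (p : ℤ) (b : Fin r) : psiL ξ p (ξ b) = psi b (-p) := by
  simp [psiL]

theorem sigmaL_basis (p : ℤ) (b : Fin r) : sigmaL ξ p (ξ b) = sigma b (-p) := by
  simp [sigmaL]

theorem psiL_of_nonpos {p : ℤ} (hp : p ≤ 0) (x : 𝔤) : psiL ξ p x = 0 := by
  have : psiL ξ p = 0 := ξ.ext fun b => by
    rw [psiL_basis, psi_of_nonneg _ (by omega), LinearMap.zero_apply]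
  rw [this, LinearMap.zero_apply]

theorem sigmaL_of_neg {p : ℤ} (hp : p < 0) (x : 𝔤) : sigmaL ξ p x = 0 := by
  have : sigmaL ξ p = 0 := ξ.ext fun b => by
    rw [sigmaL_basis, sigma_of_pos _ (by omega), LinearMap.zero_apply]
  rw [this, LinearMap.zero_apply]

theorem parity_psiL (p : ℤ) (x : 𝔤) : parity (psiL ξ p x) = -psiL ξ p x := by
  have : parity.toLinearMap ∘ₗ psiL ξ p = -psiL ξ p := ξ.ext fun b => by
    simp [psiL_basis, parity_psi]
  exact LinearMap.congr_fun this x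

theorem parity_sigmaL (p : ℤ) (x : 𝔤) : parity (sigmaL ξ p x) = sigmaL ξ p x := by
  have : parity.toLinearMap ∘ₗ sigmaL ξ p = sigmaL ξ p := ξ.ext fun b => by
    simp [sigmaL_basis, parity_sigma]
  exact LinearMap.congr_fun this x

theorem psiL_mul (p : ℤ) (x : 𝔤) (y : Forms r) : psiL ξ p x * y = parity y * psiL ξ p x :=
  odd_mul (parity_psiL ξ p x) y

theorem sigmaL_mul (p : ℤ) (x : 𝔤) (y : Forms r) : sigmaL ξ p x * y = y * sigmaL ξ p x :=
  even_mul (parity_sigmaL ξ p x) y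

theorem psiL_mul_psiL (p q : ℤ) (x y : 𝔤) :
    psiL ξ p x * psiL ξ q y = -(psiL ξ q y * psiL ξ p x) := by
  rw [psiL_mul, parity_psiL, Forms.neg_mul]

variable {ξ}

theorem IsFourierBasis.psiBr_eq (h : IsFourierBasis θ ξ) (a b : Fin r) (n : ℤ) :
    psiBr ξ a b n = psiL ξ (-n) ⁅ξ a, ξ b⁆ := by
  conv_rhs => rw [← ξ.sum_repr ⁅ξ a, ξ b⁆]
  rw [map_sum, psiBr]
  refine Finset.sum_congr rfl fun c _ => ?_
  rw [map_smul, psiL_basis, neg_neg, h.coad_eq]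
  rfl

theorem IsFourierBasis.sigmaBr_eq (h : IsFourierBasis θ ξ) (a b : Fin r) (n : ℤ) :
    sigmaBr ξ a b n = sigmaL ξ (-n) ⁅ξ a, ξ b⁆ := by
  conv_rhs => rw [← ξ.sum_repr ⁅ξ a, ξ b⁆]
  rw [map_sum, sigmaBr]
  refine Finset.sum_congr rfl fun c _ => ?_
  rw [map_smul, sigmaL_basis, neg_neg, h.coad_eq]
  rfl

theorem der_psiL (u v : Fin r → ℤ → Forms r) {p : ℤ} (hp : 0 < p) (f : 𝔤 →ₗ[ℂ] Forms r)
    (hf : ∀ b, u b (-p) = f (ξ b)) (x : 𝔤) : der u v (psiL ξ p x) = f x := by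
  have : der u v ∘ₗ psiL ξ p = f := ξ.ext fun b => by
    rw [LinearMap.comp_apply, psiL_basis, der_psi _ _ _ _ (by omega), hf]
  exact LinearMap.congr_fun this x

theorem der_sigmaL (u v : Fin r → ℤ → Forms r) {p : ℤ} (hp : 0 ≤ p) (f : 𝔤 →ₗ[ℂ] Forms r)
    (hf : ∀ b, v b (-p) = f (ξ b)) (x : 𝔤) : der u v (sigmaL ξ p x) = f x := by
  have : der u v ∘ₗ sigmaL ξ p = f := ξ.ext fun b => by
    rw [LinearMap.comp_apply, sigmaL_basis, der_sigma _ _ _ _ (by omega), hf]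
  exact LinearMap.congr_fun this x

theorem der_zero_psiL (v : Fin r → ℤ → Forms r) (p : ℤ) (x : 𝔤) :
    der 0 v (psiL ξ p x) = 0 := by
  rcases lt_or_ge 0 p with hp | hp
  · exact der_psiL 0 v hp 0 (fun _ => rfl) x
  · rw [psiL_of_nonpos ξ hp, map_zero]

theorem der_zero_sigmaL (u : Fin r → ℤ → Forms r) (p : ℤ) (x : 𝔤) :
    der u 0 (sigmaL ξ p x) = 0 := by
  rcases le_or_gt 0 p with hp | hp
  · exact der_sigmaL u 0 hp 0 (fun _ => rfl) x
  · rw [sigmaL_of_neg ξ hp, map_zero]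

theorem ad_sigmaL (a : Fin r) (m p : ℤ) (x : 𝔤) : ad ξ a m (sigmaL ξ p x) = 0 :=
  der_zero_sigmaL _ p x

theorem adStar_sigmaL (a : Fin r) (m p : ℤ) (x : 𝔤) : adStar ξ a m (sigmaL ξ p x) = 0 :=
  der_zero_sigmaL _ p x

theorem dStar_sigmaL (a : Fin r) (m p : ℤ) (x : 𝔤) : dStar ξ a m (sigmaL ξ p x) = 0 :=
  der_zero_sigmaL _ p x

theorem R_psiL (a : Fin r) (m p : ℤ) (x : 𝔤) : R ξ a m (psiL ξ p x) = 0 :=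
  der_zero_psiL _ p x

theorem d_psiL (a : Fin r) (m p : ℤ) (x : 𝔤) : d ξ a m (psiL ξ p x) = 0 :=
  der_zero_psiL _ p x

theorem IsFourierBasis.ad_psiL (h : IsFourierBasis θ ξ) (a : Fin r) (m : ℤ) {p : ℤ} (hp : 0 < p)
    (x : 𝔤) : ad ξ a m (psiL ξ p x) = psiL ξ (p - m) ⁅ξ a, x⁆ :=
  der_psiL _ _ hp (psiL ξ (p - m) ∘ₗ LieModule.toEnd ℂ 𝔤 𝔤 (ξ a))
    (fun b => by rw [h.psiBr_eq, neg_add_rev, neg_neg, ← sub_eq_add_neg]; rfl) x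

theorem IsFourierBasis.R_sigmaL (h : IsFourierBasis θ ξ) (a : Fin r) (m : ℤ) {p : ℤ} (hp : 0 ≤ p)
    (x : 𝔤) : R ξ a m (sigmaL ξ p x) = sigmaL ξ (p - m) ⁅ξ a, x⁆ :=
  der_sigmaL _ _ hp (sigmaL ξ (p - m) ∘ₗ LieModule.toEnd ℂ 𝔤 𝔤 (ξ a))
    (fun b => by rw [h.sigmaBr_eq, neg_add_rev, neg_neg, ← sub_eq_add_neg]; rfl) x

theorem IsFourierBasis.adStar_psiL (h : IsFourierBasis θ ξ) (a : Fin r) (m : ℤ) {p : ℤ}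
    (hp : 0 < p) (x : 𝔤) :
    adStar ξ a m (psiL ξ p x) = (((p : ℂ) + m) / p) • psiL ξ (p + m) ⁅ξ a, x⁆ :=
  der_psiL _ _ hp ((((p : ℂ) + m) / p) • (psiL ξ (p + m) ∘ₗ LieModule.toEnd ℂ 𝔤 𝔤 (ξ a)))
    (fun b => by
      rw [h.psiBr_eq, neg_sub, sub_neg_eq_add, add_comm m p]
      have : ((((-p : ℤ) : ℂ) - m) / ((-p : ℤ) : ℂ)) = ((p : ℂ) + m) / p := by
        push_cast
        rw [← neg_add', neg_div_neg_eq]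
      rw [this]
      rfl) x

theorem IsFourierBasis.d_sigmaL (h : IsFourierBasis θ ξ) (a : Fin r) (m : ℤ) {p : ℤ} (hp : 0 ≤ p)
    (x : 𝔤) : d ξ a m (sigmaL ξ p x) = psiL ξ (p - m) ⁅ξ a, x⁆ :=
  der_sigmaL _ _ hp (psiL ξ (p - m) ∘ₗ LieModule.toEnd ℂ 𝔤 𝔤 (ξ a))
    (fun b => by rw [h.psiBr_eq, neg_add_rev, neg_neg, ← sub_eq_add_neg]; rfl) x

theorem IsFourierBasis.dStar_psiL (h : IsFourierBasis θ ξ) (a : Fin r) (m : ℤ) {p : ℤ}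
    (hp : 0 < p) (x : 𝔤) :
    dStar ξ a m (psiL ξ p x) = (1 / (p : ℂ)) • sigmaL ξ (p + m) ⁅ξ a, x⁆ :=
  der_psiL _ _ hp ((1 / (p : ℂ)) • (sigmaL ξ (p + m) ∘ₗ LieModule.toEnd ℂ 𝔤 𝔤 (ξ a)))
    (fun b => by
      rw [h.sigmaBr_eq, neg_sub, sub_neg_eq_add, add_comm m p]
      have : (-1 / ((-p : ℤ) : ℂ)) = 1 / p := by
        push_cast
        rw [neg_div_neg_eq]
      rw [this]
      rfl) x

theorem IsFourierBasis.isEvenDer_ad (h : IsFourierBasis θ ξ) (a : Fin r) (m : ℤ) :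
    IsEvenDer (ad ξ a m) :=
  isEvenDer_der (fun b n => by rw [h.psiBr_eq, parity_psiL]) (fun b n => by simp)

theorem IsFourierBasis.isEvenDer_adStar (h : IsFourierBasis θ ξ) (a : Fin r) (m : ℤ) :
    IsEvenDer (adStar ξ a m) :=
  isEvenDer_der (fun b n => by rw [h.psiBr_eq, map_smul, parity_psiL, Forms.smul_neg])
    (fun b n => by simp)

theorem IsFourierBasis.isEvenDer_R (h : IsFourierBasis θ ξ) (a : Fin r) (m : ℤ) :
    IsEvenDer (R ξ a m) :=
  isEvenDer_der (fun b n => by simp) (fun b n => by rw [h.sigmaBr_eq, parity_sigmaL])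

theorem IsFourierBasis.isOddDer_d (h : IsFourierBasis θ ξ) (a : Fin r) (m : ℤ) :
    IsOddDer (d ξ a m) :=
  isOddDer_der (fun b n => by simp) (fun b n => by rw [h.psiBr_eq, parity_psiL])

theorem IsFourierBasis.isOddDer_dStar (h : IsFourierBasis θ ξ) (a : Fin r) (m : ℤ) :
    IsOddDer (dStar ξ a m) :=
  isOddDer_der (fun b n => by rw [h.sigmaBr_eq, map_smul, parity_sigmaL]) (fun b n => by simp)

theorem isOddDer_psiStar (a : Fin r) (m : ℕ+) : IsOddDer (psiStar a m) :=
  (isOddDer_dpsi _).smul _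

end Values

/-! ### Adjoints of derivations -/

/-- The hermitian adjoint of multiplication by `ψᵇ(n)`, zero if `n ≥ 0`. -/
def psiAdj (b : Fin r) (n : ℤ) : Module.End ℂ (Forms r) :=
  if h : n < 0 then (-1 / (n : ℂ)) • dpsi (toLex (⟨n, h⟩, b)) else 0

/-- The hermitian adjoint of multiplication by `σᵇ(n)`, zero if `n > 0`. -/
def sigmaAdj (b : Fin r) (n : ℤ) : Module.End ℂ (Forms r) :=
  if h : n ≤ 0 then dsigma (⟨n, h⟩, b) else 0

theorem isAdj_lmul_psi_psiAdj (b : Fin r) (n : ℤ) : IsAdj (lmul (psi b n)) (psiAdj b n) := by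
  by_cases hn : n < 0
  · rw [psiAdj, dif_pos hn]
    exact isAdj_lmul_psi b hn
  · rw [psiAdj, dif_neg hn, psi_of_nonneg b (by omega)]
    intro x y
    simp [herm_zero_left, herm_zero_right]

theorem isAdj_lmul_sigma_sigmaAdj (b : Fin r) (n : ℤ) :
    IsAdj (lmul (sigma b n)) (sigmaAdj b n) := by
  by_cases hn : n ≤ 0
  · rw [sigmaAdj, dif_pos hn]
    exact isAdj_lmul_sigma b hn
  · rw [sigmaAdj, dif_neg hn, sigma_of_pos b (by omega)]
    intro x y
    simp [herm_zero_left, herm_zero_right]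

theorem isOddDer_psiAdj (b : Fin r) (n : ℤ) : IsOddDer (psiAdj b n) := by
  unfold psiAdj
  split_ifs
  · exact (isOddDer_dpsi _).smul _
  · exact .zero

theorem isEvenDer_sigmaAdj (b : Fin r) (n : ℤ) : IsEvenDer (sigmaAdj b n) := by
  unfold sigmaAdj
  split_ifs
  · exact isEvenDer_dsigma _
  · exact .zero

theorem dpsi_psi (i : OddIdx r) (c : Fin r) {k : ℤ} (hk : k < 0) :
    dpsi i (psi c k) = (if i = toLex (⟨k, hk⟩, c) then 1 else 0 : ℂ) • (1 : Forms r) := by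
  classical
  rw [psi, dif_pos hk, dpsi, LinearMap.rTensor_tmul, ExteriorAlgebra.ι,
    CliffordAlgebra.contractLeft_ι, Algebra.TensorProduct.one_def, TensorProduct.smul_tmul',
    Algebra.algebraMap_eq_smul_one, Finsupp.lapply_apply, Finsupp.single_apply]
  congr 3
  exact propext eq_comm

theorem dpsi_sigma (i : OddIdx r) (c : Fin r) (k : ℤ) : dpsi i (sigma c k) = 0 := by
  unfold sigma
  split_ifs
  · simp [dpsi]
  · simp

theorem dsigma_sigma (j : EvenIdx r) (c : Fin r) {k : ℤ} (hk : k ≤ 0) :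
    dsigma j (sigma c k) = (if j = (⟨k, hk⟩, c) then 1 else 0 : ℂ) • (1 : Forms r) := by
  classical
  rw [sigma, dif_pos hk, dsigma, LinearMap.lTensor_tmul, Algebra.TensorProduct.one_def,
    ← TensorProduct.tmul_smul]
  congr 1
  change MvPolynomial.pderiv j _ = _
  rw [MvPolynomial.pderiv_X, Pi.single_apply]
  by_cases h : j = (⟨k, hk⟩, c)
  · rw [if_pos h, if_pos h.symm, one_smul]
  · rw [if_neg h, if_neg (Ne.symm h), zero_smul]

theorem dsigma_psi (j : EvenIdx r) (c : Fin r) (k : ℤ) : dsigma j (psi c k) = 0 := by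
  unfold psi
  split_ifs
  · simp [dsigma]
  · simp

theorem psiAdj_psi (b c : Fin r) (n k : ℤ) : psiAdj b n (psi c k) =
    (if b = c then if n = k ∧ n < 0 then -1 / (n : ℂ) else 0 else 0) • (1 : Forms r) := by
  by_cases hn : n < 0
  · rw [psiAdj, dif_pos hn]
    by_cases hk : k < 0
    · rw [LinearMap.smul_apply, dpsi_psi _ _ hk, smul_smul]
      congr 1
      by_cases h1 : b = c <;> by_cases h2 : n = k <;> simp [h1, h2, hk]
    · rw [psi_of_nonneg c (by omega), map_zero, if_neg (show ¬(n = k ∧ n < 0) by omega)]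
      simp
  · rw [psiAdj, dif_neg hn, if_neg (show ¬(n = k ∧ n < 0) by omega)]
    simp

theorem psiAdj_sigma (b c : Fin r) (n k : ℤ) : psiAdj b n (sigma c k) = 0 := by
  unfold psiAdj
  split_ifs
  · rw [LinearMap.smul_apply, dpsi_sigma, smul_zero]
  · rfl

theorem sigmaAdj_sigma (b c : Fin r) (n k : ℤ) : sigmaAdj b n (sigma c k) =
    (if b = c then if n = k ∧ n ≤ 0 then (1 : ℂ) else 0 else 0) • (1 : Forms r) := by
  by_cases hn : n ≤ 0
  · rw [sigmaAdj, dif_pos hn]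
    by_cases hk : k ≤ 0
    · rw [dsigma_sigma _ _ hk]
      congr 1
      by_cases h1 : b = c <;> by_cases h2 : n = k <;> simp [h1, h2, hk]
    · rw [sigma_of_pos c (by omega), map_zero, if_neg (show ¬(n = k ∧ n ≤ 0) by omega)]
      simp
  · rw [sigmaAdj, dif_neg hn, if_neg (show ¬(n = k ∧ n ≤ 0) by omega)]
    simp

theorem sigmaAdj_psi (b c : Fin r) (n k : ℤ) : sigmaAdj b n (psi c k) = 0 := by
  unfold sigmaAdj
  split_ifs
  · rw [dsigma_psi]
  · rfl

theorem herm_one_psi_mul (b : Fin r) (n : ℤ) (y : Forms r) : herm 1 (psi b n * y) = 0 := by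
  have := (isAdj_lmul_psi_psiAdj b n).symm 1 y
  rwa [(isOddDer_psiAdj b n).map_one, herm_zero_left, eq_comm] at this

theorem herm_one_sigma_mul (b : Fin r) (n : ℤ) (y : Forms r) : herm 1 (sigma b n * y) = 0 := by
  have := (isAdj_lmul_sigma_sigmaAdj b n).symm 1 y
  rwa [(isEvenDer_sigmaAdj b n).map_one, herm_zero_left, eq_comm] at this

/-- Two even derivations are adjoint if the commutators of the second with the annihilation
operators are the adjoints of multiplication by the values of the first, and if the ideal
generated by the values of the second is orthogonal to `1`. -/
theorem IsEvenDer.isAdj {T T' : Module.End ℂ (Forms r)} (hT : IsEvenDer T) (hT' : IsEvenDer T')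
    (vac_psi : ∀ b n y, n < 0 → herm 1 (T' (psi b n) * y) = 0)
    (vac_sigma : ∀ b n y, n ≤ 0 → herm 1 (T' (sigma b n) * y) = 0)
    (hpsi : ∀ b n, n < 0 → IsAdj (lmul (T (psi b n))) (psiAdj b n * T' - T' * psiAdj b n))
    (hsigma : ∀ b n, n ≤ 0 →
      IsAdj (lmul (T (sigma b n))) (sigmaAdj b n * T' - T' * sigmaAdj b n)) : IsAdj T T' := by
  intro x
  induction x using forms_induction with
  | one =>
    intro y
    rw [hT.map_one, herm_zero_left, eq_comm]
    induction y using forms_induction with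
    | one => rw [hT'.map_one, herm_zero_right]
    | add x y hx hy => rw [map_add, herm_add_right, hx, hy, add_zero]
    | smul c y hy => rw [map_smul, herm_smul_right, hy, mul_zero]
    | hpsi b n y hn _ =>
      rw [hT'.leibniz, herm_add_right, vac_psi b n y hn, herm_one_psi_mul, add_zero]
    | hsigma b n y hn _ =>
      rw [hT'.leibniz, herm_add_right, vac_sigma b n y hn, herm_one_sigma_mul, add_zero]
  | add x x' hx hx' => intro y; rw [map_add, herm_add_left, herm_add_left, hx, hx']
  | smul c x hx => intro y; rw [map_smul, herm_smul_left, herm_smul_left, hx]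
  | hpsi b n x hn hx =>
    intro y
    have h1 := hpsi b n hn x y
    have h2 := isAdj_lmul_psi_psiAdj b n
    rw [LinearMap.mulLeft_apply, LinearMap.sub_apply, Module.End.mul_apply,
      Module.End.mul_apply, herm_sub_right, ← hx] at h1
    have h3 := h2 (T x) y
    have h4 := h2 x (T' y)
    rw [LinearMap.mulLeft_apply] at h3 h4
    rw [hT.leibniz, herm_add_left, h1, h3, h4]
    ring
  | hsigma b n x hn hx =>
    intro y
    have h1 := hsigma b n hn x y
    have h2 := isAdj_lmul_sigma_sigmaAdj b n
    rw [LinearMap.mulLeft_apply, LinearMap.sub_apply, Module.End.mul_apply,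
      Module.End.mul_apply, herm_sub_right, ← hx] at h1
    have h3 := h2 (T x) y
    have h4 := h2 x (T' y)
    rw [LinearMap.mulLeft_apply] at h3 h4
    rw [hT.leibniz, herm_add_left, h1, h3, h4]
    ring

/-- The analogue of `IsEvenDer.isAdj` for odd derivations. -/
theorem IsOddDer.isAdj {T T' : Module.End ℂ (Forms r)} (hT : IsOddDer T) (hT' : IsOddDer T')
    (vac_psi : ∀ b n y, n < 0 → herm 1 (T' (psi b n) * y) = 0)
    (vac_sigma : ∀ b n y, n ≤ 0 → herm 1 (T' (sigma b n) * y) = 0)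
    (hpsi : ∀ b n, n < 0 → IsAdj (lmul (T (psi b n))) (psiAdj b n * T' + T' * psiAdj b n))
    (hsigma : ∀ b n, n ≤ 0 →
      IsAdj (lmul (T (sigma b n))) (sigmaAdj b n * T' - T' * sigmaAdj b n)) : IsAdj T T' := by
  intro x
  induction x using forms_induction with
  | one =>
    intro y
    rw [hT.map_one, herm_zero_left, eq_comm]
    induction y using forms_induction with
    | one => rw [hT'.map_one, herm_zero_right]
    | add x y hx hy => rw [map_add, herm_add_right, hx, hy, add_zero]
    | smul c y hy => rw [map_smul, herm_smul_right, hy, mul_zero]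
    | hpsi b n y hn _ =>
      rw [hT'.leibniz, herm_add_right, vac_psi b n y hn, parity_psi, Forms.neg_mul,
        herm_neg_right, herm_one_psi_mul, add_neg_cancel]
    | hsigma b n y hn _ =>
      rw [hT'.leibniz, herm_add_right, vac_sigma b n y hn, parity_sigma, herm_one_sigma_mul,
        add_zero]
  | add x x' hx hx' => intro y; rw [map_add, herm_add_left, herm_add_left, hx, hx']
  | smul c x hx => intro y; rw [map_smul, herm_smul_left, herm_smul_left, hx]
  | hpsi b n x hn hx =>
    intro y
    have h1 := hpsi b n hn x y
    have h2 := isAdj_lmul_psi_psiAdj b n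
    rw [LinearMap.mulLeft_apply, LinearMap.add_apply, Module.End.mul_apply,
      Module.End.mul_apply, herm_add_right, ← hx] at h1
    have h3 := h2 (T x) y
    have h4 := h2 x (T' y)
    rw [LinearMap.mulLeft_apply] at h3 h4
    rw [hT.leibniz, herm_add_left, parity_psi, Forms.neg_mul, herm_neg_left, h1, h3, h4]
    ring
  | hsigma b n x hn hx =>
    intro y
    have h1 := hsigma b n hn x y
    have h2 := isAdj_lmul_sigma_sigmaAdj b n
    rw [LinearMap.mulLeft_apply, LinearMap.sub_apply, Module.End.mul_apply,
      Module.End.mul_apply, herm_sub_right, ← hx] at h1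
    have h3 := h2 (T x) y
    have h4 := h2 x (T' y)
    rw [LinearMap.mulLeft_apply] at h3 h4
    rw [hT.leibniz, herm_add_left, parity_sigma, h1, h3, h4]
    ring

section Operators

variable {𝔤 : Type*} [LieRing 𝔤] [LieAlgebra ℂ 𝔤] {θ : CompactForm 𝔤}
  {ξ : Module.Basis (Fin r) ℂ 𝔤}

theorem herm_one_psiBr_mul (a b : Fin r) (n : ℤ) (y : Forms r) :
    herm 1 (psiBr ξ a b n * y) = 0 := by
  simp only [psiBr, Finset.sum_mul, smul_mul_assoc, herm_sum_right, herm_smul_right,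
    herm_one_psi_mul, mul_zero, Finset.sum_const_zero]

theorem herm_one_sigmaBr_mul (a b : Fin r) (n : ℤ) (y : Forms r) :
    herm 1 (sigmaBr ξ a b n * y) = 0 := by
  simp only [sigmaBr, Finset.sum_mul, smul_mul_assoc, herm_sum_right, herm_smul_right,
    herm_one_sigma_mul, mul_zero, Finset.sum_const_zero]

theorem isAdj_lmul_psiBr (a b : Fin r) (n : ℤ) : IsAdj (lmul (psiBr ξ a b n))
    (∑ c, starRingEnd ℂ (coad ξ a b c) • psiAdj c n) := by
  have : lmul (psiBr ξ a b n) = ∑ c, coad ξ a b c • lmul (psi c n) := by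
    refine LinearMap.ext fun x => ?_
    simp only [psiBr, Finset.sum_mul, LinearMap.sum_apply, LinearMap.mulLeft_apply,
      LinearMap.smul_apply]
    exact Finset.sum_congr rfl fun c _ => smul_mul_assoc _ _ _
  rw [this]
  exact IsAdj.sum fun c _ => (isAdj_lmul_psi_psiAdj c n).smul _

theorem isAdj_lmul_sigmaBr (a b : Fin r) (n : ℤ) : IsAdj (lmul (sigmaBr ξ a b n))
    (∑ c, starRingEnd ℂ (coad ξ a b c) • sigmaAdj c n) := by
  have : lmul (sigmaBr ξ a b n) = ∑ c, coad ξ a b c • lmul (sigma c n) := by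
    refine LinearMap.ext fun x => ?_
    simp only [sigmaBr, Finset.sum_mul, LinearMap.sum_apply, LinearMap.mulLeft_apply,
      LinearMap.smul_apply]
    exact Finset.sum_congr rfl fun c _ => smul_mul_assoc _ _ _
  rw [this]
  exact IsAdj.sum fun c _ => (isAdj_lmul_sigma_sigmaAdj c n).smul _

theorem isAdj_lmul_zero : IsAdj (lmul (0 : Forms r)) 0 := by
  intro x y
  simp [herm_zero_left, herm_zero_right]

theorem psiAdj_psiBr (a b e : Fin r) (n k : ℤ) : psiAdj b n (psiBr ξ a e k) =
    (if n = k ∧ n < 0 then coad ξ a e b * (-1 / n) else 0) • (1 : Forms r) := by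
  simp only [psiBr, map_sum, map_smul, psiAdj_psi, smul_smul, ← Finset.sum_smul, mul_ite,
    mul_zero, Finset.sum_ite_eq, Finset.mem_univ, if_true]

theorem psiAdj_sigmaBr (a b e : Fin r) (n k : ℤ) : psiAdj b n (sigmaBr ξ a e k) = 0 := by
  simp only [sigmaBr, map_sum, map_smul, psiAdj_sigma, smul_zero, Finset.sum_const_zero]

theorem sigmaAdj_psiBr (a b e : Fin r) (n k : ℤ) : sigmaAdj b n (psiBr ξ a e k) = 0 := by
  simp only [psiBr, map_sum, map_smul, sigmaAdj_psi, smul_zero, Finset.sum_const_zero]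

theorem sigmaAdj_sigmaBr (a b e : Fin r) (n k : ℤ) : sigmaAdj b n (sigmaBr ξ a e k) =
    (if n = k ∧ n ≤ 0 then coad ξ a e b else 0) • (1 : Forms r) := by
  simp only [sigmaBr, map_sum, map_smul, sigmaAdj_sigma, smul_smul, ← Finset.sum_smul, mul_ite,
    mul_zero, mul_one, Finset.sum_ite_eq, Finset.mem_univ, if_true]

theorem sum_smul_psiAdj_psi (c : Fin r → ℂ) (e : Fin r) (n k : ℤ) :
    (∑ i, c i • psiAdj i n) (psi e k) =
      (if n = k ∧ n < 0 then c e * (-1 / n) else 0) • (1 : Forms r) := by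
  simp only [LinearMap.sum_apply, LinearMap.smul_apply, psiAdj_psi, smul_smul,
    ← Finset.sum_smul, mul_ite, mul_zero, Finset.sum_ite_eq', Finset.mem_univ, if_true]

theorem sum_smul_psiAdj_sigma (c : Fin r → ℂ) (e : Fin r) (n k : ℤ) :
    (∑ i, c i • psiAdj i n) (sigma e k) = 0 := by
  simp only [LinearMap.sum_apply, LinearMap.smul_apply, psiAdj_sigma, smul_zero,
    Finset.sum_const_zero]

theorem sum_smul_sigmaAdj_sigma (c : Fin r → ℂ) (e : Fin r) (n k : ℤ) :
    (∑ i, c i • sigmaAdj i n) (sigma e k) =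
      (if n = k ∧ n ≤ 0 then c e else 0) • (1 : Forms r) := by
  simp only [LinearMap.sum_apply, LinearMap.smul_apply, sigmaAdj_sigma, smul_smul,
    ← Finset.sum_smul, mul_ite, mul_zero, mul_one, Finset.sum_ite_eq', Finset.mem_univ, if_true]

theorem sum_smul_sigmaAdj_psi (c : Fin r → ℂ) (e : Fin r) (n k : ℤ) :
    (∑ i, c i • sigmaAdj i n) (psi e k) = 0 := by
  simp only [LinearMap.sum_apply, LinearMap.smul_apply, sigmaAdj_psi, smul_zero,
    Finset.sum_const_zero]

theorem isOddDer_sum_psiAdj (c : Fin r → ℂ) (n : ℤ) : IsOddDer (∑ i, c i • psiAdj i n) :=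
  .sum fun i _ => (isOddDer_psiAdj i n).smul _

theorem isEvenDer_sum_sigmaAdj (c : Fin r → ℂ) (n : ℤ) : IsEvenDer (∑ i, c i • sigmaAdj i n) :=
  .sum fun i _ => (isEvenDer_sigmaAdj i n).smul _

theorem ad_psi (a b : Fin r) (m : ℤ) {n : ℤ} (hn : n < 0) :
    ad ξ a m (psi b n) = psiBr ξ a b (m + n) := der_psi _ _ b n hn

theorem ad_sigma (a b : Fin r) (m : ℤ) {n : ℤ} (hn : n ≤ 0) : ad ξ a m (sigma b n) = 0 :=
  der_sigma _ _ b n hn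

theorem R_psi (a b : Fin r) (m : ℤ) {n : ℤ} (hn : n < 0) : R ξ a m (psi b n) = 0 :=
  der_psi _ _ b n hn

theorem R_sigma (a b : Fin r) (m : ℤ) {n : ℤ} (hn : n ≤ 0) :
    R ξ a m (sigma b n) = sigmaBr ξ a b (m + n) := der_sigma _ _ b n hn

theorem adStar_psi (a b : Fin r) (m : ℤ) {n : ℤ} (hn : n < 0) :
    adStar ξ a m (psi b n) = (((n : ℂ) - m) / n) • psiBr ξ a b (n - m) := der_psi _ _ b n hn

theorem adStar_sigma (a b : Fin r) (m : ℤ) {n : ℤ} (hn : n ≤ 0) :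
    adStar ξ a m (sigma b n) = 0 := der_sigma _ _ b n hn

theorem d_psi (a b : Fin r) (m : ℤ) {n : ℤ} (hn : n < 0) : d ξ a m (psi b n) = 0 :=
  der_psi _ _ b n hn

theorem d_sigma (a b : Fin r) (m : ℤ) {n : ℤ} (hn : n ≤ 0) :
    d ξ a m (sigma b n) = psiBr ξ a b (m + n) := der_sigma _ _ b n hn

theorem dStar_psi (a b : Fin r) (m : ℤ) {n : ℤ} (hn : n < 0) :
    dStar ξ a m (psi b n) = (-1 / (n : ℂ)) • sigmaBr ξ a b (n - m) := der_psi _ _ b n hn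

theorem dStar_sigma (a b : Fin r) (m : ℤ) {n : ℤ} (hn : n ≤ 0) :
    dStar ξ a m (sigma b n) = 0 := der_sigma _ _ b n hn

theorem IsFourierBasis.isAdj_ad (h : IsFourierBasis θ ξ) (a : Fin r) (m : ℤ) :
    IsAdj (ad ξ a m) (adStar ξ a m) := by
  refine (h.isEvenDer_ad a m).isAdj (h.isEvenDer_adStar a m) (fun b n y hn => ?_)
    (fun b n y hn => ?_) (fun b n hn => ?_) (fun b n hn => ?_)
  · rw [adStar_psi _ _ _ hn, smul_mul_assoc, herm_smul_right, herm_one_psiBr_mul, mul_zero]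
  · rw [adStar_sigma _ _ _ hn, zero_mul, herm_zero_right]
  · rw [ad_psi _ _ _ hn]
    convert isAdj_lmul_psiBr a b (m + n) using 1
    refine ((isOddDer_psiAdj b n).commutator (h.isEvenDer_adStar a m)).ext
      (isOddDer_sum_psiAdj _ _) (fun e k hk => ?_) (fun e k hk => ?_)
    · rw [LinearMap.sub_apply, Module.End.mul_apply, Module.End.mul_apply, adStar_psi _ _ _ hk,
        map_smul, psiAdj_psiBr, psiAdj_psi, map_smul, (h.isEvenDer_adStar a m).map_one, smul_zero,
        sub_zero, smul_smul, sum_smul_psiAdj_psi]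
      congr 1
      by_cases hnk : n = k - m
      · obtain rfl : k = m + n := by omega
        have hn0 : (n : ℂ) ≠ 0 := by exact_mod_cast hn.ne
        have hk0 : ((m : ℂ) + n) ≠ 0 := by exact_mod_cast hk.ne
        rw [if_pos ⟨hnk, hn⟩, if_pos ⟨rfl, hk⟩, h.conj_coad, ← h.coad_swap]
        push_cast
        field_simp
        ring
      · rw [if_neg (fun hc => hnk hc.1), if_neg (fun hc => hnk (by omega)), mul_zero]
    · rw [LinearMap.sub_apply, Module.End.mul_apply, Module.End.mul_apply, adStar_sigma _ _ _ hk,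
        psiAdj_sigma, map_zero, map_zero, sub_zero, sum_smul_psiAdj_sigma]
  · rw [ad_sigma _ _ _ hn]
    convert isAdj_lmul_zero using 1
    refine ((isEvenDer_sigmaAdj b n).commutator (h.isEvenDer_adStar a m)).ext .zero
      (fun e k hk => ?_) (fun e k hk => ?_)
    · rw [LinearMap.sub_apply, Module.End.mul_apply, Module.End.mul_apply, adStar_psi _ _ _ hk,
        map_smul, sigmaAdj_psiBr, sigmaAdj_psi, map_zero, smul_zero, sub_zero,
        LinearMap.zero_apply]
    · rw [LinearMap.sub_apply, Module.End.mul_apply, Module.End.mul_apply, adStar_sigma _ _ _ hk,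
        sigmaAdj_sigma, map_smul, (h.isEvenDer_adStar a m).map_one, smul_zero, map_zero, sub_zero,
        LinearMap.zero_apply]

theorem IsFourierBasis.isAdj_R (h : IsFourierBasis θ ξ) (a : Fin r) (m : ℤ) :
    IsAdj (R ξ a m) (R ξ a (-m)) := by
  refine (h.isEvenDer_R a m).isAdj (h.isEvenDer_R a (-m)) (fun b n y hn => ?_)
    (fun b n y hn => ?_) (fun b n hn => ?_) (fun b n hn => ?_)
  · rw [R_psi _ _ _ hn, zero_mul, herm_zero_right]
  · rw [R_sigma _ _ _ hn, herm_one_sigmaBr_mul]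
  · rw [R_psi _ _ _ hn]
    convert isAdj_lmul_zero using 1
    refine ((isOddDer_psiAdj b n).commutator (h.isEvenDer_R a (-m))).ext .zero
      (fun e k hk => ?_) (fun e k hk => ?_)
    · rw [LinearMap.sub_apply, Module.End.mul_apply, Module.End.mul_apply, R_psi _ _ _ hk,
        psiAdj_psi, map_smul, (h.isEvenDer_R a (-m)).map_one, smul_zero, map_zero, sub_zero,
        LinearMap.zero_apply]
    · rw [LinearMap.sub_apply, Module.End.mul_apply, Module.End.mul_apply, R_sigma _ _ _ hk,
        psiAdj_sigmaBr, psiAdj_sigma, map_zero, sub_zero, LinearMap.zero_apply]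
  · rw [R_sigma _ _ _ hn]
    convert isAdj_lmul_sigmaBr a b (m + n) using 1
    refine ((isEvenDer_sigmaAdj b n).commutator (h.isEvenDer_R a (-m))).ext
      (isEvenDer_sum_sigmaAdj _ _) (fun e k hk => ?_) (fun e k hk => ?_)
    · rw [LinearMap.sub_apply, Module.End.mul_apply, Module.End.mul_apply, R_psi _ _ _ hk,
        sigmaAdj_psi, map_zero, map_zero, sub_zero, sum_smul_sigmaAdj_psi]
    · rw [LinearMap.sub_apply, Module.End.mul_apply, Module.End.mul_apply, R_sigma _ _ _ hk,
        sigmaAdj_sigmaBr, sigmaAdj_sigma, map_smul, (h.isEvenDer_R a (-m)).map_one, smul_zero,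
        sub_zero, sum_smul_sigmaAdj_sigma, h.conj_coad, ← h.coad_swap]
      congr 1
      by_cases hnk : n = -m + k
      · rw [if_pos ⟨hnk, hn⟩, if_pos (by omega)]
      · rw [if_neg (fun hc => hnk hc.1), if_neg (by omega)]

theorem IsFourierBasis.isAdj_d (h : IsFourierBasis θ ξ) (a : Fin r) (m : ℤ) :
    IsAdj (d ξ a m) (dStar ξ a m) := by
  refine (h.isOddDer_d a m).isAdj (h.isOddDer_dStar a m) (fun b n y hn => ?_)
    (fun b n y hn => ?_) (fun b n hn => ?_) (fun b n hn => ?_)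
  · rw [dStar_psi _ _ _ hn, smul_mul_assoc, herm_smul_right, herm_one_sigmaBr_mul, mul_zero]
  · rw [dStar_sigma _ _ _ hn, zero_mul, herm_zero_right]
  · rw [d_psi _ _ _ hn]
    convert isAdj_lmul_zero using 1
    refine ((isOddDer_psiAdj b n).anticommutator (h.isOddDer_dStar a m)).ext .zero
      (fun e k hk => ?_) (fun e k hk => ?_)
    · rw [LinearMap.add_apply, Module.End.mul_apply, Module.End.mul_apply, dStar_psi _ _ _ hk,
        map_smul, psiAdj_sigmaBr, psiAdj_psi, map_smul, (h.isOddDer_dStar a m).map_one,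
        smul_zero, smul_zero, add_zero, LinearMap.zero_apply]
    · rw [LinearMap.add_apply, Module.End.mul_apply, Module.End.mul_apply, dStar_sigma _ _ _ hk,
        psiAdj_sigma, map_zero, map_zero, add_zero, LinearMap.zero_apply]
  · rw [d_sigma _ _ _ hn]
    convert isAdj_lmul_psiBr a b (m + n) using 1
    have hodd : IsOddDer (sigmaAdj b n * dStar ξ a m - dStar ξ a m * sigmaAdj b n) := by
      have := ((h.isOddDer_dStar a m).commutator (isEvenDer_sigmaAdj b n)).smul (-1)
      convert this using 1
      refine LinearMap.ext fun x => ?_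
      simp only [LinearMap.sub_apply, LinearMap.smul_apply, Forms.neg_smul, one_smul]
      abel
    refine hodd.ext (isOddDer_sum_psiAdj _ _) (fun e k hk => ?_) (fun e k hk => ?_)
    · rw [LinearMap.sub_apply, Module.End.mul_apply, Module.End.mul_apply, dStar_psi _ _ _ hk,
        map_smul, sigmaAdj_sigmaBr, sigmaAdj_psi, map_zero, sub_zero, smul_smul,
        sum_smul_psiAdj_psi, h.conj_coad, ← h.coad_swap]
      congr 1
      by_cases hnk : n = k - m
      · obtain rfl : k = m + n := by omega
        rw [if_pos ⟨hnk, hn⟩, if_pos ⟨rfl, hk⟩, mul_comm]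
      · rw [if_neg (fun hc => hnk hc.1), if_neg (fun hc => hnk (by omega)), mul_zero]
    · rw [LinearMap.sub_apply, Module.End.mul_apply, Module.End.mul_apply, dStar_sigma _ _ _ hk,
        sigmaAdj_sigma, map_smul, (h.isOddDer_dStar a m).map_one, smul_zero, map_zero, sub_zero,
        sum_smul_psiAdj_sigma]

theorem isAdj_lmul_psi_psiStar (a : Fin r) (m : ℕ+) :
    IsAdj (lmul (psi a (-m))) (psiStar a m) := by
  have := isAdj_lmul_psi a (n := -(m : ℤ)) (by simp)
  convert this using 2
  push_cast
  rw [neg_div_neg_eq]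
  rfl

theorem IsFourierBasis.isAdj_dbar (h : IsFourierBasis θ ξ) : IsAdj (dbar ξ) (dbarStar ξ) := by
  refine IsAdj.locSum _ _ fun p => ?_
  have h1 := isAdj_lmul_psi_psiStar p.1 p.2
  refine (h1.mul (h.isAdj_R p.1 p.2)).add ?_
  have h2 := (h1.smul (1 / 2)).mul (h.isAdj_ad p.1 p.2)
  convert h2 using 1
  simp [Complex.conj_ofNat]

end Operators

/-! ### The differential -/

section Sums

variable {M : Type*} [AddCommMonoid M]

theorem sum_comm_four {α β γ δ : Type*} (s : Finset α) (t : Finset β) (u : Finset γ)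
    (v : Finset δ) (f : α → β → γ → δ → M) :
    ∑ a ∈ s, ∑ b ∈ t, ∑ c ∈ u, ∑ d ∈ v, f a b c d =
      ∑ c ∈ u, ∑ d ∈ v, ∑ b ∈ t, ∑ a ∈ s, f a b c d := by
  calc _ = ∑ a ∈ s, ∑ c ∈ u, ∑ b ∈ t, ∑ d ∈ v, f a b c d :=
        Finset.sum_congr rfl fun _ _ => Finset.sum_comm
    _ = ∑ c ∈ u, ∑ a ∈ s, ∑ b ∈ t, ∑ d ∈ v, f a b c d := Finset.sum_comm
    _ = ∑ c ∈ u, ∑ a ∈ s, ∑ d ∈ v, ∑ b ∈ t, f a b c d :=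
        Finset.sum_congr rfl fun _ _ => Finset.sum_congr rfl fun _ _ => Finset.sum_comm
    _ = ∑ c ∈ u, ∑ d ∈ v, ∑ a ∈ s, ∑ b ∈ t, f a b c d :=
        Finset.sum_congr rfl fun _ _ => Finset.sum_comm
    _ = _ := Finset.sum_congr rfl fun _ _ => Finset.sum_congr rfl fun _ _ => Finset.sum_comm

theorem sum_Icc_shift {N l : ℤ} (hl : 0 ≤ l) (f : ℤ → M) (h0 : ∀ k ≤ 0, f k = 0)
    (h1 : ∀ k, N < k + l → f k = 0) :
    ∑ m ∈ Finset.Icc 1 N, f (m - l) = ∑ k ∈ Finset.Icc 1 N, f k := by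
  have e1 : ∑ m ∈ Finset.Icc 1 N, f (m - l) = ∑ k ∈ Finset.Icc (1 - l) (N - l), f k :=
    Finset.sum_nbij' (fun m => m - l) (fun k => k + l) (fun m hm => by
      simp only [Finset.mem_Icc] at hm ⊢; omega) (fun m hm => by
      simp only [Finset.mem_Icc] at hm ⊢; omega) (by simp) (by simp) (by simp)
  have e2 : ∑ k ∈ Finset.Icc 1 (N - l), f k = ∑ k ∈ Finset.Icc (1 - l) (N - l), f k :=
    Finset.sum_subset (Finset.Icc_subset_Icc (by omega) le_rfl) fun k hk hk' => h0 k (by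
      simp only [Finset.mem_Icc] at hk hk'; omega)
  have e3 : ∑ k ∈ Finset.Icc 1 (N - l), f k = ∑ k ∈ Finset.Icc 1 N, f k :=
    Finset.sum_subset (Finset.Icc_subset_Icc le_rfl (by omega)) fun k hk hk' => h1 k (by
      simp only [Finset.mem_Icc] at hk hk'; omega)
  rw [e1, ← e2, e3]

theorem sum_Icc_reflect (p : ℤ) (f : ℤ → M) :
    ∑ m ∈ Finset.Icc 1 (p - 1), f (p - m) = ∑ k ∈ Finset.Icc 1 (p - 1), f k :=
  Finset.sum_nbij' (fun m => p - m) (fun k => p - k) (fun m hm => by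
    simp only [Finset.mem_Icc] at hm ⊢; omega) (fun m hm => by
    simp only [Finset.mem_Icc] at hm ⊢; omega) (by simp) (by simp) (by simp)

theorem sum_Icc_add (p q : ℤ) (f : ℤ → M) :
    ∑ m ∈ Finset.Icc 1 q, f (p + m) = ∑ k ∈ Finset.Icc (p + 1) (p + q), f k :=
  Finset.sum_nbij' (fun m => p + m) (fun k => k - p) (fun m hm => by
    simp only [Finset.mem_Icc] at hm ⊢; omega) (fun m hm => by
    simp only [Finset.mem_Icc] at hm ⊢; omega) (by simp) (by simp) (by simp)

theorem sum_Icc_trim {N N' : ℤ} (h : N ≤ N') (f : ℤ → M) (hf : ∀ m, N < m → f m = 0) :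
    ∑ m ∈ Finset.Icc 1 N', f m = ∑ m ∈ Finset.Icc 1 N, f m :=
  (Finset.sum_subset (Finset.Icc_subset_Icc le_rfl h) fun k hk hk' => hf k (by
    simp only [Finset.mem_Icc] at hk hk'; omega)).symm

end Sums

/-- A family indexed by `a` and `m > 0` which vanishes for `m > N`. -/
theorem finsum_index_eq_sum (F : Fin r → ℤ → Forms r) (N : ℤ) (hF : ∀ a m, N < m → F a m = 0) :
    (Function.support fun i : Fin r × ℕ+ => F i.1 i.2).Finite ∧
      ∑ᶠ i : Fin r × ℕ+, F i.1 i.2 = ∑ a, ∑ m ∈ Finset.Icc 1 N, F a m := by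
  set K : ℕ+ := N.toNat.succPNat with hK
  have hNK : N ≤ (K : ℤ) := by
    rw [hK, Nat.succPNat_coe]; push_cast; omega
  have hs : (Function.support fun i : Fin r × ℕ+ => F i.1 i.2) ⊆
      ((Finset.univ ×ˢ Finset.Icc 1 K : Finset (Fin r × ℕ+)) : Set (Fin r × ℕ+)) := fun i hi => by
    simp only [Finset.coe_product, Finset.coe_univ, Set.mem_prod, Set.mem_univ, true_and,
      Finset.coe_Icc, Set.mem_Icc, one_le]
    by_contra hc
    apply hi
    refine hF _ _ (hNK.trans_lt ?_)
    have h2 : (K : ℕ) < (i.2 : ℕ) := by exact_mod_cast not_le.1 hc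
    exact_mod_cast h2
  refine ⟨(Finset.finite_toSet _).subset hs, ?_⟩
  rw [finsum_eq_sum_of_support_subset _ hs, Finset.sum_product]
  refine Finset.sum_congr rfl fun a _ => ?_
  rw [← sum_Icc_trim hNK _ (hF a)]
  refine Finset.sum_nbij' (fun m : ℕ+ => (m : ℤ)) (fun z => z.toNat.toPNat') (fun m hm => ?_)
    (fun z hz => ?_) (fun m _ => by simp) (fun z hz => ?_) (fun m _ => rfl)
  · simp only [Finset.mem_Icc, one_le, true_and] at hm ⊢
    have h2 : (m : ℕ) ≤ (K : ℕ) := by exact_mod_cast hm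
    have h3 := m.pos
    omega
  · simp only [Finset.mem_Icc, one_le, true_and] at hz ⊢
    rw [← PNat.coe_le_coe, Nat.toPNat'_coe, if_pos (by omega)]
    omega
  · simp only [Finset.mem_Icc] at hz
    rw [Nat.toPNat'_coe, if_pos (by omega)]
    omega

/-- A locally finite sum over `a` and `m > 0`, evaluated on a form on which only the terms with
`m ≤ N` contribute. -/
theorem locSum_apply_eq_sum {f : Fin r × ℕ+ → Module.End ℂ (Forms r)} (hf : LocFin f)
    (F : Fin r → ℤ → Forms r) (x : Forms r) (N : ℤ) (hfF : ∀ a (m : ℕ+), f (a, m) x = F a m)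
    (hF : ∀ a m, N < m → F a m = 0) :
    locSum f hf x = ∑ a, ∑ m ∈ Finset.Icc 1 N, F a m := by
  rw [← (finsum_index_eq_sum F N hF).2]
  exact finsum_congr fun i => hfF i.1 i.2

section Operators

variable {𝔤 : Type*} [LieRing 𝔤] [LieAlgebra ℂ 𝔤] {θ : CompactForm 𝔤}
  {ξ : Module.Basis (Fin r) ℂ 𝔤}

variable (ξ) in
theorem psi_eq_psiL (b : Fin r) (n : ℤ) : psi b n = psiL ξ (-n) (ξ b) := by
  rw [psiL_basis, neg_neg]

variable (ξ) in
theorem sigma_eq_sigmaL (b : Fin r) (n : ℤ) : sigma b n = sigmaL ξ (-n) (ξ b) := by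
  rw [sigmaL_basis, neg_neg]

theorem IsFourierBasis.isOddDer_dbar (h : IsFourierBasis θ ξ) : IsOddDer (dbar ξ) := by
  refine IsOddDer.locSum _ fun p => ((h.isEvenDer_R _ _).odd_lmul (parity_psi _ _)).add ?_
  have := ((h.isEvenDer_ad p.1 p.2).odd_lmul (parity_psi p.1 (-p.2))).smul (1 / 2)
  rwa [← smul_mul_assoc] at this

theorem IsFourierBasis.dbar_sigmaL (h : IsFourierBasis θ ξ) {q N : ℤ} (hN : q ≤ N) (x : 𝔤) :
    dbar ξ (sigmaL ξ q x) =
      ∑ a, ∑ m ∈ Finset.Icc 1 N, psiL ξ m (ξ a) * sigmaL ξ (q - m) ⁅ξ a, x⁆ := by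
  refine locSum_apply_eq_sum _ _ _ N (fun a m => ?_) fun a m hm => ?_
  · rcases lt_or_ge q 0 with hq | hq
    · rw [sigmaL_of_neg ξ hq, sigmaL_of_neg ξ (by have := m.pos; omega), map_zero, mul_zero]
    · simp only [LinearMap.add_apply, Module.End.mul_apply, LinearMap.mulLeft_apply,
        h.R_sigmaL _ _ hq, ad_sigmaL, map_zero, add_zero, psiL_basis]
  · rw [sigmaL_of_neg ξ (by omega), mul_zero]

theorem IsFourierBasis.dbar_psiL (h : IsFourierBasis θ ξ) {p N : ℤ} (hN : p ≤ N + 1) (x : 𝔤) :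
    dbar ξ (psiL ξ p x) =
      (1 / 2 : ℂ) • ∑ a, ∑ m ∈ Finset.Icc 1 N, psiL ξ m (ξ a) * psiL ξ (p - m) ⁅ξ a, x⁆ := by
  simp only [Finset.smul_sum]
  refine locSum_apply_eq_sum _
    (fun a m => (1 / 2 : ℂ) • (psiL ξ m (ξ a) * psiL ξ (p - m) ⁅ξ a, x⁆)) _ N
    (fun a m => ?_) fun a m hm => ?_
  · rcases lt_or_ge 0 p with hp | hp
    · simp only [LinearMap.add_apply, Module.End.mul_apply, LinearMap.mulLeft_apply,
        h.ad_psiL _ _ hp, R_psiL, mul_zero, zero_add, psiL_basis, LinearMap.smul_apply]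
    · rw [psiL_of_nonpos ξ hp, psiL_of_nonpos ξ (p := p - m) (by have := m.pos; omega), map_zero,
        mul_zero, smul_zero]
  · rw [psiL_of_nonpos ξ (p := p - m) (by omega), mul_zero, smul_zero]

theorem IsEvenDer.ext_psiL {T U : Module.End ℂ (Forms r)} (hT : IsEvenDer T) (hU : IsEvenDer U)
    (hpsi : ∀ p x, 0 < p → T (psiL ξ p x) = U (psiL ξ p x))
    (hsigma : ∀ p x, 0 ≤ p → T (sigmaL ξ p x) = U (sigmaL ξ p x)) : T = U :=
  hT.ext hU (fun b n hn => by rw [psi_eq_psiL ξ]; exact hpsi _ _ (by omega))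
    (fun b n hn => by rw [sigma_eq_sigmaL ξ]; exact hsigma _ _ (by omega))

theorem IsOddDer.ext_psiL {T U : Module.End ℂ (Forms r)} (hT : IsOddDer T) (hU : IsOddDer U)
    (hpsi : ∀ p x, 0 < p → T (psiL ξ p x) = U (psiL ξ p x))
    (hsigma : ∀ p x, 0 ≤ p → T (sigmaL ξ p x) = U (sigmaL ξ p x)) : T = U :=
  hT.ext hU (fun b n hn => by rw [psi_eq_psiL ξ]; exact hpsi _ _ (by omega))
    (fun b n hn => by rw [sigma_eq_sigmaL ξ]; exact hsigma _ _ (by omega))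

/-- The two orders of nested brackets differ by the Jacobi identity, and are exchanged by the
anticommutation of the `ψ`. -/
theorem sum_psiL_psiL_jacobi (G : ℤ → 𝔤 →ₗ[ℂ] Forms r) (N : ℤ) (x : 𝔤) :
    (∑ a, ∑ m ∈ Finset.Icc 1 N, ∑ e, ∑ l ∈ Finset.Icc 1 N,
        psiL ξ m (ξ a) * (psiL ξ l (ξ e) * G (m + l) ⁅ξ e, ⁅ξ a, x⁆⁆)) +
      (∑ a, ∑ m ∈ Finset.Icc 1 N, ∑ e, ∑ l ∈ Finset.Icc 1 N,
        psiL ξ m (ξ a) * (psiL ξ l (ξ e) * G (m + l) ⁅ξ e, ⁅ξ a, x⁆⁆)) =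
    -∑ a, ∑ m ∈ Finset.Icc 1 N, ∑ e, ∑ l ∈ Finset.Icc 1 N,
        psiL ξ m (ξ a) * (psiL ξ l (ξ e) * G (m + l) ⁅⁅ξ a, ξ e⁆, x⁆) := by
  have h1 : (∑ a, ∑ m ∈ Finset.Icc 1 N, ∑ e, ∑ l ∈ Finset.Icc 1 N,
        psiL ξ m (ξ a) * (psiL ξ l (ξ e) * G (m + l) ⁅ξ e, ⁅ξ a, x⁆⁆)) =
      -∑ a, ∑ m ∈ Finset.Icc 1 N, ∑ e, ∑ l ∈ Finset.Icc 1 N,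
        psiL ξ m (ξ a) * (psiL ξ l (ξ e) * G (m + l) ⁅ξ a, ⁅ξ e, x⁆⁆) := by
    rw [sum_comm_four]
    simp only [← Finset.sum_neg_distrib]
    refine Finset.sum_congr rfl fun a _ => Finset.sum_congr rfl fun m _ => ?_
    rw [Finset.sum_comm]
    refine Finset.sum_congr rfl fun e _ => Finset.sum_congr rfl fun l _ => ?_
    rw [← mul_assoc, ← mul_assoc, psiL_mul_psiL, Forms.neg_mul, add_comm l m]
  nth_rewrite 2 [h1]
  simp only [← Finset.sum_neg_distrib, ← Finset.sum_add_distrib]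
  refine Finset.sum_congr rfl fun a _ => Finset.sum_congr rfl fun m _ =>
    Finset.sum_congr rfl fun e _ => Finset.sum_congr rfl fun l _ => ?_
  rw [leibniz_lie (ξ a) (ξ e) x, map_add, mul_add, mul_add]
  abel

/-- The invariance of the Casimir element moves the bracket of two basis elements to the last factor
of a triple product. -/
theorem IsFourierBasis.sum_psiL_psiL_casimir (h : IsFourierBasis θ ξ)
    (G : ℤ → 𝔤 →ₗ[ℂ] Forms r) (N : ℤ) (hG : ∀ m, N < m → G m = 0) (x : 𝔤) :
    ∑ a, ∑ m ∈ Finset.Icc 1 N, (∑ e, ∑ l ∈ Finset.Icc 1 N,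
        psiL ξ l (ξ e) * psiL ξ (m - l) ⁅ξ e, ξ a⁆) * G m ⁅ξ a, x⁆ =
    -∑ a, ∑ m ∈ Finset.Icc 1 N, ∑ e, ∑ l ∈ Finset.Icc 1 N,
        psiL ξ m (ξ a) * (psiL ξ l (ξ e) * G (m + l) ⁅⁅ξ a, ξ e⁆, x⁆) := by
  simp only [Finset.sum_mul, mul_assoc]
  rw [sum_comm_four]
  simp only [← Finset.mul_sum, h.casimir_lie_left]
  rw [← Finset.sum_neg_distrib]
  refine Finset.sum_congr rfl fun e _ => ?_
  rw [← Finset.sum_neg_distrib]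
  refine Finset.sum_congr rfl fun l hl => ?_
  rw [Finset.mem_Icc] at hl
  rw [← Forms.mul_neg, Finset.sum_neg_distrib]
  congr 2
  have := sum_Icc_shift (N := N) (l := l) (by omega)
    (fun k => ∑ a, psiL ξ k (ξ a) * G (l + k) ⁅⁅ξ e, ξ a⁆, x⁆)
    (fun k hk => by simp only [psiL_of_nonpos ξ hk, zero_mul, Finset.sum_const_zero])
    (fun k hk => by
      rw [hG _ (by omega)]; simp only [LinearMap.zero_apply, mul_zero, Finset.sum_const_zero])
  simp only [add_sub_cancel] at this
  rw [this, Finset.sum_comm]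

theorem eq_zero_of_add_self_forms {x : Forms r} (hx : x + x = 0) : x = 0 := by
  rw [← two_smul ℂ x] at hx
  exact (smul_eq_zero.1 hx).resolve_left two_ne_zero

theorem IsFourierBasis.dbar_dbar_sigmaL (h : IsFourierBasis θ ξ) (q : ℤ) (x : 𝔤) :
    dbar ξ (dbar ξ (sigmaL ξ q x)) = 0 := by
  set Y := ∑ a, ∑ m ∈ Finset.Icc 1 q, ∑ e, ∑ l ∈ Finset.Icc 1 q,
    psiL ξ m (ξ a) * (psiL ξ l (ξ e) * sigmaL ξ (q - (m + l)) ⁅⁅ξ a, ξ e⁆, x⁆) with hY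
  set Z := ∑ a, ∑ m ∈ Finset.Icc 1 q, ∑ e, ∑ l ∈ Finset.Icc 1 q,
    psiL ξ m (ξ a) * (psiL ξ l (ξ e) * sigmaL ξ (q - (m + l)) ⁅ξ e, ⁅ξ a, x⁆⁆) with hZ
  have h1 : Z + Z = -Y := sum_psiL_psiL_jacobi (fun j => sigmaL ξ (q - j)) q x
  have h2 := h.sum_psiL_psiL_casimir (fun j => sigmaL ξ (q - j)) q
    (fun m hm => LinearMap.ext fun y => sigmaL_of_neg ξ (by omega) y) x
  have h3 : dbar ξ (dbar ξ (sigmaL ξ q x)) = -(1 / 2 : ℂ) • Y + -Z := by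
    rw [h.dbar_sigmaL le_rfl, map_sum]
    simp only [map_sum, h.isOddDer_dbar.leibniz, parity_psiL, Finset.sum_add_distrib]
    congr 1
    · rw [Forms.neg_smul, ← Forms.smul_neg, ← h2, Finset.smul_sum]
      refine Finset.sum_congr rfl fun a _ => ?_
      rw [Finset.smul_sum]
      refine Finset.sum_congr rfl fun m hm => ?_
      rw [Finset.mem_Icc] at hm
      rw [h.dbar_psiL (N := q) (by omega), smul_mul_assoc]
    · rw [hZ, ← Finset.sum_neg_distrib]
      refine Finset.sum_congr rfl fun a _ => ?_
      rw [← Finset.sum_neg_distrib]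
      refine Finset.sum_congr rfl fun m hm => ?_
      rw [Finset.mem_Icc] at hm
      rw [h.dbar_sigmaL (N := q) (by omega), Forms.neg_mul]
      simp only [Finset.mul_sum, sub_sub]
  have h4 : dbar ξ (dbar ξ (sigmaL ξ q x)) + dbar ξ (dbar ξ (sigmaL ξ q x)) = 0 := by
    have h5 : -(1 / 2 : ℂ) • Y + -(1 / 2 : ℂ) • Y = Z + Z := by
      rw [h1, ← add_smul, ← neg_add, add_halves, Forms.neg_smul, one_smul]
    rw [h3, add_add_add_comm, h5]
    abel
  exact eq_zero_of_add_self_forms h4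

theorem IsFourierBasis.dbar_dbar_psiL (h : IsFourierBasis θ ξ) (p : ℤ) (x : 𝔤) :
    dbar ξ (dbar ξ (psiL ξ p x)) = 0 := by
  set Y := ∑ a, ∑ m ∈ Finset.Icc 1 (p - 1), ∑ e, ∑ l ∈ Finset.Icc 1 (p - 1),
    psiL ξ m (ξ a) * (psiL ξ l (ξ e) * psiL ξ (p - (m + l)) ⁅⁅ξ a, ξ e⁆, x⁆) with hY
  set Z := ∑ a, ∑ m ∈ Finset.Icc 1 (p - 1), ∑ e, ∑ l ∈ Finset.Icc 1 (p - 1),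
    psiL ξ m (ξ a) * (psiL ξ l (ξ e) * psiL ξ (p - (m + l)) ⁅ξ e, ⁅ξ a, x⁆⁆) with hZ
  have h1 : Z + Z = -Y := sum_psiL_psiL_jacobi (fun j => psiL ξ (p - j)) (p - 1) x
  have h2 := h.sum_psiL_psiL_casimir (fun j => psiL ξ (p - j)) (p - 1)
    (fun m hm => LinearMap.ext fun y => psiL_of_nonpos ξ (by omega) y) x
  have hA : ∑ a, ∑ m ∈ Finset.Icc 1 (p - 1),
      dbar ξ (psiL ξ m (ξ a)) * psiL ξ (p - m) ⁅ξ a, x⁆ = -(1 / 2 : ℂ) • Y := by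
    rw [Forms.neg_smul, ← Forms.smul_neg, ← h2, Finset.smul_sum]
    refine Finset.sum_congr rfl fun a _ => ?_
    rw [Finset.smul_sum]
    refine Finset.sum_congr rfl fun m hm => ?_
    rw [Finset.mem_Icc] at hm
    rw [h.dbar_psiL (N := p - 1) (by omega), smul_mul_assoc]
  have hB : ∑ a, ∑ m ∈ Finset.Icc 1 (p - 1),
      psiL ξ m (ξ a) * dbar ξ (psiL ξ (p - m) ⁅ξ a, x⁆) = (1 / 2 : ℂ) • Z := by
    rw [hZ, Finset.smul_sum]
    refine Finset.sum_congr rfl fun a _ => ?_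
    rw [Finset.smul_sum]
    refine Finset.sum_congr rfl fun m hm => ?_
    rw [Finset.mem_Icc] at hm
    rw [h.dbar_psiL (N := p - 1) (by omega), mul_smul_comm]
    simp only [Finset.mul_sum, sub_sub]
  -- exchanging the two factors of `∂̄ψ`
  have hAB : ∑ a, ∑ m ∈ Finset.Icc 1 (p - 1),
      dbar ξ (psiL ξ m (ξ a)) * psiL ξ (p - m) ⁅ξ a, x⁆ =
      -∑ a, ∑ m ∈ Finset.Icc 1 (p - 1),
        psiL ξ m (ξ a) * dbar ξ (psiL ξ (p - m) ⁅ξ a, x⁆) := by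
    have e1 : ∀ m, ∑ a, psiL ξ m ⁅ξ a, x⁆ * dbar ξ (psiL ξ (p - m) (ξ a)) =
        -∑ a, psiL ξ m (ξ a) * dbar ξ (psiL ξ (p - m) ⁅ξ a, x⁆) := by
      intro m
      have := h.casimir (psiL ξ m) (dbar ξ ∘ₗ psiL ξ (p - m)) x
      simp only [LinearMap.comp_apply] at this
      simp only [← lie_skew _ x, map_neg, Forms.neg_mul, Forms.mul_neg, Finset.sum_neg_distrib,
        this]
    rw [Finset.sum_comm, ← sum_Icc_reflect, Finset.sum_comm, ← Finset.sum_comm]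
    rw [Finset.sum_comm (s := Finset.univ) (t := Finset.Icc 1 (p - 1)) (f := fun a m =>
      psiL ξ m (ξ a) * dbar ξ (psiL ξ (p - m) ⁅ξ a, x⁆)), ← Finset.sum_neg_distrib]
    refine Finset.sum_congr rfl fun m _ => ?_
    rw [← e1]
    refine Finset.sum_congr rfl fun a _ => ?_
    rw [sub_sub_cancel, psiL_mul, h.isOddDer_dbar.par, parity_psiL, map_neg, Forms.neg_neg]
  -- hence `Y` and `Z`, which differ from the two sums by factors `∓1/2`, agree
  have hYZ : Y = Z := by
    have h3 := hAB
    rw [hA, hB, Forms.neg_smul] at h3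
    exact smul_right_injective _ (show (1 / 2 : ℂ) ≠ 0 by norm_num) (neg_injective h3)
  -- together with `Z + Z = -Y` this leaves `3 Y = 0`
  have hY0 : Y = 0 := by
    rw [← hYZ] at h1
    have h3 : (3 : ℂ) • Y = 0 := by
      have : (3 : ℂ) • Y = Y + Y + Y := by module
      rw [this, h1]; abel
    exact (smul_eq_zero.1 h3).resolve_left (by norm_num)
  rw [h.dbar_psiL (N := p - 1) (by omega), map_smul]
  simp only [map_sum, h.isOddDer_dbar.leibniz, parity_psiL, Finset.sum_add_distrib,
    Forms.neg_mul, Finset.sum_neg_distrib, hA, hB, ← hYZ, hY0, smul_zero, neg_zero, add_zero]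

/-- `∂̄²` is half the anticommutator of `∂̄` with itself, a derivation, so it vanishes as soon as it
vanishes on the generators. -/
theorem IsFourierBasis.dbar_dbar (h : IsFourierBasis θ ξ) (x : Forms r) :
    dbar ξ (dbar ξ x) = 0 := by
  have h1 := (h.isOddDer_dbar.anticommutator h.isOddDer_dbar).ext_psiL (ξ := ξ) .zero
    (fun p x _ => by simp [h.dbar_dbar_psiL]) (fun p x _ => by simp [h.dbar_dbar_sigmaL])
  exact eq_zero_of_add_self_forms (LinearMap.congr_fun h1 x)

/-! ### The action of `𝔤` -/

variable (ξ) in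
/-- The action of `ξ_a` on `Λ ⊗ S`. -/
abbrev lieAct (a : Fin r) : Module.End ℂ (Forms r) := R ξ a 0 + ad ξ a 0

theorem IsFourierBasis.isEvenDer_lieAct (h : IsFourierBasis θ ξ) (a : Fin r) :
    IsEvenDer (lieAct ξ a) := (h.isEvenDer_R a 0).add (h.isEvenDer_ad a 0)

theorem IsFourierBasis.lieAct_psiL (h : IsFourierBasis θ ξ) (a : Fin r) (p : ℤ) (x : 𝔤) :
    lieAct ξ a (psiL ξ p x) = psiL ξ p ⁅ξ a, x⁆ := by
  rcases lt_or_ge 0 p with hp | hp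
  · rw [LinearMap.add_apply, R_psiL, h.ad_psiL _ _ hp, zero_add, sub_zero]
  · rw [psiL_of_nonpos ξ hp, psiL_of_nonpos ξ hp, map_zero]

theorem IsFourierBasis.lieAct_sigmaL (h : IsFourierBasis θ ξ) (a : Fin r) (p : ℤ) (x : 𝔤) :
    lieAct ξ a (sigmaL ξ p x) = sigmaL ξ p ⁅ξ a, x⁆ := by
  rcases le_or_gt 0 p with hp | hp
  · rw [LinearMap.add_apply, ad_sigmaL, h.R_sigmaL _ _ hp, add_zero, sub_zero]
  · rw [sigmaL_of_neg ξ hp, sigmaL_of_neg ξ hp, map_zero]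

/-- The action of `x` on the invariant `∑ₐ f(ξ_a) g[ξ_a, y]`: the Casimir element is fixed, and only
`y` is moved. -/
theorem IsFourierBasis.sum_invariant (h : IsFourierBasis θ ξ) (f g : 𝔤 →ₗ[ℂ] Forms r)
    (x y : 𝔤) :
    ∑ a, (f ⁅x, ξ a⁆ * g ⁅ξ a, y⁆ + f (ξ a) * g ⁅x, ⁅ξ a, y⁆⁆) =
      ∑ a, f (ξ a) * g ⁅ξ a, ⁅x, y⁆⁆ := by
  rw [Finset.sum_add_distrib, h.casimir_lie_left, ← Finset.sum_neg_distrib,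
    ← Finset.sum_add_distrib]
  refine Finset.sum_congr rfl fun a _ => ?_
  rw [leibniz_lie x (ξ a) y, map_add, mul_add]
  abel

/-- The differential commutes with the action of `𝔤`. -/
theorem IsFourierBasis.dbar_lieAct (h : IsFourierBasis θ ξ) (a : Fin r) :
    dbar ξ * lieAct ξ a = lieAct ξ a * dbar ξ := by
  have h1 := (h.isOddDer_dbar.commutator (h.isEvenDer_lieAct a)).ext_psiL (ξ := ξ) .zero
    (fun p x hp => ?_) (fun p x hp => ?_)
  · refine LinearMap.ext fun x => ?_
    have := LinearMap.congr_fun h1 x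
    rw [LinearMap.sub_apply, LinearMap.zero_apply] at this
    exact sub_eq_zero.1 this
  · rw [LinearMap.sub_apply, Module.End.mul_apply, Module.End.mul_apply, h.lieAct_psiL,
      LinearMap.zero_apply, sub_eq_zero, h.dbar_psiL (N := p) (by omega),
      h.dbar_psiL (N := p) (by omega), map_smul]
    congr 1
    rw [Finset.sum_comm]
    conv_rhs => rw [Finset.sum_comm]
    rw [map_sum]
    refine Finset.sum_congr rfl fun m _ => ?_
    rw [map_sum, ← h.sum_invariant]
    refine Finset.sum_congr rfl fun e _ => ?_
    rw [(h.isEvenDer_lieAct a).leibniz, h.lieAct_psiL, h.lieAct_psiL]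
  · rw [LinearMap.sub_apply, Module.End.mul_apply, Module.End.mul_apply, h.lieAct_sigmaL,
      LinearMap.zero_apply, sub_eq_zero, h.dbar_sigmaL le_rfl, h.dbar_sigmaL le_rfl]
    rw [Finset.sum_comm]
    conv_rhs => rw [Finset.sum_comm]
    rw [map_sum]
    refine Finset.sum_congr rfl fun m _ => ?_
    rw [map_sum, ← h.sum_invariant]
    refine Finset.sum_congr rfl fun e _ => ?_
    rw [(h.isEvenDer_lieAct a).leibniz, h.lieAct_psiL, h.lieAct_sigmaL]

theorem adStar_zero (a : Fin r) : adStar ξ a 0 = ad ξ a 0 := by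
  unfold adStar ad der
  congr 1
  unfold locSum
  congr 1
  congr 1
  funext x
  refine finsum_congr fun i => ?_
  have : (((ofLex i).1 : ℤ) : ℂ) ≠ 0 := by exact_mod_cast (ofLex i).1.2.ne
  simp [div_self this]

theorem IsFourierBasis.isAdj_lieAct (h : IsFourierBasis θ ξ) (a : Fin r) :
    IsAdj (lieAct ξ a) (lieAct ξ a) := by
  have h1 := (h.isAdj_R a 0).add (h.isAdj_ad a 0)
  rwa [neg_zero, adStar_zero] at h1

theorem eq_of_herm {x y : Forms r} (hxy : ∀ z, herm z x = herm z y) : x = y := by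
  refine sub_eq_zero.1 (eq_zero_of_herm_self ?_)
  rw [herm_sub_right, hxy, sub_self, Complex.zero_re]

/-- The adjoint differential commutes with the action of `𝔤`, which is self-adjoint. -/
theorem IsFourierBasis.dbarStar_lieAct (h : IsFourierBasis θ ξ) (a : Fin r) (x : Forms r) :
    dbarStar ξ (lieAct ξ a x) = lieAct ξ a (dbarStar ξ x) := by
  refine eq_of_herm fun z => ?_
  rw [← h.isAdj_dbar, ← h.isAdj_lieAct, ← h.isAdj_lieAct, ← h.isAdj_dbar]
  have := LinearMap.congr_fun (h.dbar_lieAct a) z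
  rw [Module.End.mul_apply, Module.End.mul_apply] at this
  rw [this]

end Operators

/-! ### The adjoint differential -/

theorem locSum_apply_eq_finset_sum {ι : Type*} {f : ι → Module.End ℂ (Forms r)} (hf : LocFin f)
    (x : Forms r) (s : Finset ι) (hs : ∀ i, i ∉ s → f i x = 0) :
    locSum f hf x = ∑ i ∈ s, f i x :=
  finsum_eq_sum_of_support_subset _ fun i hi => by
    by_contra hc
    exact hi (hs i hc)

theorem psiStar_eq_psiAdj (a : Fin r) (m : ℕ+) : psiStar a m = psiAdj a (-(m : ℤ)) := by
  rw [psiAdj, dif_pos (by simp)]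
  push_cast
  rw [neg_div_neg_eq]
  rfl

theorem psiStar_sigma (a : Fin r) (m : ℕ+) (c : Fin r) (k : ℤ) :
    psiStar a m (sigma c k) = 0 := by
  rw [psiStar_eq_psiAdj, psiAdj_sigma]

theorem psiStar_psi (a : Fin r) (m : ℕ+) (c : Fin r) (k : ℕ+) :
    psiStar a m (psi c (-k)) = (if (a, m) = (c, k) then 1 / (k : ℂ) else 0) • (1 : Forms r) := by
  rw [psiStar_eq_psiAdj, psiAdj_psi]
  congr 1
  by_cases h1 : a = c
  · by_cases h2 : m = k
    · subst h1 h2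
      simp
    · rw [if_pos h1, if_neg, if_neg (by simp [h2])]
      rintro ⟨h3, -⟩
      exact h2 (by exact_mod_cast neg_injective h3)
  · rw [if_neg h1, if_neg (by simp [h1])]

section Operators

variable {𝔤 : Type*} [LieRing 𝔤] [LieAlgebra ℂ 𝔤] {θ : CompactForm 𝔤}
  {ξ : Module.Basis (Fin r) ℂ 𝔤}

theorem locSum_psiStar_psi (u : Fin r × ℕ+ → Forms r) (c : Fin r) (k : ℕ+) :
    locSum (fun i : Fin r × ℕ+ => lmul (u i) * psiStar i.1 i.2) (locFin_psiStar.comp _)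
      (psi c (-k)) = (1 / (k : ℂ)) • u (c, k) := by
  rw [locSum_apply_eq_finset_sum _ _ {(c, k)}]
  · rw [Finset.sum_singleton, Module.End.mul_apply, psiStar_psi, if_pos rfl,
      LinearMap.mulLeft_apply, mul_smul_comm, mul_one]
  · intro i hi
    rw [Finset.mem_singleton] at hi
    rw [Module.End.mul_apply, psiStar_psi, if_neg hi, zero_smul, map_zero]

theorem locSum_psiStar_sigma (u : Fin r × ℕ+ → Forms r) (c : Fin r) (k : ℤ) :
    locSum (fun i : Fin r × ℕ+ => lmul (u i) * psiStar i.1 i.2) (locFin_psiStar.comp _)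
      (sigma c k) = 0 := by
  rw [locSum_apply_eq_finset_sum _ _ ∅]
  · rfl
  · intro i _
    rw [Module.End.mul_apply, psiStar_sigma, map_zero]

theorem isEvenDer_locSum_psiStar {u : Fin r × ℕ+ → Forms r} (hu : ∀ i, parity (u i) = -u i) :
    IsEvenDer (locSum (fun i : Fin r × ℕ+ => lmul (u i) * psiStar i.1 i.2)
      (locFin_psiStar.comp _)) :=
  IsEvenDer.locSum _ fun i => IsOddDer.odd_lmul (isOddDer_psiStar i.1 i.2) (hu i)

theorem isOddDer_locSum_psiStar {u : Fin r × ℕ+ → Forms r} (hu : ∀ i, parity (u i) = u i) :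
    IsOddDer (locSum (fun i : Fin r × ℕ+ => lmul (u i) * psiStar i.1 i.2)
      (locFin_psiStar.comp _)) :=
  IsOddDer.locSum _ fun i => IsOddDer.even_lmul (isOddDer_psiStar i.1 i.2) (hu i)

/-- The part of the commutator of `∂̄*` with `ψᵇ(-p)` in which `ad_a(m)*` acts on `ψᵇ(-p)`. -/
theorem IsFourierBasis.locSum_adStar_psiStar (h : IsFourierBasis θ ξ) (b : Fin r) (p : ℕ+) :
    locSum (fun i : Fin r × ℕ+ => lmul (adStar ξ i.1 i.2 (psi b (-p))) * psiStar i.1 i.2)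
      (locFin_psiStar.comp _) = -(1 / (p : ℂ)) • adStar ξ b p := by
  have hu : ∀ i : Fin r × ℕ+, parity (adStar ξ i.1 i.2 (psi b (-p))) =
      -adStar ξ i.1 i.2 (psi b (-p)) := fun i => by
    rw [(h.isEvenDer_adStar _ _).par, parity_psi, Forms.end_neg]
  refine (isEvenDer_locSum_psiStar hu).ext
    ((h.isEvenDer_adStar b p).smul _) (fun c n hn => ?_) (fun c n hn => ?_)
  · obtain ⟨k, rfl⟩ : ∃ k : ℕ+, n = -(k : ℤ) := ⟨⟨(-n).toNat, by omega⟩, by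
      simp only [PNat.mk_coe]; omega⟩
    have hp : (0 : ℤ) < p := by exact_mod_cast p.pos
    have hk : (0 : ℤ) < k := by exact_mod_cast k.pos
    have hp0 : ((p : ℕ) : ℂ) ≠ 0 := by exact_mod_cast p.ne_zero
    have hk0 : ((k : ℕ) : ℂ) ≠ 0 := by exact_mod_cast k.ne_zero
    rw [locSum_psiStar_psi, psi_eq_psiL ξ, psi_eq_psiL ξ, neg_neg, neg_neg, h.adStar_psiL _ _ hp,
      LinearMap.smul_apply, h.adStar_psiL _ _ hk, smul_smul, smul_smul, ← lie_skew, map_neg,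
      Forms.smul_neg, ← Forms.neg_smul, add_comm (p : ℤ)]
    congr 1
    push_cast
    field_simp
    ring
  · rw [locSum_psiStar_sigma, LinearMap.smul_apply, adStar_sigma _ _ _ hn, smul_zero]

/-- The commutator of `∂̄*` with `σᵇ(-q)`: a derivation in which `R_a(-m)` acts on `σᵇ(-q)`. -/
theorem IsFourierBasis.locSum_R_psiStar (h : IsFourierBasis θ ξ) (b : Fin r) {q : ℤ}
    (hq : 0 ≤ q) :
    locSum (fun i : Fin r × ℕ+ => lmul (R ξ i.1 (-i.2) (sigma b (-q))) * psiStar i.1 i.2)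
      (locFin_psiStar.comp _) = (-1 : ℂ) • dStar ξ b q := by
  have hu : ∀ i : Fin r × ℕ+, parity (R ξ i.1 (-i.2) (sigma b (-q))) =
      R ξ i.1 (-i.2) (sigma b (-q)) := fun i => by
    rw [(h.isEvenDer_R _ _).par, parity_sigma]
  refine (isOddDer_locSum_psiStar hu).ext
    ((h.isOddDer_dStar b q).smul _) (fun c n hn => ?_) (fun c n hn => ?_)
  · obtain ⟨k, rfl⟩ : ∃ k : ℕ+, n = -(k : ℤ) := ⟨⟨(-n).toNat, by omega⟩, by
      simp only [PNat.mk_coe]; omega⟩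
    have hk : (0 : ℤ) < k := by exact_mod_cast k.pos
    rw [locSum_psiStar_psi, psi_eq_psiL ξ, sigma_eq_sigmaL ξ, neg_neg, neg_neg,
      h.R_sigmaL _ _ hq, LinearMap.smul_apply, h.dStar_psiL _ _ hk, sub_neg_eq_add, ← lie_skew,
      map_neg, Forms.smul_neg, Forms.neg_smul, one_smul, add_comm q]
    simp
  · rw [locSum_psiStar_sigma, LinearMap.smul_apply, dStar_sigma _ _ _ hn, smul_zero]

theorem dbarStar_one : dbarStar ξ 1 = 0 := by
  rw [dbarStar, locSum_apply_eq_finset_sum _ _ ∅]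
  · rfl
  · intro i _
    simp [(isOddDer_psiStar i.1 i.2).map_one]

/-- The anticommutator of the adjoint differential with multiplication by `ψ`. Half of the
coefficient of `ad_b(p)*` comes from `ψᵇ(-p)*` hitting `ψᵇ(-p)`, and the other half from `ad_a(m)*`
hitting it. -/
theorem IsFourierBasis.dbarStar_psi_mul (h : IsFourierBasis θ ξ) (b : Fin r) (p : ℕ+)
    (y : Forms r) : dbarStar ξ (psi b (-p) * y) =
      (1 / (p : ℂ)) • (R ξ b (-p) + adStar ξ b p) y - psi b (-p) * dbarStar ξ y := by
  classical
  set s : Finset (Fin r × ℕ+) := (locFin_psiStar y).toFinset ∪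
    ((locFin_psiStar (psi b (-p) * y)).toFinset ∪ {(b, p)}) with hs
  have hs1 : ∀ i ∉ s, psiStar i.1 i.2 y = 0 := by
    intro i hi
    by_contra hc
    exact hi (by simp [hs, hc])
  have hs2 : ∀ i ∉ s, psiStar i.1 i.2 (psi b (-p) * y) = 0 := by
    intro i hi
    by_contra hc
    exact hi (by simp [hs, hc])
  have hs3 : (b, p) ∈ s := by simp [hs]
  have hV := LinearMap.congr_fun (h.locSum_adStar_psiStar b p) y
  rw [locSum_apply_eq_finset_sum _ _ s (fun i hi => by
    rw [Module.End.mul_apply, hs1 i hi, map_zero])] at hV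
  rw [dbarStar, locSum_apply_eq_finset_sum _ _ s (fun i hi => by
      simp only [LinearMap.add_apply, Module.End.mul_apply, hs2 i hi, map_zero, add_zero]),
    locSum_apply_eq_finset_sum _ _ s (fun i hi => by
      simp only [LinearMap.add_apply, Module.End.mul_apply, hs1 i hi, map_zero, add_zero])]
  have key : ∀ i : Fin r × ℕ+,
      (R ξ i.1 (-i.2) * psiStar i.1 i.2 + ((1 / 2 : ℂ) • adStar ξ i.1 i.2) * psiStar i.1 i.2)
        (psi b (-p) * y) =
      (if i = (b, p) then (1 / (p : ℂ)) • (R ξ i.1 (-i.2) y + (1 / 2 : ℂ) • adStar ξ i.1 i.2 y)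
        else 0) + (-(1 / 2 : ℂ)) • ((lmul (adStar ξ i.1 i.2 (psi b (-p))) * psiStar i.1 i.2) y) -
      psi b (-p) * (R ξ i.1 (-i.2) * psiStar i.1 i.2 +
        ((1 / 2 : ℂ) • adStar ξ i.1 i.2) * psiStar i.1 i.2) y := by
    rintro ⟨a, m⟩
    simp only [LinearMap.add_apply, Module.End.mul_apply, LinearMap.smul_apply,
      (isOddDer_psiStar a m).leibniz, psiStar_psi, parity_psi, map_add, Forms.neg_mul,
      Forms.end_neg, (h.isEvenDer_R _ _).leibniz, (h.isEvenDer_adStar _ _).leibniz,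
      LinearMap.mulLeft_apply,
      R_psi a _ _ (n := -(p : ℤ)) (by simp), zero_mul, zero_add, smul_mul_assoc, one_mul,
      map_smul, mul_add, mul_smul_comm, smul_add, Forms.smul_neg, Forms.neg_smul]
    split_ifs with hi
    · rw [smul_comm (1 / 2 : ℂ) (1 / (p : ℂ))]
      abel
    · simp only [zero_smul, smul_zero]
      abel
  rw [Finset.sum_congr rfl fun i _ => key i, Finset.sum_sub_distrib, Finset.sum_add_distrib,
    Finset.sum_ite_eq', if_pos hs3, ← Finset.smul_sum, hV, ← Finset.mul_sum]
  congr 1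
  simp only [LinearMap.smul_apply, smul_smul, smul_add, LinearMap.add_apply]
  rw [add_assoc, ← add_smul]
  congr 2
  ring

/-- The commutator of the adjoint differential with multiplication by `σ`. -/
theorem IsFourierBasis.dbarStar_sigma_mul (h : IsFourierBasis θ ξ) (b : Fin r) {q : ℤ}
    (hq : 0 ≤ q) (y : Forms r) : dbarStar ξ (sigma b (-q) * y) =
      -dStar ξ b q y + sigma b (-q) * dbarStar ξ y := by
  classical
  set s : Finset (Fin r × ℕ+) := (locFin_psiStar y).toFinset ∪
    (locFin_psiStar (sigma b (-q) * y)).toFinset with hs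
  have hs1 : ∀ i ∉ s, psiStar i.1 i.2 y = 0 := by
    intro i hi
    by_contra hc
    exact hi (by simp [hs, hc])
  have hs2 : ∀ i ∉ s, psiStar i.1 i.2 (sigma b (-q) * y) = 0 := by
    intro i hi
    by_contra hc
    exact hi (by simp [hs, hc])
  have hV := LinearMap.congr_fun (h.locSum_R_psiStar b hq) y
  rw [locSum_apply_eq_finset_sum _ _ s (fun i hi => by
    rw [Module.End.mul_apply, hs1 i hi, map_zero]), LinearMap.smul_apply, Forms.neg_smul,
    one_smul] at hV
  rw [dbarStar, locSum_apply_eq_finset_sum _ _ s (fun i hi => by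
      simp only [LinearMap.add_apply, Module.End.mul_apply, hs2 i hi, map_zero, add_zero]),
    locSum_apply_eq_finset_sum _ _ s (fun i hi => by
      simp only [LinearMap.add_apply, Module.End.mul_apply, hs1 i hi, map_zero, add_zero]),
    ← hV, Finset.mul_sum, ← Finset.sum_add_distrib]
  refine Finset.sum_congr rfl ?_
  rintro ⟨a, m⟩ -
  simp only [LinearMap.add_apply, Module.End.mul_apply, LinearMap.smul_apply,
    (isOddDer_psiStar a m).leibniz, psiStar_sigma, parity_sigma, zero_mul, zero_add,
    (h.isEvenDer_R _ _).leibniz, (h.isEvenDer_adStar _ _).leibniz, LinearMap.mulLeft_apply,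
    adStar_sigma a _ _ (n := -q) (by omega), mul_add, mul_smul_comm]
  abel

theorem IsFourierBasis.dbarStar_psiL_mul (h : IsFourierBasis θ ξ) (b : Fin r) {p : ℤ}
    (hp : 0 < p) (y : Forms r) : dbarStar ξ (psiL ξ p (ξ b) * y) =
      (1 / (p : ℂ)) • (R ξ b (-p) + adStar ξ b p) y - psiL ξ p (ξ b) * dbarStar ξ y := by
  obtain ⟨k, rfl⟩ : ∃ k : ℕ+, p = (k : ℤ) := ⟨⟨p.toNat, by omega⟩, by
    simp only [PNat.mk_coe]; omega⟩
  rw [psiL_basis, h.dbarStar_psi_mul]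
  simp

theorem IsFourierBasis.dbarStar_sigmaL_mul (h : IsFourierBasis θ ξ) (b : Fin r) {q : ℤ}
    (hq : 0 ≤ q) (y : Forms r) : dbarStar ξ (sigmaL ξ q (ξ b) * y) =
      -dStar ξ b q y + sigmaL ξ q (ξ b) * dbarStar ξ y := by
  rw [sigmaL_basis, h.dbarStar_sigma_mul _ hq]

theorem IsFourierBasis.exists_dbarStar_psiL_mul (h : IsFourierBasis θ ξ) (p : ℤ) (z : 𝔤) :
    ∃ U, IsEvenDer U ∧
      ∀ y, dbarStar ξ (psiL ξ p z * y) = U y - psiL ξ p z * dbarStar ξ y := by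
  rcases lt_or_ge 0 p with hp | hp
  · refine ⟨∑ b, ξ.coord b z • ((1 / (p : ℂ)) • (R ξ b (-p) + adStar ξ b p)),
      .sum fun b _ => (((h.isEvenDer_R _ _).add (h.isEvenDer_adStar _ _)).smul _).smul _,
      fun y => ?_⟩
    have hz : psiL ξ p z = ∑ b, ξ.coord b z • psiL ξ p (ξ b) := by
      conv_lhs => rw [← ξ.sum_repr z]
      simp only [map_sum, map_smul]
      rfl
    rw [hz]
    simp only [Finset.sum_mul, map_sum, smul_mul_assoc, map_smul, h.dbarStar_psiL_mul _ hp,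
      LinearMap.sum_apply, LinearMap.smul_apply, Forms.smul_sub, Finset.sum_sub_distrib]
  · exact ⟨0, .zero, fun y => by simp [psiL_of_nonpos ξ hp]⟩

theorem IsFourierBasis.exists_dbarStar_sigmaL_mul (h : IsFourierBasis θ ξ) (q : ℤ) (z : 𝔤) :
    ∃ U, IsOddDer U ∧
      ∀ y, dbarStar ξ (sigmaL ξ q z * y) = U y + sigmaL ξ q z * dbarStar ξ y := by
  rcases le_or_gt 0 q with hq | hq
  · refine ⟨∑ b, ξ.coord b z • ((-1 : ℂ) • dStar ξ b q),
      .sum fun b _ => ((h.isOddDer_dStar _ _).smul _).smul _, fun y => ?_⟩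
    have hz : sigmaL ξ q z = ∑ b, ξ.coord b z • sigmaL ξ q (ξ b) := by
      conv_lhs => rw [← ξ.sum_repr z]
      simp only [map_sum, map_smul]
      rfl
    rw [hz]
    simp only [Finset.sum_mul, map_sum, smul_mul_assoc, map_smul, h.dbarStar_sigmaL_mul _ hq,
      LinearMap.sum_apply, LinearMap.smul_apply, smul_add, Finset.sum_add_distrib,
      Forms.neg_smul, one_smul]
  · exact ⟨0, .zero, fun y => by simp [sigmaL_of_neg ξ hq]⟩

/-! ### The Laplacian is of order two -/

variable (ξ) in
/-- The commutator of `∂̄*` with multiplication by the even element `w` is an odd derivation, up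
to multiplication operators. -/
def CommutesToOddDer (w : Forms r) : Prop :=
  ∃ U c, IsOddDer U ∧ ∀ y, dbarStar ξ (w * y) = w * dbarStar ξ y + U y + c * y

variable (ξ) in
/-- The anticommutator of `∂̄*` with multiplication by the odd element `w` is an even derivation,
up to multiplication operators. -/
def AnticommutesToEvenDer (w : Forms r) : Prop :=
  ∃ U c, IsEvenDer U ∧ ∀ y, dbarStar ξ (w * y) = -(w * dbarStar ξ y) + U y + c * y

theorem CommutesToOddDer.add {w w' : Forms r} (hw : CommutesToOddDer ξ w)
    (hw' : CommutesToOddDer ξ w') : CommutesToOddDer ξ (w + w') := by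
  obtain ⟨U, c, hU, h1⟩ := hw
  obtain ⟨U', c', hU', h2⟩ := hw'
  refine ⟨U + U', c + c', hU.add hU', fun y => ?_⟩
  rw [add_mul, map_add, h1, h2, LinearMap.add_apply, add_mul, add_mul]
  abel

theorem AnticommutesToEvenDer.add {w w' : Forms r} (hw : AnticommutesToEvenDer ξ w)
    (hw' : AnticommutesToEvenDer ξ w') : AnticommutesToEvenDer ξ (w + w') := by
  obtain ⟨U, c, hU, h1⟩ := hw
  obtain ⟨U', c', hU', h2⟩ := hw'
  refine ⟨U + U', c + c', hU.add hU', fun y => ?_⟩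
  rw [add_mul, map_add, h1, h2, LinearMap.add_apply, add_mul, add_mul]
  abel

theorem CommutesToOddDer.smul {w : Forms r} (hw : CommutesToOddDer ξ w) (k : ℂ) :
    CommutesToOddDer ξ (k • w) := by
  obtain ⟨U, c, hU, h1⟩ := hw
  refine ⟨k • U, k • c, hU.smul k, fun y => ?_⟩
  rw [smul_mul_assoc, map_smul, h1, LinearMap.smul_apply, smul_mul_assoc, smul_mul_assoc,
    smul_add, smul_add]

theorem CommutesToOddDer.sum {ι : Type*} {s : Finset ι} {f : ι → Forms r}
    (hf : ∀ i ∈ s, CommutesToOddDer ξ (f i)) : CommutesToOddDer ξ (∑ i ∈ s, f i) :=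
  Finset.sum_induction f _ (fun _ _ => .add) ⟨0, 0, .zero, fun y => by simp⟩ hf

theorem AnticommutesToEvenDer.sum {ι : Type*} {s : Finset ι} {f : ι → Forms r}
    (hf : ∀ i ∈ s, AnticommutesToEvenDer ξ (f i)) : AnticommutesToEvenDer ξ (∑ i ∈ s, f i) :=
  Finset.sum_induction f _ (fun _ _ => .add) ⟨0, 0, .zero, fun y => by simp⟩ hf

theorem IsFourierBasis.commutes_psiL_psiL (h : IsFourierBasis θ ξ) (p q : ℤ) (x z : 𝔤) :
    CommutesToOddDer ξ (psiL ξ p x * psiL ξ q z) := by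
  obtain ⟨U, hU, h1⟩ := h.exists_dbarStar_psiL_mul p x
  obtain ⟨V, hV, h2⟩ := h.exists_dbarStar_psiL_mul q z
  refine ⟨lmul (psiL ξ q z) * U + (-1 : ℂ) • (lmul (psiL ξ p x) * V), U (psiL ξ q z),
    (hU.odd_lmul (parity_psiL ξ _ _)).add ((hV.odd_lmul (parity_psiL ξ _ _)).smul _),
    fun y => ?_⟩
  rw [mul_assoc, h1, h2, hU.leibniz]
  simp only [LinearMap.add_apply, LinearMap.smul_apply, Module.End.mul_apply,
    LinearMap.mulLeft_apply, Forms.mul_sub, Forms.neg_smul, one_smul, mul_assoc]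
  abel

theorem IsFourierBasis.anticommutes_psiL_sigmaL (h : IsFourierBasis θ ξ) (p q : ℤ) (x z : 𝔤) :
    AnticommutesToEvenDer ξ (psiL ξ p x * sigmaL ξ q z) := by
  obtain ⟨U, hU, h1⟩ := h.exists_dbarStar_psiL_mul p x
  obtain ⟨V, hV, h2⟩ := h.exists_dbarStar_sigmaL_mul q z
  refine ⟨lmul (sigmaL ξ q z) * U + (-1 : ℂ) • (lmul (psiL ξ p x) * V), U (sigmaL ξ q z),
    (hU.even_lmul (parity_sigmaL ξ _ _)).add ((hV.odd_lmul (parity_psiL ξ _ _)).smul _),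
    fun y => ?_⟩
  rw [mul_assoc, h1, h2, hU.leibniz]
  simp only [LinearMap.add_apply, LinearMap.smul_apply, Module.End.mul_apply,
    LinearMap.mulLeft_apply, mul_add, Forms.neg_smul, one_smul, mul_assoc]
  abel

/-- The order of `∂̄ ∂̄* + ∂̄* ∂̄` is two, although `∂̄` is of order one and `∂̄*` of order two: the
commutators of `∂̄*` with multiplication by `g` and by `∂̄g` are derivations up to multiplication
operators, and so is the supercommutator of the first of them with the derivation `∂̄`. -/
theorem IsFourierBasis.isSecondOrder_boxBar (h : IsFourierBasis θ ξ) :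
    IsSecondOrder (boxBar ξ) := by
  refine .of_commutators ?_ (fun b n => ?_) (fun b n => ?_)
  · simp [boxBar, dbarStar_one, h.isOddDer_dbar.map_one]
  · rw [psi_eq_psiL ξ]
    set p := -n
    obtain ⟨U, hU, h1⟩ := h.exists_dbarStar_psiL_mul p (ξ b)
    obtain ⟨V, c, hV, h2⟩ : CommutesToOddDer ξ (dbar ξ (psiL ξ p (ξ b))) := by
      rw [h.dbar_psiL (N := p) (by omega)]
      exact (CommutesToOddDer.sum fun a _ => .sum fun m _ =>
        h.commutes_psiL_psiL _ _ _ _).smul _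
    refine ⟨(dbar ξ * U - U * dbar ξ) + V, c, (h.isOddDer_dbar.commutator hU).add hV,
      fun y => ?_⟩
    simp only [boxBar, LinearMap.add_apply, LinearMap.sub_apply, Module.End.mul_apply, h1,
      h.isOddDer_dbar.leibniz, parity_psiL, Forms.neg_mul, map_add, Forms.end_neg,
      Forms.end_sub, h2, mul_add]
    abel
  · rw [sigma_eq_sigmaL ξ]
    set p := -n
    obtain ⟨U, hU, h1⟩ := h.exists_dbarStar_sigmaL_mul p (ξ b)
    obtain ⟨V, c, hV, h2⟩ : AnticommutesToEvenDer ξ (dbar ξ (sigmaL ξ p (ξ b))) := by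
      rw [h.dbar_sigmaL le_rfl]
      exact AnticommutesToEvenDer.sum fun a _ => .sum fun m _ =>
        h.anticommutes_psiL_sigmaL _ _ _ _
    refine ⟨(dbar ξ * U + U * dbar ξ) + V, c, (h.isOddDer_dbar.anticommutator hU).add hV,
      fun y => ?_⟩
    simp only [boxBar, LinearMap.add_apply, Module.End.mul_apply, h1,
      h.isOddDer_dbar.leibniz, parity_sigmaL, map_add, h2, mul_add]
    abel

theorem IsFourierBasis.isSecondOrder_box (h : IsFourierBasis θ ξ) : IsSecondOrder (box ξ) :=
  .locSum _ fun _ => (((h.isEvenDer_R _ _).add (h.isEvenDer_ad _ _)).smul _).mul_isSecondOrder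
    ((h.isEvenDer_R _ _).add (h.isEvenDer_adStar _ _))

theorem IsFourierBasis.isSecondOrder_bigD (h : IsFourierBasis θ ξ) : IsSecondOrder (bigD ξ) :=
  .locSum _ fun _ => (h.isOddDer_d _ _).mul_isSecondOrder (h.isOddDer_dStar _ _)

end Operators

/-! ### Sums over the splittings of the energy -/

section Sums

variable {M : Type*} [AddCommGroup M] [Module ℂ M]

theorem sum_Icc_split {N : Type*} [AddCommMonoid N] {a b c : ℤ} (h1 : a ≤ b + 1) (h2 : b ≤ c)
    (f : ℤ → N) :
    ∑ k ∈ Finset.Icc a c, f k = ∑ k ∈ Finset.Icc a b, f k + ∑ k ∈ Finset.Icc (b + 1) c, f k := by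
  rw [← Finset.sum_union]
  · congr 1
    ext k
    simp only [Finset.mem_union, Finset.mem_Icc]
    omega
  · rw [Finset.disjoint_left]
    intro k hk hk'
    simp only [Finset.mem_Icc] at hk hk'
    omega

/-- Comparison of the brackets of `ψ(-p)` and `σ(-q)`: all the sums are over the splittings of the
total energy `p + q`, in an initial, a final or the whole range. -/
theorem bracket_sum_odd_even (H L : ℤ → M) {p q : ℤ} (hp : 0 < p) (hq : 0 ≤ q) :
    ((1 / p : ℂ) • ∑ k ∈ Finset.Icc 1 (p + q), (L k - H k) +
        ∑ m ∈ Finset.Icc 1 (p - 1), (1 / m : ℂ) • H (p - m)) -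
      (1 / p : ℂ) • ∑ m ∈ Finset.Icc 1 q, (L m - (((m : ℂ) + p) / m) • H (p + m)) =
    (∑ m ∈ Finset.Icc 1 (p - 1), ((1 / m : ℂ) * (((p : ℂ) - m) / p)) • H (p - m) +
        ∑ m ∈ Finset.Icc 1 q, (1 / m : ℂ) • H (p + m)) +
      (1 / p : ℂ) • ∑ m ∈ Finset.Icc 1 p, L (q + m) - (1 / p : ℂ) • H p := by
  have hp0 : (p : ℂ) ≠ 0 := by exact_mod_cast hp.ne'
  have e1 : ∑ m ∈ Finset.Icc 1 (p - 1), (1 / m : ℂ) • H (p - m) =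
      ∑ m ∈ Finset.Icc 1 (p - 1), ((1 / m : ℂ) * (((p : ℂ) - m) / p)) • H (p - m) +
        (1 / p : ℂ) • ∑ k ∈ Finset.Icc 1 (p - 1), H k := by
    rw [← sum_Icc_reflect p H, Finset.smul_sum, ← Finset.sum_add_distrib]
    refine Finset.sum_congr rfl fun m hm => ?_
    have hm0 : (m : ℂ) ≠ 0 := by
      rw [Finset.mem_Icc] at hm
      exact_mod_cast (show m ≠ 0 by omega)
    rw [← add_smul]
    congr 1
    field_simp
    ring
  have e2 : (1 / p : ℂ) • ∑ m ∈ Finset.Icc 1 q, (L m - (((m : ℂ) + p) / m) • H (p + m)) =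
      (1 / p : ℂ) • ∑ m ∈ Finset.Icc 1 q, L m - (1 / p : ℂ) • ∑ k ∈ Finset.Icc (p + 1) (p + q), H k
        - ∑ m ∈ Finset.Icc 1 q, (1 / m : ℂ) • H (p + m) := by
    rw [← sum_Icc_add p q H, Finset.smul_sum, Finset.smul_sum, Finset.smul_sum,
      ← Finset.sum_sub_distrib, ← Finset.sum_sub_distrib]
    refine Finset.sum_congr rfl fun m hm => ?_
    have hm0 : (m : ℂ) ≠ 0 := by
      rw [Finset.mem_Icc] at hm
      exact_mod_cast (show m ≠ 0 by omega)
    have : (1 / p : ℂ) * (((m : ℂ) + p) / m) = 1 / p + 1 / m := by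
      field_simp
    rw [smul_sub, smul_smul, this, add_smul]
    abel
  have e3 : ∑ m ∈ Finset.Icc 1 p, L (q + m) = ∑ k ∈ Finset.Icc (q + 1) (p + q), L k := by
    rw [sum_Icc_add q p L, add_comm p q]
  have e4 : ∑ k ∈ Finset.Icc 1 (p + q), H k = ∑ k ∈ Finset.Icc 1 (p - 1), H k + H p +
      ∑ k ∈ Finset.Icc (p + 1) (p + q), H k := by
    rw [sum_Icc_split (b := p) (by omega) (by omega),
      sum_Icc_split (a := 1) (b := p - 1) (c := p) (by omega) (by omega)]
    simp
  rw [e1, e2, e3, Finset.sum_sub_distrib, e4,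
    sum_Icc_split (a := 1) (b := q) (by omega) (by omega) L]
  module

/-- Comparison of the brackets of `ψ(-p)` and `ψ(-q)`. -/
theorem bracket_sum_odd_odd (H : ℤ → M) {p q : ℤ} (hp : 0 < p) (hq : 0 < q) :
    ((1 / p * (((q : ℂ) + p) / q)) • (1 / 2 : ℂ) •
          ∑ k ∈ Finset.Icc 1 (p + q - 1), (-H (p + q - k) - H k) +
        ∑ m ∈ Finset.Icc 1 (p - 1), ((1 / m : ℂ) * (((q : ℂ) + m) / q)) • H (p - m)) -
      (1 / p : ℂ) • (1 / 2 : ℂ) • ∑ m ∈ Finset.Icc 1 (q - 1),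
        (((((q - m : ℤ) : ℂ) + p) / ((q - m : ℤ) : ℂ)) • -H (p + q - m) -
          (((m : ℂ) + p) / m) • H (p + m)) =
    (∑ m ∈ Finset.Icc 1 (p - 1), ((1 / m : ℂ) * (((p : ℂ) - m) / p)) • H (p - m) +
        ∑ m ∈ Finset.Icc 1 (q - 1), ((1 / m : ℂ) * (((q : ℂ) - m) / q)) • H (p + m)) +
      (-(1 / p : ℂ) + -(1 / q : ℂ)) • H p := by
  have hp0 : (p : ℂ) ≠ 0 := by exact_mod_cast hp.ne'
  have hq0 : (q : ℂ) ≠ 0 := by exact_mod_cast hq.ne'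
  have e1 : ∑ m ∈ Finset.Icc 1 (p - 1), ((1 / m : ℂ) * (((q : ℂ) + m) / q)) • H (p - m) =
      ∑ m ∈ Finset.Icc 1 (p - 1), ((1 / m : ℂ) * (((p : ℂ) - m) / p)) • H (p - m) +
        (1 / p + 1 / q : ℂ) • ∑ k ∈ Finset.Icc 1 (p - 1), H k := by
    rw [← sum_Icc_reflect p H, Finset.smul_sum, ← Finset.sum_add_distrib]
    refine Finset.sum_congr rfl fun m hm => ?_
    have hm0 : (m : ℂ) ≠ 0 := by
      rw [Finset.mem_Icc] at hm
      exact_mod_cast (show m ≠ 0 by omega)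
    rw [← add_smul]
    congr 1
    field_simp
    ring
  have e2 : ∑ m ∈ Finset.Icc 1 (q - 1), (((m : ℂ) + p) / m) • H (p + m) =
      (p : ℂ) • (∑ m ∈ Finset.Icc 1 (q - 1), ((1 / m : ℂ) * (((q : ℂ) - m) / q)) • H (p + m) +
        (1 / p + 1 / q : ℂ) • ∑ k ∈ Finset.Icc (p + 1) (p + q - 1), H k) := by
    rw [← add_sub_assoc', ← sum_Icc_add p (q - 1) H, Finset.smul_sum, ← Finset.sum_add_distrib,
      Finset.smul_sum]
    refine Finset.sum_congr rfl fun m hm => ?_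
    have hm0 : (m : ℂ) ≠ 0 := by
      rw [Finset.mem_Icc] at hm
      exact_mod_cast (show m ≠ 0 by omega)
    rw [← add_smul, smul_smul]
    congr 1
    field_simp
    ring
  have e3 : ∑ m ∈ Finset.Icc 1 (q - 1),
      ((((q - m : ℤ) : ℂ) + p) / ((q - m : ℤ) : ℂ)) • -H (p + q - m) =
      -∑ m ∈ Finset.Icc 1 (q - 1), (((m : ℂ) + p) / m) • H (p + m) := by
    rw [← sum_Icc_reflect q, ← Finset.sum_neg_distrib]
    refine Finset.sum_congr rfl fun m _ => ?_
    rw [smul_neg, add_sub_assoc, sub_sub_cancel]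
  have e4 : ∑ k ∈ Finset.Icc 1 (p + q - 1), H k = ∑ k ∈ Finset.Icc 1 (p - 1), H k + H p +
      ∑ k ∈ Finset.Icc (p + 1) (p + q - 1), H k := by
    rw [sum_Icc_split (b := p) (by omega) (by omega),
      sum_Icc_split (a := 1) (b := p - 1) (c := p) (by omega) (by omega)]
    simp
  have e5 : (1 / p * (((q : ℂ) + p) / q)) = 1 / p + 1 / q := by
    field_simp
  have e6 : ∀ z : M, (1 / p : ℂ) • (p : ℂ) • z = z := fun z => by
    rw [smul_smul, one_div_mul_cancel hp0, one_smul]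
  rw [Finset.sum_sub_distrib, Finset.sum_sub_distrib, Finset.sum_neg_distrib,
    sum_Icc_reflect (p + q) H, e3, e1, e2, e4, e5]
  set A := ∑ m ∈ Finset.Icc 1 (q - 1), ((1 / m : ℂ) * (((q : ℂ) - m) / q)) • H (p + m)
  set A' := ∑ m ∈ Finset.Icc 1 (p - 1), ((1 / m : ℂ) * (((p : ℂ) - m) / p)) • H (p - m)
  set B := ∑ k ∈ Finset.Icc 1 (p - 1), H k
  set B' := ∑ k ∈ Finset.Icc (p + 1) (p + q - 1), H k
  have e7 : (1 / p : ℂ) • (1 / 2 : ℂ) • (-((p : ℂ) • (A + (1 / p + 1 / q : ℂ) • B')) -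
      (p : ℂ) • (A + (1 / p + 1 / q : ℂ) • B')) = -(A + (1 / p + 1 / q : ℂ) • B') := by
    generalize A + (1 / p + 1 / q : ℂ) • B' = z
    have : (1 / 2 : ℂ) • (-((p : ℂ) • z) - (p : ℂ) • z) = (p : ℂ) • -z := by module
    rw [this, e6]
  rw [e7]
  module

/-- The scalar by which the Laplacian acts on `ψ(-p)`, as the sum of the scalars of `□`, of `D`
and of the term which vanishes on invariants. -/
theorem scalar_sum_psi {p : ℤ} (hp : 0 < p) :
    (1 / 2 : ℂ) * ∑ m ∈ Finset.Icc 1 (p - 1),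
      (1 / m : ℂ) * ((((p - m : ℤ) : ℂ) + m) / ((p - m : ℤ) : ℂ)) =
    ∑ m ∈ Finset.Icc 1 (p - 1), (1 / m : ℂ) * (((p : ℂ) - m) / p) +
      ∑ _m ∈ Finset.Icc 1 p, (1 / p : ℂ) + -(1 / p : ℂ) := by
  have hp0 : (p : ℂ) ≠ 0 := by exact_mod_cast hp.ne'
  have e1 : ∑ m ∈ Finset.Icc 1 (p - 1),
      (1 / m : ℂ) * ((((p - m : ℤ) : ℂ) + m) / ((p - m : ℤ) : ℂ)) =
      ∑ m ∈ Finset.Icc 1 (p - 1), (1 / m : ℂ) + ∑ m ∈ Finset.Icc 1 (p - 1), (1 / m : ℂ) := by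
    nth_rewrite 3 [← sum_Icc_reflect]
    rw [← Finset.sum_add_distrib]
    refine Finset.sum_congr rfl fun m hm => ?_
    rw [Finset.mem_Icc] at hm
    have hm0 : (m : ℂ) ≠ 0 := by exact_mod_cast (show m ≠ 0 by omega)
    have hm1 : ((p - m : ℤ) : ℂ) ≠ 0 := by exact_mod_cast (show p - m ≠ 0 by omega)
    field_simp
  have e2 : ∑ m ∈ Finset.Icc 1 (p - 1), (1 / m : ℂ) =
      ∑ m ∈ Finset.Icc 1 (p - 1), (1 / m : ℂ) * (((p : ℂ) - m) / p) +
        ∑ m ∈ Finset.Icc 1 (p - 1), (1 / p : ℂ) := by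
    rw [← Finset.sum_add_distrib]
    refine Finset.sum_congr rfl fun m hm => ?_
    rw [Finset.mem_Icc] at hm
    have hm0 : (m : ℂ) ≠ 0 := by exact_mod_cast (show m ≠ 0 by omega)
    field_simp
    ring
  have e3 : ∑ m ∈ Finset.Icc 1 p, (1 / p : ℂ) =
      ∑ m ∈ Finset.Icc 1 (p - 1), (1 / p : ℂ) + 1 / p := by
    rw [sum_Icc_split (a := 1) (b := p - 1) (c := p) (by omega) (by omega)]
    simp
  rw [e1, e3, e2]
  ring

end Sums

/-! ### Brackets of the generators -/

/-- The bracket of `u` and `v` under a locally finite sum over `a` and `m > 0`, when the brackets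
under its terms are sums of two families, vanishing for `m > N₁` and for `m > N₂`. -/
theorem locSum_mul_apply {F : Fin r × ℕ+ → Module.End ℂ (Forms r)} (hF : LocFin F)
    (C₁ C₂ : Fin r → ℤ → Forms r) (u v : Forms r) {N₁ N₂ : ℤ}
    (hC : ∀ a (m : ℕ+), F (a, m) (u * v) =
      F (a, m) u * v + u * F (a, m) v + (C₁ a m + C₂ a m))
    (h₁ : ∀ a m, N₁ < m → C₁ a m = 0) (h₂ : ∀ a m, N₂ < m → C₂ a m = 0) :
    locSum F hF (u * v) = locSum F hF u * v + u * locSum F hF v +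
      (∑ m ∈ Finset.Icc 1 N₁, ∑ a, C₁ a m + ∑ m ∈ Finset.Icc 1 N₂, ∑ a, C₂ a m) := by
  have hC' : ∀ i : Fin r × ℕ+, F i (u * v) =
      F i u * v + u * F i v + (C₁ i.1 i.2 + C₂ i.1 i.2) := fun i => hC i.1 i.2
  obtain ⟨hf₁, e₁⟩ := finsum_index_eq_sum C₁ N₁ h₁
  obtain ⟨hf₂, e₂⟩ := finsum_index_eq_sum C₂ N₂ h₂
  have hu : (Function.support fun i => F i u * v).Finite :=
    (hF u).subset fun i hi hc => hi (by simp only [hc, zero_mul])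
  have hv : (Function.support fun i => u * F i v).Finite :=
    (hF v).subset fun i hi hc => hi (by simp only [hc, mul_zero])
  rw [Finset.sum_comm, ← e₁, Finset.sum_comm, ← e₂]
  change ∑ᶠ i, F i (u * v) = (∑ᶠ i, F i u) * v + u * (∑ᶠ i, F i v) + _
  rw [finsum_congr hC', finsum_add_distrib, finsum_add_distrib hu hv, finsum_add_distrib hf₁ hf₂,
    finsum_mul' _ _ (hF u), mul_finsum' _ _ (hF v)]
  · exact (hu.union hv).subset (Function.support_add _ _)
  · exact (hf₁.union hf₂).subset (Function.support_add _ _)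

section Operators

variable {𝔤 : Type*} [LieRing 𝔤] [LieAlgebra ℂ 𝔤] {θ : CompactForm 𝔤}
  {ξ : Module.Basis (Fin r) ℂ 𝔤}

variable (ξ) in
/-- The invariant `∑ₐ f_k[ξ_a, x] g_{N-k}[ξ_a, y]` of two families of generators, at the splitting
`N = k + (N - k)` of the energy. -/
def lieSum (f g : ℤ → 𝔤 →ₗ[ℂ] Forms r) (N : ℤ) (x y : 𝔤) (k : ℤ) : Forms r :=
  ∑ a, f k ⁅ξ a, x⁆ * g (N - k) ⁅ξ a, y⁆

variable (ξ) in
/-- The invariant `∑ₐ f_k(ξ_a) g_{N-k}[x, [ξ_a, y]]` of two families of generators. -/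
def nestSum (f g : ℤ → 𝔤 →ₗ[ℂ] Forms r) (N : ℤ) (x y : 𝔤) (k : ℤ) : Forms r :=
  ∑ a, f k (ξ a) * g (N - k) ⁅x, ⁅ξ a, y⁆⁆

/-- The differential of a generator in the direction `[x, y]`, expressed by the two invariants. -/
theorem IsFourierBasis.sum_lie_lie (h : IsFourierBasis θ ξ) (f g : ℤ → 𝔤 →ₗ[ℂ] Forms r)
    (N : ℤ) (x y : 𝔤) (k : ℤ) :
    ∑ a, f k (ξ a) * g (N - k) ⁅ξ a, ⁅x, y⁆⁆ =
      nestSum ξ f g N x y k - lieSum ξ f g N x y k := by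
  rw [lieSum, h.casimir_lie, nestSum, sub_neg_eq_add, ← Finset.sum_add_distrib]
  refine Finset.sum_congr rfl fun a _ => ?_
  rw [leibniz_lie (ξ a) x y, map_add, mul_add, add_comm]

theorem IsFourierBasis.nestSum_eq (h : IsFourierBasis θ ξ) (f g : ℤ → 𝔤 →ₗ[ℂ] Forms r)
    (N : ℤ) (x y : 𝔤) (k : ℤ) :
    nestSum ξ f g N x y k = ∑ a, f k ⁅ξ a, y⁆ * g (N - k) ⁅ξ a, x⁆ := by
  rw [h.casimir_lie, nestSum, ← Finset.sum_neg_distrib]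
  refine Finset.sum_congr rfl fun a _ => ?_
  rw [← lie_skew, map_neg, Forms.mul_neg]

theorem IsFourierBasis.nestSum_psiL (h : IsFourierBasis θ ξ) (N : ℤ) (x y : 𝔤) (k : ℤ) :
    nestSum ξ (psiL ξ) (psiL ξ) N x y k = -lieSum ξ (psiL ξ) (psiL ξ) N x y (N - k) := by
  rw [h.nestSum_eq, lieSum, ← Finset.sum_neg_distrib]
  refine Finset.sum_congr rfl fun a _ => ?_
  rw [psiL_mul_psiL, sub_sub_cancel]

variable (ξ) in
/-- A family of generators `f p`, for the energies `p ≥ e`, with the features common to the `ψ`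
(`e = 1`, `c = 1/2`) and the `σ` (`e = 0`, `c = 1`). The coefficient `k p m` describes the action
of `R_a(m) + ad_a(-m)*`. -/
structure IsGeneratorFamily (f : ℤ → 𝔤 →ₗ[ℂ] Forms r) (e : ℤ) (c : ℂ) (k : ℤ → ℤ → ℂ) :
    Prop where
  of_lt : ∀ {p}, p < e → ∀ x, f p x = 0
  lower : ∀ a m {p}, e ≤ p → ∀ x, (R ξ a m + adStar ξ a (-m)) (f p x) = k p m • f (p - m) ⁅ξ a, x⁆
  raise : ∀ a m {p}, e ≤ p → ∀ x, (R ξ a m + ad ξ a m) (f p x) = f (p - m) ⁅ξ a, x⁆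
  dbar_eq : ∀ p x, dbar ξ (f p x) =
    c • ∑ m ∈ Finset.Icc 1 (p - e), ∑ a, psiL ξ m (ξ a) * f (p - m) ⁅ξ a, x⁆
  dbarStar_eq : ∀ p x, dbarStar ξ (f p x) = 0

theorem IsFourierBasis.dbarStar_psiL (h : IsFourierBasis θ ξ) (p : ℤ) (x : 𝔤) :
    dbarStar ξ (psiL ξ p x) = 0 := by
  rcases lt_or_ge 0 p with hp | hp
  · have : dbarStar ξ ∘ₗ psiL ξ p = 0 := ξ.ext fun b => by
      have := h.dbarStar_psiL_mul b hp 1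
      rwa [mul_one, dbarStar_one, mul_zero, sub_zero,
        ((h.isEvenDer_R _ _).add (h.isEvenDer_adStar _ _)).map_one, smul_zero] at this
    exact LinearMap.congr_fun this x
  · rw [psiL_of_nonpos ξ hp, map_zero]

theorem IsFourierBasis.dbarStar_sigmaL (h : IsFourierBasis θ ξ) (p : ℤ) (x : 𝔤) :
    dbarStar ξ (sigmaL ξ p x) = 0 := by
  rcases le_or_gt 0 p with hp | hp
  · have : dbarStar ξ ∘ₗ sigmaL ξ p = 0 := ξ.ext fun b => by
      have := h.dbarStar_sigmaL_mul b hp 1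
      rwa [mul_one, dbarStar_one, mul_zero, add_zero, (h.isOddDer_dStar _ _).map_one,
        Forms.neg_zero] at this
    exact LinearMap.congr_fun this x
  · rw [sigmaL_of_neg ξ hp, map_zero]

theorem IsFourierBasis.isGeneratorFamily_psiL (h : IsFourierBasis θ ξ) :
    IsGeneratorFamily ξ (psiL ξ) 1 (1 / 2) fun p m => ((p : ℂ) - m) / p where
  of_lt hp := psiL_of_nonpos ξ (by omega)
  lower a m p hp x := by
    rw [LinearMap.add_apply, R_psiL, h.adStar_psiL _ _ (by omega), zero_add, ← sub_eq_add_neg]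
    push_cast
    rw [← sub_eq_add_neg]
  raise a m p hp x := by
    rw [LinearMap.add_apply, R_psiL, h.ad_psiL _ _ (by omega), zero_add]
  dbar_eq p x := by rw [h.dbar_psiL (N := p - 1) (by omega), Finset.sum_comm]
  dbarStar_eq := h.dbarStar_psiL

theorem IsFourierBasis.isGeneratorFamily_sigmaL (h : IsFourierBasis θ ξ) :
    IsGeneratorFamily ξ (sigmaL ξ) 0 1 fun _ _ => 1 where
  of_lt hp := sigmaL_of_neg ξ hp
  lower a m p hp x := by
    rw [LinearMap.add_apply, adStar_sigmaL, h.R_sigmaL _ _ hp, add_zero, one_smul]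
  raise a m p hp x := by
    rw [LinearMap.add_apply, ad_sigmaL, h.R_sigmaL _ _ hp, add_zero]
  dbar_eq p x := by rw [h.dbar_sigmaL le_rfl, Finset.sum_comm, one_smul, sub_zero]
  dbarStar_eq := h.dbarStar_sigmaL

variable {f g : ℤ → 𝔤 →ₗ[ℂ] Forms r} {e e' : ℤ} {c c' : ℂ} {k k' : ℤ → ℤ → ℂ}

theorem IsGeneratorFamily.box_apply (h : IsFourierBasis θ ξ) (hf : IsGeneratorFamily ξ f e c k)
    {p : ℤ} (hp : e ≤ p) (x : 𝔤) :
    box ξ (f p x) = (∑ m ∈ Finset.Icc 1 (p - e), (1 / m : ℂ) * k p m) • f p x := by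
  have h1 : box ξ (f p x) = ∑ a, ∑ m ∈ Finset.Icc 1 (p - e),
      if m ≤ p - e then ((1 / m : ℂ) * k p m) • f p ⁅ξ a, ⁅ξ a, x⁆⁆ else 0 := by
    refine locSum_apply_eq_sum _ _ _ _ (fun a m => ?_) fun a m hm => if_neg (by omega)
    rw [Module.End.mul_apply, hf.lower a m hp, map_smul, LinearMap.smul_apply]
    split_ifs with hm
    · rw [hf.raise a _ (by omega), sub_neg_eq_add, sub_add_cancel, smul_smul, mul_comm]
      simp
    · rw [hf.of_lt (by omega), map_zero, smul_zero, smul_zero]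
  rw [h1, Finset.sum_comm, Finset.sum_smul]
  refine Finset.sum_congr rfl fun m hm => ?_
  simp only [(Finset.mem_Icc.1 hm).2, if_true, ← Finset.smul_sum, ← map_sum, h.casimir_adjoint]

/-- The bracket of two generators under `□`. -/
theorem IsGeneratorFamily.box_mul (h : IsFourierBasis θ ξ) (hf : IsGeneratorFamily ξ f e c k)
    (hg : IsGeneratorFamily ξ g e' c' k') {p q : ℤ} (hp : e ≤ p) (hq : e' ≤ q) (x y : 𝔤) :
    box ξ (f p x * g q y) = box ξ (f p x) * g q y + f p x * box ξ (g q y) +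
      (∑ m ∈ Finset.Icc 1 (p - e), ((1 / m : ℂ) * k p m) • lieSum ξ f g (p + q) x y (p - m) +
        ∑ m ∈ Finset.Icc 1 (q - e'),
          ((1 / m : ℂ) * k' q m) • lieSum ξ f g (p + q) x y (p + m)) := by
  simp only [lieSum, Finset.smul_sum]
  refine locSum_mul_apply _
    (fun a m => ((1 / m : ℂ) * k p m) • (f (p - m) ⁅ξ a, x⁆ * g (p + q - (p - m)) ⁅ξ a, y⁆))
    (fun a m => ((1 / m : ℂ) * k' q m) • (f (p + m) ⁅ξ a, x⁆ * g (p + q - (p + m)) ⁅ξ a, y⁆))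
    _ _ (fun a m => ?_) (fun a m hm => ?_) fun a m hm => ?_
  · have hY := (h.isEvenDer_R a m).add (h.isEvenDer_adStar a (-m))
    have hX := (h.isEvenDer_R a (-m)).add (h.isEvenDer_ad a (-m))
    simp only [Module.End.mul_apply, LinearMap.smul_apply, hY.leibniz, map_add, hX.leibniz]
    rw [hf.lower a m hp, hg.lower a m hq, hf.raise a (-m) hp, hg.raise a (-m) hq]
    have e1 : p + q - (p - (m : ℤ)) = q - -(m : ℤ) := by ring
    have e2 : p + q - (p + (m : ℤ)) = q - (m : ℤ) := by ring
    have e3 : p + (m : ℤ) = p - -(m : ℤ) := by ring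
    rw [e1, e2, e3]
    simp only [map_smul, smul_mul_assoc, mul_smul_comm, smul_add, smul_smul, Int.cast_natCast]
    abel
  · rw [hf.of_lt (by omega), zero_mul, smul_zero]
  · rw [hg.of_lt (p := p + q - (p + m)) (by omega), mul_zero, smul_zero]

/-- The value of the adjoint differential on a product of an odd generator and a generator. -/
theorem IsGeneratorFamily.dbarStar_psiL_mul (h : IsFourierBasis θ ξ)
    (hg : IsGeneratorFamily ξ g e' c' k') {p q : ℤ} (hp : 0 < p) (hq : e' ≤ q) (z y : 𝔤) :
    dbarStar ξ (psiL ξ p z * g q y) = ((1 / p : ℂ) * k' q (-p)) • g (q + p) ⁅z, y⁆ := by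
  have : dbarStar ξ ∘ₗ LinearMap.mulRight ℂ (g q y) ∘ₗ psiL ξ p =
      ((1 / p : ℂ) * k' q (-p)) • (g (q + p) ∘ₗ (-LieAlgebra.ad ℂ 𝔤 y)) := ξ.ext fun b => by
    have h1 := hg.lower b (-p) hq y
    rw [neg_neg, sub_neg_eq_add] at h1
    simp only [LinearMap.comp_apply, LinearMap.mulRight_apply, LinearMap.smul_apply,
      LinearMap.neg_apply, LieAlgebra.ad_apply, lie_skew]
    rw [h.dbarStar_psiL_mul b hp, hg.dbarStar_eq, mul_zero, sub_zero, h1, smul_smul]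
  have h2 := LinearMap.congr_fun this z
  simpa only [LinearMap.comp_apply, LinearMap.mulRight_apply, LinearMap.smul_apply,
    LinearMap.neg_apply, LieAlgebra.ad_apply, lie_skew] using h2

theorem IsGeneratorFamily.boxBar_apply (h : IsFourierBasis θ ξ)
    (hg : IsGeneratorFamily ξ g e' c' k') (q : ℤ) (y : 𝔤) :
    boxBar ξ (g q y) =
      (c' * ∑ m ∈ Finset.Icc 1 (q - e'), (1 / m : ℂ) * k' (q - m) (-m)) • g q y := by
  rw [boxBar, LinearMap.add_apply, Module.End.mul_apply, Module.End.mul_apply, hg.dbarStar_eq,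
    map_zero, zero_add, hg.dbar_eq, map_smul, mul_smul, Finset.sum_smul, map_sum]
  congr 1
  refine Finset.sum_congr rfl fun m hm => ?_
  rw [Finset.mem_Icc] at hm
  rw [map_sum]
  simp only [hg.dbarStar_psiL_mul h (p := m) (q := q - m) (by omega) (by omega), sub_add_cancel]
  rw [← Finset.smul_sum, ← map_sum, h.casimir_adjoint]

/-- The bracket of an odd generator and a generator under the Laplacian `∂̄ ∂̄* + ∂̄* ∂̄`. -/
theorem IsGeneratorFamily.boxBar_psiL_mul (h : IsFourierBasis θ ξ)
    (hg : IsGeneratorFamily ξ g e' c' k') {p q : ℤ} (hp : 0 < p) (hq : e' ≤ q) (b : Fin r)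
    (y : 𝔤) :
    boxBar ξ (psiL ξ p (ξ b) * g q y) =
      boxBar ξ (psiL ξ p (ξ b)) * g q y + psiL ξ p (ξ b) * boxBar ξ (g q y) +
      ((((1 / p : ℂ) * k' q (-p)) • c' • ∑ j ∈ Finset.Icc 1 (p + q - e'),
          (nestSum ξ (psiL ξ) g (p + q) (ξ b) y j - lieSum ξ (psiL ξ) g (p + q) (ξ b) y j) +
        ∑ m ∈ Finset.Icc 1 (p - 1),
          ((1 / m : ℂ) * k' q (-m)) • lieSum ξ (psiL ξ) g (p + q) (ξ b) y (p - m)) -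
        (1 / p : ℂ) • c' • ∑ m ∈ Finset.Icc 1 (q - e'),
          (k' (q - m) (-p) • nestSum ξ (psiL ξ) g (p + q) (ξ b) y m -
            (((m : ℂ) + p) / m) • lieSum ξ (psiL ξ) g (p + q) (ξ b) y (p + m))) := by
  have hK : IsEvenDer (R ξ b (-p) + adStar ξ b p) :=
    (h.isEvenDer_R b (-p)).add (h.isEvenDer_adStar b p)
  -- the term `∂̄ ∂̄* (ψ g)`
  have e1 : dbar ξ (dbarStar ξ (psiL ξ p (ξ b) * g q y)) =
      ((1 / p : ℂ) * k' q (-p)) • c' • ∑ j ∈ Finset.Icc 1 (p + q - e'),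
        (nestSum ξ (psiL ξ) g (p + q) (ξ b) y j - lieSum ξ (psiL ξ) g (p + q) (ξ b) y j) := by
    rw [hg.dbarStar_psiL_mul h hp hq, map_smul, hg.dbar_eq, add_comm q p]
    simp only [h.sum_lie_lie]
  -- the term `∂̄* (ψ ∂̄ g)`
  have e2 : dbarStar ξ (psiL ξ p (ξ b) * dbar ξ (g q y)) =
      (1 / p : ℂ) • c' • ∑ m ∈ Finset.Icc 1 (q - e'),
          (k' (q - m) (-p) • nestSum ξ (psiL ξ) g (p + q) (ξ b) y m -
            (((m : ℂ) + p) / m) • lieSum ξ (psiL ξ) g (p + q) (ξ b) y (p + m)) -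
        psiL ξ p (ξ b) * boxBar ξ (g q y) := by
    rw [h.dbarStar_psiL_mul b hp]
    congr 2
    · rw [hg.dbar_eq, map_smul, map_sum]
      congr 1
      refine Finset.sum_congr rfl fun m hm => ?_
      rw [Finset.mem_Icc] at hm
      rw [map_sum, nestSum, lieSum, Finset.smul_sum, Finset.smul_sum, ← Finset.sum_sub_distrib]
      refine Finset.sum_congr rfl fun a _ => ?_
      have h1 := hg.lower b (-p) (p := q - m) (by omega) ⁅ξ a, y⁆
      rw [neg_neg, sub_neg_eq_add] at h1
      rw [hK.leibniz, h1, LinearMap.add_apply, R_psiL, h.adStar_psiL b p (by omega), zero_add,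
        ← lie_skew, map_neg, Forms.smul_neg, Forms.neg_mul, smul_mul_assoc, mul_smul_comm,
        show q - m + p = p + q - m by ring, show p + q - (p + m) = q - m by ring, add_comm m p]
      abel
    · rw [boxBar, LinearMap.add_apply, Module.End.mul_apply, hg.dbarStar_eq, map_zero, zero_add]
      rfl
  -- the term `∂̄* (∂̄ψ g)`
  have e3 : dbarStar ξ (dbar ξ (psiL ξ p (ξ b)) * g q y) =
      boxBar ξ (psiL ξ p (ξ b)) * g q y + ∑ m ∈ Finset.Icc 1 (p - 1),
          ((1 / m : ℂ) * k' q (-m)) • lieSum ξ (psiL ξ) g (p + q) (ξ b) y (p - m) := by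
    set W : ℤ → Forms r := fun m =>
      ((1 / m : ℂ) * k' q (-m)) • lieSum ξ (psiL ξ) g (p + q) (ξ b) y (p - m) with hW
    -- the cross terms `W m` and `W (p - m)` come from `∂̄*` pairing one of the two factors of `∂̄ψ`
    -- with `g`; they have equal sums, which cancels the factor `1/2` of `∂̄ψ`
    have h1 : ∀ m ∈ Finset.Icc 1 (p - 1),
        ∑ a, dbarStar ξ (psiL ξ m (ξ a) * psiL ξ (p - m) ⁅ξ a, ξ b⁆ * g q y) =
        ∑ a, dbarStar ξ (psiL ξ m (ξ a) * psiL ξ (p - m) ⁅ξ a, ξ b⁆) * g q y +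
          (W m + W (p - m)) := by
      intro m hm
      rw [Finset.mem_Icc] at hm
      have h2 : W m = ∑ a, (1 / m : ℂ) •
          (psiL ξ (p - m) ⁅ξ a, ξ b⁆ * (R ξ a (-m) + adStar ξ a m) (g q y)) := by
        rw [hW]
        simp only [lieSum, Finset.smul_sum]
        refine Finset.sum_congr rfl fun a _ => ?_
        have h1 := hg.lower a (-m) hq y
        rw [neg_neg, sub_neg_eq_add] at h1
        rw [h1, mul_smul_comm, smul_smul, show p + q - (p - m) = q + m by ring]
      have h3 : W (p - m) = -∑ a, psiL ξ m (ξ a) *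
          dbarStar ξ (psiL ξ (p - m) ⁅ξ a, ξ b⁆ * g q y) := by
        rw [hW]
        simp only [hg.dbarStar_psiL_mul h (p := p - m) (by omega) hq, mul_smul_comm,
          ← Finset.smul_sum, sub_sub_cancel]
        rw [← Forms.smul_neg, ← h.casimir_lie, lieSum, show q + (p - m) = p + q - m by ring]
      rw [h2, h3, ← Finset.sum_neg_distrib, ← Finset.sum_add_distrib, ← Finset.sum_add_distrib]
      refine Finset.sum_congr rfl fun a _ => ?_
      have hKa : IsEvenDer (R ξ a (-m) + adStar ξ a m) :=
        (h.isEvenDer_R a (-m)).add (h.isEvenDer_adStar a m)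
      rw [mul_assoc, h.dbarStar_psiL_mul a (by omega), h.dbarStar_psiL_mul a (by omega),
        h.dbarStar_psiL, hKa.leibniz, mul_zero, sub_zero, smul_add, smul_mul_assoc]
      abel
    have h4 : boxBar ξ (psiL ξ p (ξ b)) = dbarStar ξ (dbar ξ (psiL ξ p (ξ b))) := by
      rw [boxBar, LinearMap.add_apply, Module.End.mul_apply, h.dbarStar_psiL, map_zero, zero_add]
      rfl
    rw [h4, h.isGeneratorFamily_psiL.dbar_eq]
    simp only [map_smul, map_sum, smul_mul_assoc, Finset.sum_mul]
    rw [Finset.sum_congr rfl h1, Finset.sum_add_distrib, Finset.sum_add_distrib,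
      sum_Icc_reflect p W]
    module
  rw [boxBar, LinearMap.add_apply, Module.End.mul_apply, Module.End.mul_apply, e1,
    h.isOddDer_dbar.leibniz, parity_psiL, map_add, Forms.neg_mul, Forms.end_neg, e2, e3]
  simp only [boxBar]
  abel

end Operators

section Operators

variable {𝔤 : Type*} [LieRing 𝔤] [LieAlgebra ℂ 𝔤] {θ : CompactForm 𝔤}
  {ξ : Module.Basis (Fin r) ℂ 𝔤}

/-! ### The operator `D` -/

theorem IsFourierBasis.dStar_psiL_eq_zero (h : IsFourierBasis θ ξ) (a : Fin r) {m p : ℤ}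
    (hp : p < m) (x : 𝔤) : dStar ξ a (-m) (psiL ξ p x) = 0 := by
  rcases lt_or_ge 0 p with h0 | h0
  · rw [h.dStar_psiL _ _ h0, sigmaL_of_neg ξ (by omega), smul_zero]
  · rw [psiL_of_nonpos ξ h0, map_zero]

theorem IsFourierBasis.bigD_psiL (h : IsFourierBasis θ ξ) {p : ℤ} (hp : 0 < p) (x : 𝔤) :
    bigD ξ (psiL ξ p x) = (∑ _m ∈ Finset.Icc 1 p, (1 / p : ℂ)) • psiL ξ p x := by
  have h1 : bigD ξ (psiL ξ p x) = ∑ a, ∑ m ∈ Finset.Icc 1 p,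
      if m ≤ p then (1 / p : ℂ) • psiL ξ p ⁅ξ a, ⁅ξ a, x⁆⁆ else 0 := by
    refine locSum_apply_eq_sum _ _ _ _ (fun a m => ?_) fun a m hm => if_neg (by omega)
    rw [Module.End.mul_apply]
    change d ξ a (-m) (dStar ξ a (-m) (psiL ξ p x)) = _
    split_ifs with hm
    · rw [h.dStar_psiL _ _ hp, map_smul, h.d_sigmaL _ _ (by omega), sub_neg_eq_add,
        neg_add_cancel_right]
    · rw [h.dStar_psiL_eq_zero _ (by omega), map_zero]
  rw [h1, Finset.sum_comm, Finset.sum_smul]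
  refine Finset.sum_congr rfl fun m hm => ?_
  simp only [(Finset.mem_Icc.1 hm).2, if_true, ← Finset.smul_sum, ← map_sum, h.casimir_adjoint]

theorem bigD_eq_zero {x : Forms r} (hx : ∀ a m, dStar ξ a m x = 0) : bigD ξ x = 0 := by
  rw [bigD, locSum_apply_eq_finset_sum _ _ ∅]
  · rfl
  · intro i _
    rw [Module.End.mul_apply, hx, map_zero]

theorem bigD_sigmaL (q : ℤ) (x : 𝔤) : bigD ξ (sigmaL ξ q x) = 0 :=
  bigD_eq_zero fun _ _ => dStar_sigmaL _ _ _ _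

theorem IsFourierBasis.bigD_sigmaL_mul_sigmaL (h : IsFourierBasis θ ξ) (p q : ℤ) (x y : 𝔤) :
    bigD ξ (sigmaL ξ p x * sigmaL ξ q y) = 0 :=
  bigD_eq_zero fun a m => by
    rw [(h.isOddDer_dStar a m).leibniz, dStar_sigmaL, dStar_sigmaL, zero_mul, mul_zero, add_zero]

theorem IsFourierBasis.bigD_psiL_mul_psiL (h : IsFourierBasis θ ξ) (p q : ℤ) (x y : 𝔤) :
    bigD ξ (psiL ξ p x * psiL ξ q y) =
      bigD ξ (psiL ξ p x) * psiL ξ q y + psiL ξ p x * bigD ξ (psiL ξ q y) := by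
  have := locSum_mul_apply ((locFin_dStar ξ).comp fun i : Fin r × ℕ+ => d ξ i.1 (-i.2)) 0 0
    (psiL ξ p x) (psiL ξ q y) (N₁ := 0) (N₂ := 0) (fun a m => ?_) (fun _ _ _ => rfl)
    fun _ _ _ => rfl
  · rw [bigD, this]
    simp
  · simp only [Module.End.mul_apply, (h.isOddDer_dStar _ _).leibniz, (h.isOddDer_d _ _).leibniz,
      (h.isOddDer_dStar _ _).par, parity_psiL, map_add, d_psiL, Forms.neg_mul, Forms.end_neg,
      Forms.neg_neg, mul_zero, zero_mul, zero_add, add_zero, Pi.zero_apply]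

/-- The bracket of an odd and an even generator under `D`, the only one which does not vanish. -/
theorem IsFourierBasis.bigD_psiL_mul_sigmaL (h : IsFourierBasis θ ξ) {p q : ℤ} (hp : 0 < p)
    (hq : 0 ≤ q) (x y : 𝔤) :
    bigD ξ (psiL ξ p x * sigmaL ξ q y) = bigD ξ (psiL ξ p x) * sigmaL ξ q y +
      (1 / p : ℂ) • ∑ m ∈ Finset.Icc 1 p, nestSum ξ (psiL ξ) (sigmaL ξ) (p + q) x y (q + m) := by
  have := locSum_mul_apply ((locFin_dStar ξ).comp fun i : Fin r × ℕ+ => d ξ i.1 (-i.2))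
    (fun a m => (1 / p : ℂ) • (psiL ξ (q + m) ⁅ξ a, y⁆ * sigmaL ξ (p + q - (q + m)) ⁅ξ a, x⁆)) 0
    (psiL ξ p x) (sigmaL ξ q y) (N₁ := p) (N₂ := 0) (fun a m => ?_) (fun a m hm => ?_)
    fun _ _ _ => rfl
  · have h0 : bigD ξ (sigmaL ξ q y) = 0 := bigD_sigmaL q y
    rw [bigD] at h0
    rw [bigD, this, h0, mul_zero, add_zero]
    congr 1
    simp only [Pi.zero_apply, Finset.sum_const_zero, add_zero, Finset.smul_sum, h.nestSum_eq]
  · simp only [Module.End.mul_apply, (h.isOddDer_dStar _ _).leibniz, (h.isOddDer_d _ _).leibniz,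
      (h.isOddDer_dStar _ _).par, parity_psiL, dStar_sigmaL, map_zero, mul_zero, add_zero,
      Pi.zero_apply, h.d_sigmaL _ _ hq, Forms.end_neg, Forms.neg_neg]
    rw [h.dStar_psiL _ _ hp, smul_mul_assoc, sigmaL_mul,
      show p + q - (q + (m : ℤ)) = p + -m by ring, sub_neg_eq_add]
  · rw [sigmaL_of_neg ξ (p := p + q - (q + m)) (by omega), mul_zero, smul_zero]

/-! ### The term which vanishes on invariants -/

variable (ξ) in
/-- The derivation `ψᵇ(n) ↦ ψ^{[a,b]}(n) / n`, `σᵇ(n) ↦ 0`. -/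
def adDiv (a : Fin r) : Module.End ℂ (Forms r) := der (fun b n => (1 / n : ℂ) • psiBr ξ a b n) 0

variable (ξ) in
/-- The difference between `∂̄ ∂̄* + ∂̄* ∂̄` and `□ + D`: a sum of multiples of the operators by
which `𝔤` acts, hence zero on the invariants. -/
def invariantDefect : Module.End ℂ (Forms r) := ∑ a, adDiv ξ a * lieAct ξ a

theorem IsFourierBasis.isEvenDer_adDiv (h : IsFourierBasis θ ξ) (a : Fin r) :
    IsEvenDer (adDiv ξ a) :=
  isEvenDer_der (fun b n => by rw [h.psiBr_eq, map_smul, parity_psiL, Forms.smul_neg])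
    (fun b n => by simp)

theorem adDiv_sigmaL (a : Fin r) (p : ℤ) (x : 𝔤) : adDiv ξ a (sigmaL ξ p x) = 0 :=
  der_zero_sigmaL _ p x

theorem IsFourierBasis.adDiv_psiL (h : IsFourierBasis θ ξ) (a : Fin r) {p : ℤ} (hp : 0 < p)
    (x : 𝔤) : adDiv ξ a (psiL ξ p x) = -(1 / p : ℂ) • psiL ξ p ⁅ξ a, x⁆ :=
  der_psiL _ _ hp (-(1 / p : ℂ) • (psiL ξ p ∘ₗ LieModule.toEnd ℂ 𝔤 𝔤 (ξ a)))
    (fun b => by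
      rw [h.psiBr_eq, neg_neg]
      push_cast
      rw [div_neg]
      rfl) x

theorem IsFourierBasis.isSecondOrder_invariantDefect (h : IsFourierBasis θ ξ) :
    IsSecondOrder (invariantDefect ξ) :=
  .sum fun a _ => (h.isEvenDer_adDiv a).mul_isSecondOrder (h.isEvenDer_lieAct a)

theorem IsFourierBasis.invariantDefect_psiL (h : IsFourierBasis θ ξ) {p : ℤ} (hp : 0 < p)
    (x : 𝔤) : invariantDefect ξ (psiL ξ p x) = -(1 / p : ℂ) • psiL ξ p x := by
  simp only [invariantDefect, LinearMap.sum_apply, Module.End.mul_apply, h.lieAct_psiL,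
    h.adDiv_psiL _ hp]
  rw [← Finset.smul_sum, ← map_sum, h.casimir_adjoint]

theorem IsFourierBasis.invariantDefect_sigmaL (h : IsFourierBasis θ ξ) (p : ℤ) (x : 𝔤) :
    invariantDefect ξ (sigmaL ξ p x) = 0 := by
  simp only [invariantDefect, LinearMap.sum_apply, Module.End.mul_apply, h.lieAct_sigmaL,
    adDiv_sigmaL, Finset.sum_const_zero]

theorem IsFourierBasis.invariantDefect_mul (h : IsFourierBasis θ ξ) (u v : Forms r) :
    invariantDefect ξ (u * v) = invariantDefect ξ u * v + u * invariantDefect ξ v +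
      (∑ a, adDiv ξ a u * lieAct ξ a v + ∑ a, lieAct ξ a u * adDiv ξ a v) := by
  simp only [invariantDefect, LinearMap.sum_apply, Module.End.mul_apply, Finset.sum_mul,
    Finset.mul_sum, ← Finset.sum_add_distrib]
  refine Finset.sum_congr rfl fun a _ => ?_
  rw [(h.isEvenDer_lieAct a).leibniz, map_add, (h.isEvenDer_adDiv a).leibniz,
    (h.isEvenDer_adDiv a).leibniz]
  abel

theorem IsFourierBasis.invariantDefect_psiL_mul_sigmaL (h : IsFourierBasis θ ξ) {p : ℤ}
    (hp : 0 < p) (q : ℤ) (x y : 𝔤) :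
    invariantDefect ξ (psiL ξ p x * sigmaL ξ q y) =
      invariantDefect ξ (psiL ξ p x) * sigmaL ξ q y -
        (1 / p : ℂ) • lieSum ξ (psiL ξ) (sigmaL ξ) (p + q) x y p := by
  rw [h.invariantDefect_mul, h.invariantDefect_sigmaL, mul_zero, add_zero,
    Forms.sub_eq_add_neg, ← Forms.neg_smul]
  congr 1
  simp only [adDiv_sigmaL, mul_zero, Finset.sum_const_zero, add_zero, h.adDiv_psiL _ hp,
    h.lieAct_sigmaL, smul_mul_assoc, lieSum, Finset.smul_sum, add_sub_cancel_left]

theorem IsFourierBasis.invariantDefect_psiL_mul_psiL (h : IsFourierBasis θ ξ) {p q : ℤ}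
    (hp : 0 < p) (hq : 0 < q) (x y : 𝔤) :
    invariantDefect ξ (psiL ξ p x * psiL ξ q y) =
      invariantDefect ξ (psiL ξ p x) * psiL ξ q y + psiL ξ p x * invariantDefect ξ (psiL ξ q y) +
        (-(1 / p : ℂ) + -(1 / q : ℂ)) • lieSum ξ (psiL ξ) (psiL ξ) (p + q) x y p := by
  rw [h.invariantDefect_mul, add_smul]
  simp only [h.adDiv_psiL _ hp, h.adDiv_psiL _ hq, h.lieAct_psiL, smul_mul_assoc, mul_smul_comm,
    lieSum, Finset.smul_sum, add_sub_cancel_left]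

theorem IsFourierBasis.invariantDefect_sigmaL_mul_sigmaL (h : IsFourierBasis θ ξ) (p q : ℤ)
    (x y : 𝔤) : invariantDefect ξ (sigmaL ξ p x * sigmaL ξ q y) = 0 := by
  rw [h.invariantDefect_mul]
  simp only [h.invariantDefect_sigmaL, adDiv_sigmaL, mul_zero, zero_mul, Finset.sum_const_zero,
    add_zero]

/-! ### The formula for the Laplacian -/

/-- The bracket of two even generators under the Laplacian `∂̄ ∂̄* + ∂̄* ∂̄`. -/
theorem IsFourierBasis.boxBar_sigmaL_mul_sigmaL (h : IsFourierBasis θ ξ) {p q : ℤ} (hp : 0 ≤ p)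
    (hq : 0 ≤ q) (b b' : Fin r) :
    boxBar ξ (sigmaL ξ p (ξ b) * sigmaL ξ q (ξ b')) =
      boxBar ξ (sigmaL ξ p (ξ b)) * sigmaL ξ q (ξ b') +
        sigmaL ξ p (ξ b) * boxBar ξ (sigmaL ξ q (ξ b')) +
      (∑ m ∈ Finset.Icc 1 p, (1 / m : ℂ) •
          lieSum ξ (sigmaL ξ) (sigmaL ξ) (p + q) (ξ b) (ξ b') (p - m) +
        ∑ m ∈ Finset.Icc 1 q, (1 / m : ℂ) •
          lieSum ξ (sigmaL ξ) (sigmaL ξ) (p + q) (ξ b) (ξ b') (p + m)) := by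
  have e1 : ∀ q' x, boxBar ξ (sigmaL ξ q' x) = dbarStar ξ (dbar ξ (sigmaL ξ q' x)) :=
    fun q' x => by
      rw [boxBar, LinearMap.add_apply, Module.End.mul_apply, h.dbarStar_sigmaL, map_zero, zero_add]
      rfl
  have e2 : ∀ {p'} (_ : 0 ≤ p') (q' : ℤ) (a a' : Fin r),
      dbarStar ξ (sigmaL ξ p' (ξ a) * dbar ξ (sigmaL ξ q' (ξ a'))) =
        ∑ m ∈ Finset.Icc 1 q', (1 / m : ℂ) •
          lieSum ξ (sigmaL ξ) (sigmaL ξ) (p' + q') (ξ a) (ξ a') (p' + m) +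
        sigmaL ξ p' (ξ a) * boxBar ξ (sigmaL ξ q' (ξ a')) := by
    intro p' hp' q' a a'
    rw [h.dbarStar_sigmaL_mul _ hp', e1, h.dbar_sigmaL le_rfl, Finset.sum_comm]
    congr 1
    rw [map_sum, ← Finset.sum_neg_distrib]
    refine Finset.sum_congr rfl fun m hm => ?_
    rw [Finset.mem_Icc] at hm
    rw [map_sum, ← Finset.sum_neg_distrib, lieSum, Finset.smul_sum]
    refine Finset.sum_congr rfl fun e _ => ?_
    rw [(h.isOddDer_dStar _ _).leibniz, dStar_sigmaL, mul_zero, add_zero,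
      h.dStar_psiL _ _ (by omega), ← lie_skew, map_neg, Forms.smul_neg, Forms.neg_mul,
      Forms.neg_neg, smul_mul_assoc, add_comm m p', show p' + q' - (p' + m) = q' - m by ring]
  have e3 : ∀ m, lieSum ξ (sigmaL ξ) (sigmaL ξ) (q + p) (ξ b') (ξ b) (q + m) =
      lieSum ξ (sigmaL ξ) (sigmaL ξ) (p + q) (ξ b) (ξ b') (p - m) := fun m => by
    refine Finset.sum_congr rfl fun e _ => ?_
    rw [sigmaL_mul, show q + p - (q + m) = p - m by ring, show p + q - (p - m) = q + m by ring]
  have e4 : dbarStar ξ (sigmaL ξ p (ξ b) * sigmaL ξ q (ξ b')) = 0 := by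
    rw [h.dbarStar_sigmaL_mul _ hp, dStar_sigmaL, h.dbarStar_sigmaL, mul_zero, Forms.neg_zero,
      add_zero]
  rw [boxBar, LinearMap.add_apply, Module.End.mul_apply, e4, map_zero, zero_add,
    Module.End.mul_apply, h.isOddDer_dbar.leibniz, parity_sigmaL, map_add,
    ← sigmaL_mul ξ q (ξ b') (dbar ξ (sigmaL ξ p (ξ b))), e2 hp, e2 hq, sigmaL_mul]
  simp only [e3, boxBar]
  abel

/-- The formula for the Laplacian on all of `Λ ⊗ S`. -/
theorem IsFourierBasis.boxBar_eq (h : IsFourierBasis θ ξ) :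
    boxBar ξ = box ξ + bigD ξ + invariantDefect ξ := by
  have hP := h.isGeneratorFamily_psiL
  have hS := h.isGeneratorFamily_sigmaL
  have gp : ∀ b {p : ℤ}, 0 < p → boxBar ξ (psiL ξ p (ξ b)) =
      box ξ (psiL ξ p (ξ b)) + bigD ξ (psiL ξ p (ξ b)) + invariantDefect ξ (psiL ξ p (ξ b)) := by
    intro b p hp
    rw [hP.boxBar_apply h, hP.box_apply h (by omega), h.bigD_psiL hp, h.invariantDefect_psiL hp,
      ← add_smul, ← add_smul, ← scalar_sum_psi hp]
    push_cast
    simp only [sub_neg_eq_add]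
  have gs : ∀ b {q : ℤ}, 0 ≤ q → boxBar ξ (sigmaL ξ q (ξ b)) = box ξ (sigmaL ξ q (ξ b)) := by
    intro b q hq
    rw [hS.boxBar_apply h, hS.box_apply h hq, one_mul]
  have key := ((h.isSecondOrder_boxBar.sub h.isSecondOrder_box).sub h.isSecondOrder_bigD).sub
    h.isSecondOrder_invariantDefect
  have e : ∀ x, boxBar ξ x = box ξ x + bigD ξ x + invariantDefect ξ x →
      (boxBar ξ - box ξ - bigD ξ - invariantDefect ξ) x = 0 := fun x hx => by
    simp only [LinearMap.sub_apply, hx]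
    abel
  have h0 := key.eq_zero (fun b n hn => e _ ?_) (fun b n hn => e _ ?_)
    (fun b n b' n' hn hn' => e _ ?_) (fun b n b' n' hn hn' => e _ ?_)
    (fun b n b' n' hn hn' => e _ ?_)
  · refine LinearMap.ext fun x => ?_
    have h1 := LinearMap.congr_fun h0 x
    simp only [LinearMap.sub_apply, LinearMap.zero_apply, sub_eq_iff_eq_add, zero_add] at h1
    simp only [h1, LinearMap.add_apply]
    abel
  · rw [psi_eq_psiL ξ]
    exact gp _ (by omega)
  · rw [sigma_eq_sigmaL ξ, gs _ (by omega), bigD_sigmaL, h.invariantDefect_sigmaL, add_zero,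
      add_zero]
  · have hp : 0 < -n := by omega
    have hq : 0 < -n' := by omega
    rw [psi_eq_psiL ξ, psi_eq_psiL ξ]
    generalize -n = p at hp ⊢
    generalize -n' = q at hq ⊢
    have := bracket_sum_odd_odd (lieSum ξ (psiL ξ) (psiL ξ) (p + q) (ξ b) (ξ b')) hp hq
    rw [hP.boxBar_psiL_mul h hp (by omega), hP.box_mul h hP (by omega) (by omega),
      h.bigD_psiL_mul_psiL, h.invariantDefect_psiL_mul_psiL hp hq, gp _ hp, gp _ hq]
    simp only [h.nestSum_psiL, Int.cast_neg, sub_neg_eq_add, add_mul, mul_add]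
    rw [this]
    abel
  · have hp : 0 < -n := by omega
    have hq : 0 ≤ -n' := by omega
    rw [psi_eq_psiL ξ, sigma_eq_sigmaL ξ]
    generalize -n = p at hp ⊢
    generalize -n' = q at hq ⊢
    have := bracket_sum_odd_even (lieSum ξ (psiL ξ) (sigmaL ξ) (p + q) (ξ b) (ξ b'))
      (nestSum ξ (psiL ξ) (sigmaL ξ) (p + q) (ξ b) (ξ b')) hp hq
    rw [hS.boxBar_psiL_mul h hp hq, hP.box_mul h hS (by omega) hq, h.bigD_psiL_mul_sigmaL hp hq,
      h.invariantDefect_psiL_mul_sigmaL hp, gp _ hp, gs _ hq]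
    simp only [one_smul, mul_one, add_mul, sub_zero]
    rw [this]
    abel
  · have hp : 0 ≤ -n := by omega
    have hq : 0 ≤ -n' := by omega
    rw [sigma_eq_sigmaL ξ, sigma_eq_sigmaL ξ, h.boxBar_sigmaL_mul_sigmaL hp hq,
      hS.box_mul h hS hp hq, h.bigD_sigmaL_mul_sigmaL, h.invariantDefect_sigmaL_mul_sigmaL,
      gs _ hp, gs _ hq]
    simp only [mul_one, add_zero, sub_zero]

theorem IsFourierBasis.boxBar_apply_of_mem_koszul (h : IsFourierBasis θ ξ) {x : Forms r}
    (hx : x ∈ koszul ξ) : boxBar ξ x = box ξ x + bigD ξ x := by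
  have h1 : invariantDefect ξ x = 0 := by
    rw [invariantDefect, LinearMap.sum_apply]
    refine Finset.sum_eq_zero fun a _ => ?_
    rw [Module.End.mul_apply, LinearMap.mem_ker.1 ((Submodule.mem_iInf _).1 hx a), map_zero]
  rw [h.boxBar_eq, LinearMap.add_apply, LinearMap.add_apply, h1, add_zero]

end Operators

/-! ### Harmonic cocycles -/

/-- A locally finite sum of operators `Y* Y` is positive, and its quadratic form vanishes only on
the joint kernel of the operators `Y`. -/
theorem herm_locSum_adj_mul {ι : Type*} {F X Y : ι → Module.End ℂ (Forms r)} (hF : LocFin F)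
    (hFXY : ∀ i, ∃ c : ℝ, 0 < c ∧ F i = (c : ℂ) • (X i * Y i)) (hXY : ∀ i, IsAdj (Y i) (X i))
    (x : Forms r) :
    0 ≤ (herm x (locSum F hF x)).re ∧
      ((herm x (locSum F hF x)).re = 0 → ∀ i, Y i x = 0) := by
  classical
  have key : ∀ i, 0 ≤ (herm x (F i x)).re ∧ ((herm x (F i x)).re = 0 → Y i x = 0) := by
    intro i
    obtain ⟨c, hc, hi⟩ := hFXY i
    rw [hi, LinearMap.smul_apply, Module.End.mul_apply, herm_smul_right, ← hXY i,
      Complex.re_ofReal_mul]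
    refine ⟨mul_nonneg hc.le (herm_self_re_nonneg _), fun h0 => eq_zero_of_herm_self ?_⟩
    exact (mul_eq_zero.1 h0).resolve_left hc.ne'
  have hsum : ∀ i, (herm x (locSum F hF x)).re =
      ∑ j ∈ insert i (hF x).toFinset, (herm x (F j x)).re := by
    intro i
    rw [locSum_apply_eq_finset_sum hF x (insert i (hF x).toFinset) fun j hj => ?_,
      herm_sum_right, Complex.re_sum]
    by_contra hc
    exact hj (Finset.mem_insert_of_mem (by simpa using hc))
  constructor
  · rw [locSum_apply_eq_finset_sum hF x (hF x).toFinset fun j hj => by simpa using hj,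
      herm_sum_right, Complex.re_sum]
    exact Finset.sum_nonneg fun i _ => (key i).1
  · intro h0 i
    rw [hsum i, Finset.sum_eq_zero_iff_of_nonneg fun j _ => (key j).1] at h0
    exact (key i).2 (h0 i (Finset.mem_insert_self _ _))

section Operators

variable {𝔤 : Type*} [LieRing 𝔤] [LieAlgebra ℂ 𝔤] {θ : CompactForm 𝔤}
  {ξ : Module.Basis (Fin r) ℂ 𝔤}

theorem IsFourierBasis.herm_box (h : IsFourierBasis θ ξ) (x : Forms r) :
    0 ≤ (herm x (box ξ x)).re ∧ ((herm x (box ξ x)).re = 0 →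
      ∀ i : Fin r × ℕ+, (R ξ i.1 i.2 + adStar ξ i.1 (-i.2)) x = 0) := by
  refine herm_locSum_adj_mul
    (F := fun i : Fin r × ℕ+ => ((1 / (i.2 : ℂ)) • (R ξ i.1 (-i.2) + ad ξ i.1 (-i.2))) *
      (R ξ i.1 i.2 + adStar ξ i.1 (-i.2)))
    (X := fun i => R ξ i.1 (-i.2) + ad ξ i.1 (-i.2))
    (Y := fun i => R ξ i.1 i.2 + adStar ξ i.1 (-i.2))
    (((locFin_R ξ).add (locFin_adStar ξ)).comp _) (fun i => ?_)
    (fun i => (h.isAdj_R _ _).add (h.isAdj_ad _ _).symm) x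
  refine ⟨1 / (i.2 : ℝ), by positivity, ?_⟩
  rw [smul_mul_assoc]
  push_cast
  rfl

theorem IsFourierBasis.herm_bigD (h : IsFourierBasis θ ξ) (x : Forms r) :
    0 ≤ (herm x (bigD ξ x)).re ∧ ((herm x (bigD ξ x)).re = 0 →
      ∀ i : Fin r × ℕ+, dStar ξ i.1 (-i.2) x = 0) := by
  refine herm_locSum_adj_mul (F := fun i : Fin r × ℕ+ => d ξ i.1 (-i.2) * dStar ξ i.1 (-i.2))
    (X := fun i => d ξ i.1 (-i.2)) (Y := fun i => dStar ξ i.1 (-i.2))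
    ((locFin_dStar ξ).comp _) (fun i => ⟨1, one_pos, ?_⟩)
    (fun i => (h.isAdj_d _ _).symm) x
  rw [Complex.ofReal_one, one_smul]

/-- A form killed by the Laplacian is closed. -/
theorem IsFourierBasis.dbar_eq_zero (h : IsFourierBasis θ ξ) {x : Forms r}
    (hx : boxBar ξ x = 0) : dbar ξ x = 0 := by
  have h1 : herm x (boxBar ξ x) =
      herm (dbarStar ξ x) (dbarStar ξ x) + herm (dbar ξ x) (dbar ξ x) := by
    rw [boxBar, LinearMap.add_apply, herm_add_right, Module.End.mul_apply, Module.End.mul_apply,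
      ← h.isAdj_dbar.symm x, ← h.isAdj_dbar x]
  have h2 := congrArg Complex.re h1
  rw [hx, herm_zero_right, Complex.zero_re, Complex.add_re] at h2
  have h3 := herm_self_re_nonneg (dbarStar ξ x)
  have h4 := herm_self_re_nonneg (dbar ξ x)
  exact eq_zero_of_herm_self (by linarith)

variable (ξ) in
/-- The joint kernel of the derivations `d_a(-m)*`, `m > 0`, and `R_a(m) + ad_a(-m)*`, `m ≥ 0`. -/
def IsJointKernel (x : Forms r) : Prop :=
  (∀ (a : Fin r) (m : ℤ), 0 < m → dStar ξ a (-m) x = 0) ∧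
    ∀ (a : Fin r) (m : ℤ), 0 ≤ m → (R ξ a m + adStar ξ a (-m)) x = 0

theorem exists_pnat_of_pos {m : ℤ} (hm : 0 < m) : ∃ k : ℕ+, m = k :=
  ⟨⟨m.toNat, by omega⟩, by simp only [PNat.mk_coe]; omega⟩

/-- The harmonic cocycles are the joint kernel. -/
theorem IsFourierBasis.isHarmonic_iff (h : IsFourierBasis θ ξ) (x : Forms r) :
    IsHarmonic ξ x ↔ IsJointKernel ξ x := by
  constructor
  · rintro ⟨hx, -, hbox⟩
    rw [h.boxBar_apply_of_mem_koszul hx] at hbox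
    have h1 := congrArg (fun y => (herm x y).re) hbox
    simp only [herm_add_right, herm_zero_right, Complex.add_re, Complex.zero_re] at h1
    have hB := h.herm_box x
    have hD := h.herm_bigD x
    refine ⟨fun a m hm => ?_, fun a m hm => ?_⟩
    · obtain ⟨k, rfl⟩ := exists_pnat_of_pos hm
      exact hD.2 (by linarith [hB.1, hD.1]) (a, k)
    · rcases hm.eq_or_lt with rfl | hm
      · rw [neg_zero, adStar_zero]
        exact (Submodule.mem_iInf _).1 hx a
      · obtain ⟨k, rfl⟩ := exists_pnat_of_pos hm
        exact hB.2 (by linarith [hB.1, hD.1]) (a, k)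
  · rintro ⟨hD, hB⟩
    have hx : x ∈ koszul ξ := (Submodule.mem_iInf _).2 fun a => by
      have := hB a 0 le_rfl
      rwa [neg_zero, adStar_zero] at this
    have h1 : bigD ξ x = 0 := by
      rw [bigD, locSum_apply_eq_finset_sum _ _ ∅ fun i _ => ?_, Finset.sum_empty]
      rw [Module.End.mul_apply, hD _ _ (by exact_mod_cast i.2.pos), map_zero]
    have h2 : box ξ x = 0 := by
      rw [box, locSum_apply_eq_finset_sum _ _ ∅ fun i _ => ?_, Finset.sum_empty]
      rw [Module.End.mul_apply, hB _ _ (by positivity), map_zero]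
    have h3 : boxBar ξ x = 0 := by rw [h.boxBar_apply_of_mem_koszul hx, h1, h2, add_zero]
    exact ⟨hx, h.dbar_eq_zero h3, h3⟩

/-- The joint kernel, as a subalgebra: the operators which define it are derivations. -/
def IsFourierBasis.jointKernel (h : IsFourierBasis θ ξ) : Subalgebra ℂ (Forms r) where
  carrier := {x | IsJointKernel ξ x}
  add_mem' hx hy := ⟨fun a m hm => by rw [map_add, hx.1 a m hm, hy.1 a m hm, add_zero],
    fun a m hm => by rw [map_add, hx.2 a m hm, hy.2 a m hm, add_zero]⟩
  mul_mem' hx hy := ⟨fun a m hm => by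
      rw [(h.isOddDer_dStar _ _).leibniz, hx.1 a m hm, hy.1 a m hm, zero_mul, mul_zero, add_zero],
    fun a m hm => by
      rw [((h.isEvenDer_R _ _).add (h.isEvenDer_adStar _ _)).leibniz, hx.2 a m hm, hy.2 a m hm,
        zero_mul, mul_zero, add_zero]⟩
  algebraMap_mem' c := by
    rw [Algebra.algebraMap_eq_smul_one]
    exact ⟨fun a m hm => by rw [map_smul, (h.isOddDer_dStar _ _).map_one, smul_zero],
      fun a m hm => by
        rw [map_smul, ((h.isEvenDer_R _ _).add (h.isEvenDer_adStar _ _)).map_one, smul_zero]⟩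

theorem IsFourierBasis.dbar_mem_koszul (h : IsFourierBasis θ ξ) {x : Forms r}
    (hx : x ∈ koszul ξ) : dbar ξ x ∈ koszul ξ :=
  (Submodule.mem_iInf _).2 fun a => by
    have h1 := LinearMap.congr_fun (h.dbar_lieAct a) x
    rw [Module.End.mul_apply, LinearMap.mem_ker.1 ((Submodule.mem_iInf _).1 hx a), map_zero] at h1
    exact h1.symm

theorem IsFourierBasis.dbarStar_mem_koszul (h : IsFourierBasis θ ξ) {x : Forms r}
    (hx : x ∈ koszul ξ) : dbarStar ξ x ∈ koszul ξ :=
  (Submodule.mem_iInf _).2 fun a => by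
    have h1 := h.dbarStar_lieAct a x
    rw [LinearMap.mem_ker.1 ((Submodule.mem_iInf _).1 hx a), map_zero] at h1
    exact h1.symm

end Operators

end LoopKoszul

end

open LoopKoszul
theorem theorem3p3 {𝔤 : Type*} [LieRing 𝔤] [LieAlgebra ℂ 𝔤] [LieAlgebra.IsSemisimple ℂ 𝔤]
    (θ : CompactForm 𝔤) {r : ℕ} (ξ : Module.Basis (Fin r) ℂ 𝔤) (hξ : IsFourierBasis θ ξ) :
    -- the starred operators are the hermitian adjoints
    ((∀ a m, IsAdj (ad ξ a m) (adStar ξ a m)) ∧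
      (∀ a m, IsAdj (R ξ a m) (R ξ a (-m))) ∧
      (∀ a m, IsAdj (d ξ a m) (dStar ξ a m)) ∧
      (∀ (a : Fin r) (m : ℕ+), IsAdj (lmul (psi a (-m))) (psiStar a m)) ∧
      IsAdj (dbar ξ) (dbarStar ξ)) ∧
    -- `C` is a complex under `∂̄`, and is preserved by `∂̄*`
    (∀ x ∈ koszul ξ, dbar ξ x ∈ koszul ξ ∧ dbarStar ξ x ∈ koszul ξ ∧ dbar ξ (dbar ξ x) = 0) ∧
    -- the formula for the Laplacian
    (∀ x ∈ koszul ξ, boxBar ξ x = box ξ x + bigD ξ x) ∧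
    -- the harmonic cocycles are a joint kernel in `Λ ⊗ S`
    (∀ x : Forms r, IsHarmonic ξ x ↔
      (∀ (a : Fin r) (m : ℤ), 0 < m → dStar ξ a (-m) x = 0) ∧
      (∀ (a : Fin r) (m : ℤ), 0 ≤ m → (R ξ a m + adStar ξ a (-m)) x = 0)) ∧
    -- they form a subalgebra
    (∃ H : Subalgebra ℂ (Forms r), ∀ x, x ∈ H ↔ IsHarmonic ξ x) :=
  ⟨⟨hξ.isAdj_ad, hξ.isAdj_R, hξ.isAdj_d, isAdj_lmul_psi_psiStar, hξ.isAdj_dbar⟩,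
    fun _ hx => ⟨hξ.dbar_mem_koszul hx, hξ.dbarStar_mem_koszul hx, hξ.dbar_dbar _⟩,
    fun _ hx => hξ.boxBar_apply_of_mem_koszul hx,
    hξ.isHarmonic_iff,
    ⟨hξ.jointKernel, fun x => (hξ.isHarmonic_iff x).symm⟩⟩
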